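/- A graph on $n$ vertices is called a Dirac graph if its minimum degree is at least $n/2$. For a graph $G$ and $p\in[0,1]$, let $G_p$ be the random subgraph of $G$ on the same vertex set obtained by keeping each edge of $G$ independently with probability $p$; $\log$ is the natural logarithm. (1) There is an absolute constant $C>0$ such that for every $\eta>0$ there is an $N$ such that for all $n\ge N$, every Dirac graph $G$ on $n$ vertices and every $p\in[0,1]$ with $p\ge \frac{C\log n}{n}$, $$\Pr\bigl[G_p \text{ is Hamiltonian}\bigr]\ge 1-\eta .$$ That is, $G_p$ is asymptotically almost surely Hamiltonian, uniformly in $G$ and $p$. (2) This is tight up to the constant $C$: for every constant $c<1$ and every $\eta>0$ there is an $N$ such that for all $n\ge N$, every Dirac graph $G$ on $n$ vertices and every $p\in[0,1]$ with $p\le \frac{c\log n}{n}$, $$\Pr\bigl[G_p \text{ has an isolated vertex}\bigr]\ge 1-\eta\quad\text{and}\quad \Pr\bigl[G_p \text{ is not Hamiltonian}\bigr]\ge 1-\eta .$$ -/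

import Mathlib

open MeasureTheory ProbabilityTheory

/-- The law of the random subgraph `G_p`: the random graph on the vertex set of `G` in which each
edge of `G` is kept independently with probability `p` (and there are no other edges).
It is the image, under "the graph with edge set `S`", of the law of the random set `S` that
contains each element of `G.edgeSet` independently with probability `p`. -/
noncomputable def SimpleGraph.randomSubgraph {V : Type*} (G : SimpleGraph V) (p : unitInterval) :
    Measure (SimpleGraph V) :=
  (setBernoulli G.edgeSet p).map SimpleGraph.fromEdgeSet

instance SimpleGraph.isProbabilityMeasure_randomSubgraph {V : Type*} [Countable V]
    (G : SimpleGraph V) (p : unitInterval) : IsProbabilityMeasure (G.randomSubgraph p) :=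
  Measure.isProbabilityMeasure_map SimpleGraph.measurable_fromEdgeSet.aemeasurable

/-- A Dirac graph: a finite graph on `n` vertices with minimum degree at least `n / 2`. -/
def SimpleGraph.IsDirac {V : Type*} [Fintype V] (G : SimpleGraph V) [DecidableRel G.Adj] : Prop :=
  (Fintype.card V : ℝ) / 2 ≤ G.minDegree

open Finset

/-! Hamiltonicity is deduced from a spread measure. A probability distribution on the Hamilton
cycles of `G` is `q`-spread if a random cycle contains any given edge set `S` with probability at
most `q ^ #S`. By weak duality such a distribution forces every cover of the family of Hamilton
cycles to have `q`-cost at least `1` (`HasSpread.coverCost`), and the minimum-fragment argument of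
Park and Pham (`failProb_le_of_coverCost`) shows that a family of `n`-element sets without a cheap
cover is hit by a random set of density `O(q log n)`. So it suffices to find an `O(1/n)`-spread
distribution in every large Dirac graph (`exists_hasSpread_hamCycles`).

Spread comes from switching. Delete one edge of a Hamilton cycle and reclose the resulting path
after at most two Pósa rotations. Such a move has three coordinates, and `Flexible` says that a
positive proportion of the `3 * n ^ 3` moves succeeds, even when a small set of edges is protected.
Conversely, once the ends of the deleted edge are known, the new cycle determines the old one and
the move up to the mode and one coordinate (`Move.cancel`). Comparing the two counts, each
prescribed edge costs a factor `O(1/n)`, as long as `#S` is a small multiple of `n`. For larger `S`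
the count is compared with the complete graph; the exponential loss is harmless because `#S` is
linear in `n` (`Flexible.spread`).

If only few moves close some path of a graph of minimum degree `n / 2`, the graph is close to two
disjoint cliques or to a balanced complete bipartite graph (`extremal_of_stuck`,
`flexible_of_not_nearExtremal`). In these extremal cases the graph is nearly complete inside a host
of that shape, which again makes it flexible (`flexible_of_nearComplete`), except that a Hamilton
cycle may need edges outside the host: two disjoint crossing edges between the cliques, or a
matching inside the larger side that makes up for the imbalance. The minimum degree supplies these
edges in a spread way. They are chosen at random first, then a random cycle through them, and the
mixture is still spread (`hasSpread_mix`).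

For the tightness, the number of isolated vertices has mean tending to infinity when `p ≤ c log n /
n` with `c < 1`. Two vertices share at most one edge, so the second moment method gives an isolated
vertex, which excludes a Hamilton cycle. -/

/-- The probability that a `p`-random subset of `E` equals `W`. -/
noncomputable def bernWeight {E : Type*} [Fintype E] (p : ℝ) (W : Finset E) : ℝ :=
  p ^ #W * (1 - p) ^ (Fintype.card E - #W)

/-! ### Random subsets, minimum fragments and the fractional expectation threshold. -/

section bernWeight
variable {E : Type*} [Fintype E]

theorem bernWeight_nonneg {p : ℝ} (h0 : 0 ≤ p) (h1 : p ≤ 1) (W : Finset E) :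
    0 ≤ bernWeight p W :=
  mul_nonneg (pow_nonneg h0 _) (pow_nonneg (by linarith) _)

theorem sum_bernWeight (p : ℝ) : ∑ W : Finset E, bernWeight p W = 1 := by
  simp [bernWeight, Fintype.sum_pow_mul_eq_add_pow]

variable [DecidableEq E]

/-- The union of independent `p₁`- and `p₂`-random sets is random with density `p₁ + p₂ - p₁ * p₂`.
A pair with union `W` is a set `W₁ ⊆ W` together with an arbitrary `X ⊆ W₁`, the second set being
`(W \ W₁) ∪ X`; summing over `X` and then over `W₁` uses the binomial theorem twice. -/
theorem sum_bernWeight_fiber_union (p₁ p₂ : ℝ) (W : Finset E) :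
    ∑ x : Finset E × Finset E with x.1 ∪ x.2 = W, bernWeight p₁ x.1 * bernWeight p₂ x.2 =
      bernWeight (p₁ + p₂ - p₁ * p₂) W := by
  have key : ∑ x : Finset E × Finset E with x.1 ∪ x.2 = W,
      bernWeight p₁ x.1 * bernWeight p₂ x.2 =
      ∑ y ∈ W.powerset.sigma fun W₁ => W₁.powerset,
        bernWeight p₁ y.1 * bernWeight p₂ ((W \ y.1) ∪ y.2) := by
    refine Finset.sum_nbij' (fun x => ⟨x.1, x.2 ∩ x.1⟩) (fun y => (y.1, (W \ y.1) ∪ y.2))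
      ?_ ?_ ?_ ?_ ?_
    · rintro ⟨a, b⟩ h
      simp only [mem_filter, mem_univ, true_and] at h
      subst h
      exact mem_sigma.2 ⟨mem_powerset.2 subset_union_left, mem_powerset.2 inter_subset_right⟩
    · rintro ⟨a, b⟩ h
      simp only [mem_sigma, mem_powerset] at h
      simp only [mem_filter, mem_univ, true_and]
      ext e
      have h1 := @h.1 e
      have h2 := @h.2 e
      simp only [mem_union, mem_sdiff]
      tauto
    · rintro ⟨a, b⟩ h
      simp only [mem_filter, mem_univ, true_and] at h
      subst h
      simp only [Prod.mk.injEq, true_and]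
      ext e
      simp only [mem_union, mem_sdiff, mem_inter]
      tauto
    · rintro ⟨a, b⟩ h
      simp only [mem_sigma, mem_powerset] at h
      have : (W \ a ∪ b) ∩ a = b := by
        ext e
        have h1 := @h.1 e
        have h2 := @h.2 e
        simp only [mem_union, mem_sdiff, mem_inter]
        tauto
      simp [this]
    · rintro ⟨a, b⟩ h
      simp only [mem_filter, mem_univ, true_and] at h
      subst h
      have : (a ∪ b) \ a ∪ b ∩ a = b := by
        ext e
        simp only [mem_union, mem_sdiff, mem_inter]
        tauto
      simp [this]
  rw [key, Finset.sum_sigma]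
  have inner : ∀ W₁ ∈ W.powerset, ∑ X ∈ W₁.powerset,
      bernWeight p₁ W₁ * bernWeight p₂ ((W \ W₁) ∪ X) =
      ((1 - p₁) * (1 - p₂)) ^ (Fintype.card E - #W) *
        (p₁ ^ #W₁ * ((1 - p₁) * p₂) ^ (#W - #W₁)) := by
    intro W₁ hW₁
    rw [mem_powerset] at hW₁
    have hc1 := card_le_card hW₁
    have hc2 : #W ≤ Fintype.card E := card_le_univ W
    have : ∀ X ∈ W₁.powerset, bernWeight p₁ W₁ * bernWeight p₂ ((W \ W₁) ∪ X) =
        (((1 - p₁) * (1 - p₂)) ^ (Fintype.card E - #W) *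
        (p₁ ^ #W₁ * ((1 - p₁) * p₂) ^ (#W - #W₁))) * (p₂ ^ #X * (1 - p₂) ^ (#W₁ - #X)) := by
      intro X hX
      rw [mem_powerset] at hX
      have hc3 := card_le_card hX
      have hd : Disjoint (W \ W₁) X := by
        rw [Finset.disjoint_left]
        intro e he hx
        exact (mem_sdiff.1 he).2 (hX hx)
      unfold bernWeight
      rw [card_union_of_disjoint hd, card_sdiff_of_subset hW₁]
      have e1 : Fintype.card E - #W₁ = (Fintype.card E - #W) + (#W - #W₁) := by omega
      have e2 : Fintype.card E - (#W - #W₁ + #X) = (Fintype.card E - #W) + (#W₁ - #X) := by omega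
      rw [e1, e2, pow_add, pow_add, pow_add, mul_pow, mul_pow]
      ring
    rw [Finset.sum_congr rfl this, ← Finset.mul_sum, Finset.sum_pow_mul_eq_add_pow]
    simp
  rw [Finset.sum_congr rfl inner, ← Finset.mul_sum, Finset.sum_pow_mul_eq_add_pow]
  unfold bernWeight
  rw [mul_comm]
  congr 2 <;> ring

theorem sum_bernWeight_union (p₁ p₂ : ℝ) (φ : Finset E → ℝ) :
    ∑ W₁ : Finset E, bernWeight p₁ W₁ * ∑ W₂ : Finset E, bernWeight p₂ W₂ * φ (W₁ ∪ W₂) =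
      ∑ W : Finset E, bernWeight (p₁ + p₂ - p₁ * p₂) W * φ W := by
  have h1 : ∑ W₁ : Finset E, bernWeight p₁ W₁ * ∑ W₂ : Finset E, bernWeight p₂ W₂ * φ (W₁ ∪ W₂) =
      ∑ x : Finset E × Finset E, bernWeight p₁ x.1 * bernWeight p₂ x.2 * φ (x.1 ∪ x.2) := by
    rw [Fintype.sum_prod_type]
    refine Finset.sum_congr rfl fun a _ => ?_
    rw [Finset.mul_sum]
    exact Finset.sum_congr rfl fun b _ => by ring
  rw [h1, ← Finset.sum_fiberwise (s := univ) (g := fun x : Finset E × Finset E => x.1 ∪ x.2)]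
  refine Finset.sum_congr rfl fun W _ => ?_
  rw [← sum_bernWeight_fiber_union, Finset.sum_mul]
  refine Finset.sum_congr rfl fun x hx => ?_
  rw [(mem_filter.1 hx).2]

/-- The probability that a `p`-random subset contains no member of `𝓗`. -/
noncomputable def failProb (p : ℝ) (𝓗 : Finset (Finset E)) : ℝ :=
  ∑ W : Finset E, bernWeight p W * if ∃ H ∈ 𝓗, H ⊆ W then 0 else 1

theorem failProb_nonneg {p : ℝ} (h0 : 0 ≤ p) (h1 : p ≤ 1) (𝓗 : Finset (Finset E)) :
    0 ≤ failProb p 𝓗 :=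
  Finset.sum_nonneg fun W _ => mul_nonneg (bernWeight_nonneg h0 h1 W) (by split_ifs <;> norm_num)

theorem failProb_le_one {p : ℝ} (h0 : 0 ≤ p) (h1 : p ≤ 1) (𝓗 : Finset (Finset E)) :
    failProb p 𝓗 ≤ 1 := by
  rw [← sum_bernWeight (E := E) p]
  refine Finset.sum_le_sum fun W _ => ?_
  have := bernWeight_nonneg h0 h1 W
  split_ifs <;> linarith

/-- Sprinkling: a `p'`-random set is the union of a `p`-random and an independent `r`-random set,
where `r = (p' - p) / (1 - p)`. -/
theorem failProb_anti {p p' : ℝ} (h0 : 0 ≤ p) (hp : p ≤ p') (h1 : p' ≤ 1)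
    (𝓗 : Finset (Finset E)) : failProb p' 𝓗 ≤ failProb p 𝓗 := by
  rcases hp.eq_or_lt with rfl | hlt
  · rfl
  have hp1 : 0 < 1 - p := by linarith
  obtain ⟨r, hr⟩ : ∃ r, r = (p' - p) / (1 - p) := ⟨_, rfl⟩
  have hr0 : 0 ≤ r := hr ▸ div_nonneg (by linarith) hp1.le
  have hr1 : r ≤ 1 := by rw [hr, div_le_one hp1]; linarith
  have he : p' = p + r - p * r := by
    have : r * (1 - p) = p' - p := by rw [hr]; field_simp
    linarith
  have := sum_bernWeight_union p r (fun W : Finset E => if ∃ H ∈ 𝓗, H ⊆ W then (0 : ℝ) else 1)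
  unfold failProb
  rw [he, ← this]
  refine Finset.sum_le_sum fun W _ => mul_le_mul_of_nonneg_left ?_ (bernWeight_nonneg h0 (by linarith) W)
  calc _ ≤ ∑ W₂ : Finset E, bernWeight r W₂ * (if ∃ H ∈ 𝓗, H ⊆ W then (0 : ℝ) else 1) := by
        refine Finset.sum_le_sum fun W₂ _ =>
          mul_le_mul_of_nonneg_left ?_ (bernWeight_nonneg hr0 hr1 W₂)
        by_cases h : ∃ H ∈ 𝓗, H ⊆ W
        · rw [if_pos h, if_pos]
          obtain ⟨H, hH, hs⟩ := h
          exact ⟨H, hH, hs.trans subset_union_left⟩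
        · rw [if_neg h]; split_ifs <;> norm_num
    _ = _ := by rw [← Finset.sum_mul, sum_bernWeight, one_mul]

/-- Every family of sets that covers `𝓗` has `q`-cost at least `θ`. -/
def CoverCost (q : ℝ) (𝓗 : Finset (Finset E)) (θ : ℝ) : Prop :=
  ∀ 𝒰 : Finset (Finset E), (∀ H ∈ 𝓗, ∃ U ∈ 𝒰, U ⊆ H) → θ ≤ ∑ U ∈ 𝒰, q ^ #U

-- The minimum runs over all members of `𝓗` inside `H ∪ W`, not just over `H` itself. For `H ∉ 𝓗`
-- the value is a dummy.
omit [Fintype E] in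
theorem exists_minFragment (𝓗 : Finset (Finset E)) (W H : Finset E) :
    ∃ T : Finset E, H ∈ 𝓗 → ∃ H' ∈ 𝓗, T = H' \ W ∧ H' ⊆ H ∪ W ∧
      ∀ K ∈ 𝓗, K ⊆ H ∪ W → #T ≤ #(K \ W) := by
  by_cases hH : H ∈ 𝓗
  · obtain ⟨H', h1, h2⟩ := Finset.exists_min_image (𝓗.filter fun K => K ⊆ H ∪ W)
      (fun K => #(K \ W)) ⟨H, by simp [hH, subset_union_left]⟩
    rw [mem_filter] at h1
    exact ⟨H' \ W, fun _ => ⟨H', h1.1, rfl, h1.2, fun K hK hs => h2 K (by simp [hK, hs])⟩⟩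
  · exact ⟨∅, fun h => absurd h hH⟩

/-- A minimum fragment `H' \ W` with `H' ∈ 𝓗` and `H' ⊆ H ∪ W`. -/
noncomputable def minFragment (𝓗 : Finset (Finset E)) (W H : Finset E) : Finset E :=
  (exists_minFragment 𝓗 W H).choose

theorem minFragment_spec {𝓗 : Finset (Finset E)} (W : Finset E) {H : Finset E} (hH : H ∈ 𝓗) :
    ∃ H' ∈ 𝓗, minFragment 𝓗 W H = H' \ W ∧ H' ⊆ H ∪ W ∧
      ∀ K ∈ 𝓗, K ⊆ H ∪ W → #(minFragment 𝓗 W H) ≤ #(K \ W) :=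
  (exists_minFragment 𝓗 W H).choose_spec hH

theorem minFragment_subset {𝓗 : Finset (Finset E)} (W : Finset E) {H : Finset E} (hH : H ∈ 𝓗) :
    minFragment 𝓗 W H ⊆ H := by
  obtain ⟨H', _, h2, h3, _⟩ := minFragment_spec W hH
  rw [h2]
  intro e he
  rw [mem_sdiff] at he
  have := h3 he.1
  rw [mem_union] at this
  tauto

/-- All minimum fragments of `𝓗` with respect to `W`. -/
noncomputable def fragments (𝓗 : Finset (Finset E)) (W : Finset E) : Finset (Finset E) :=
  𝓗.image (minFragment 𝓗 W)

theorem disjoint_of_mem_fragments {𝓗 : Finset (Finset E)} {W T : Finset E}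
    (hT : T ∈ fragments 𝓗 W) : Disjoint W T := by
  obtain ⟨H, hH, rfl⟩ := mem_image.1 hT
  obtain ⟨H', _, h2, _, _⟩ := minFragment_spec W hH
  rw [h2]
  exact disjoint_sdiff

theorem exists_subset_union_of_mem_fragments {𝓗 : Finset (Finset E)} {W T : Finset E}
    (hT : T ∈ fragments 𝓗 W) : ∃ H ∈ 𝓗, H ⊆ W ∪ T := by
  obtain ⟨H, hH, rfl⟩ := mem_image.1 hT
  obtain ⟨H', h1, h2, _, _⟩ := minFragment_spec W hH
  refine ⟨H', h1, ?_⟩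
  rw [h2]
  intro e he
  by_cases h : e ∈ W <;> simp [h, he]

/-- Minimality is what makes this true. Since `K ⊆ W ∪ T ⊆ W ∪ H`, the set `K` competes with the
minimiser, so `#T ≤ #(K \ W)`; but `K \ W ⊆ T`, hence they are equal. Consequently `T` is confined
to any member of `𝓗` found inside `W ∪ T`, which can be chosen without knowing `W`. -/
theorem fragment_subset {𝓗 : Finset (Finset E)} {W T K : Finset E}
    (hT : T ∈ fragments 𝓗 W) (hK : K ∈ 𝓗) (hs : K ⊆ W ∪ T) : T ⊆ K := by
  have hd := disjoint_of_mem_fragments hT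
  obtain ⟨H, hH, rfl⟩ := mem_image.1 hT
  obtain ⟨H', h1, h2, h3, h4⟩ := minFragment_spec W hH
  have hsub := minFragment_subset W hH
  have h5 := h4 K hK (by
    intro e he
    have := hs he
    rw [mem_union] at this ⊢
    rcases this with h | h
    · exact Or.inr h
    · exact Or.inl (hsub h))
  have h6 : K \ W ⊆ minFragment 𝓗 W H := by
    intro e he
    rw [mem_sdiff] at he
    have := hs he.1
    rw [mem_union] at this
    tauto
  have h7 := eq_of_subset_of_card_le h6 h5
  rw [← h7]
  exact sdiff_subset

/-- Adding the elements of `T` to `W` changes the weight by `(p / (1 - p)) ^ #T`, and `1 - p ≤ 1`.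
-/
theorem bernWeight_mul_pow_le {p q : ℝ} (hp : 0 < p) (hp1 : p ≤ 1) (hq : 0 ≤ q)
    {W T : Finset E} (hd : Disjoint W T) :
    bernWeight p W * q ^ #T ≤ bernWeight p (W ∪ T) * (q / p) ^ #T := by
  have hc : #(W ∪ T) ≤ Fintype.card E := card_le_univ _
  rw [card_union_of_disjoint hd] at hc
  unfold bernWeight
  rw [card_union_of_disjoint hd]
  have e1 : Fintype.card E - #W = (Fintype.card E - (#W + #T)) + #T := by omega
  rw [e1, pow_add, pow_add, div_pow]
  have hpT : p ^ #T ≠ 0 := by positivity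
  have h1 : (1 - p) ^ #T ≤ 1 := pow_le_one₀ (by linarith) (by linarith)
  have h2 : 0 ≤ (1 - p) ^ (Fintype.card E - (#W + #T)) := pow_nonneg (by linarith) _
  have : p ^ #W * p ^ #T * (1 - p) ^ (Fintype.card E - (#W + #T)) * (q ^ #T / p ^ #T) =
    p ^ #W * ((1 - p) ^ (Fintype.card E - (#W + #T)) * 1) * q ^ #T := by
    field_simp
  rw [this]
  gcongr

/-- The expected cost of the large minimum fragments. -/
theorem sum_cost_fragments_le {p q B : ℝ} (hp : 0 < p) (hp1 : p ≤ 1) (hq : 0 ≤ q) {l m : ℕ}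
    (𝓗 : Finset (Finset E)) (hl : ∀ H ∈ 𝓗, #H ≤ l)
    (hB : ∀ H : Finset E, #H ≤ l → ∑ T ∈ H.powerset with m < #T, (q / p) ^ #T ≤ B) :
    ∑ W : Finset E, bernWeight p W * ∑ T ∈ fragments 𝓗 W with m < #T, q ^ #T ≤ B := by
  -- `K Z` is chosen from `Z` alone, so that for given `Z = W ∪ T` the fragment `T` is one of the
  -- subsets of a fixed set of size at most `l`.
  have hch : ∀ Z : Finset E, ∃ K : Finset E, #K ≤ l ∧ ((∃ H ∈ 𝓗, H ⊆ Z) → K ∈ 𝓗 ∧ K ⊆ Z) := by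
    intro Z
    by_cases h : ∃ H ∈ 𝓗, H ⊆ Z
    · obtain ⟨H, h1, h2⟩ := h
      exact ⟨H, hl H h1, fun _ => ⟨h1, h2⟩⟩
    · exact ⟨∅, by simp, fun h' => absurd h' h⟩
  choose K hK1 hK2 using hch
  calc _ ≤ ∑ W : Finset E, ∑ T ∈ fragments 𝓗 W with m < #T,
        bernWeight p (W ∪ T) * (q / p) ^ #T := by
        refine Finset.sum_le_sum fun W _ => ?_
        rw [Finset.mul_sum]
        refine Finset.sum_le_sum fun T hT => bernWeight_mul_pow_le hp hp1 hq ?_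
        exact disjoint_of_mem_fragments (mem_filter.1 hT).1
    _ = ∑ x ∈ (univ : Finset (Finset E)).sigma fun W => (fragments 𝓗 W).filter fun T => m < #T,
        bernWeight p (x.1 ∪ x.2) * (q / p) ^ #x.2 := by rw [Finset.sum_sigma]
    -- Change of variables from `(W, T)` to `(W ∪ T, T)`, injective because a fragment is disjoint
    -- from `W`.
    _ = ∑ y ∈ ((univ : Finset (Finset E)).sigma fun W =>
          (fragments 𝓗 W).filter fun T => m < #T).image
            (fun x => (⟨x.1 ∪ x.2, x.2⟩ : Σ _ : Finset E, Finset E)),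
        bernWeight p y.1 * (q / p) ^ #y.2 := by
        rw [Finset.sum_image]
        rintro ⟨W, T⟩ h ⟨W', T'⟩ h' he
        simp only [coe_sigma, Set.mem_sigma_iff, mem_coe, mem_univ, mem_filter, true_and] at h h'
        simp only [Sigma.mk.injEq, heq_eq_eq] at he
        obtain ⟨h1, rfl⟩ := he
        have d1 := disjoint_of_mem_fragments h.1
        have d2 := disjoint_of_mem_fragments h'.1
        have : W = W' := by
          rw [← union_sdiff_cancel_right d1, h1, union_sdiff_cancel_right d2]
        rw [this]
    _ ≤ ∑ y ∈ (univ : Finset (Finset E)).sigma fun Z => (K Z).powerset.filter fun T => m < #T,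
        bernWeight p y.1 * (q / p) ^ #y.2 := by
        refine Finset.sum_le_sum_of_subset_of_nonneg ?_ fun y _ _ =>
          mul_nonneg (bernWeight_nonneg hp.le hp1 _) (by positivity)
        intro y hy
        obtain ⟨⟨W, T⟩, h, rfl⟩ := mem_image.1 hy
        simp only [mem_sigma, mem_univ, mem_filter, true_and] at h
        simp only [mem_sigma, mem_univ, mem_filter, true_and, mem_powerset]
        have := hK2 _ (exists_subset_union_of_mem_fragments h.1)
        exact ⟨fragment_subset h.1 this.1 this.2, h.2⟩
    _ = ∑ Z : Finset E, bernWeight p Z * ∑ T ∈ (K Z).powerset with m < #T, (q / p) ^ #T := by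
        rw [Finset.sum_sigma]
        exact Finset.sum_congr rfl fun Z _ => by rw [Finset.mul_sum]
    _ ≤ ∑ Z : Finset E, bernWeight p Z * B :=
        Finset.sum_le_sum fun Z _ => mul_le_mul_of_nonneg_left (hB _ (hK1 Z))
          (bernWeight_nonneg hp.le hp1 _)
    _ = B := by rw [← Finset.sum_mul, sum_bernWeight, one_mul]

/-- Each member of `𝓗` contains its own fragment. Hence a cover of the small fragments together with
the large fragments themselves is a cover of `𝓗`. -/
theorem CoverCost.fragments {q θ : ℝ} {𝓗 : Finset (Finset E)} (hq : 0 ≤ q)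
    (h : CoverCost q 𝓗 θ) (W : Finset E) (m : ℕ) :
    CoverCost q ((fragments 𝓗 W).filter fun T => #T ≤ m)
      (θ - ∑ T ∈ fragments 𝓗 W with m < #T, q ^ #T) := by
  intro 𝒰 h𝒰
  have h1 := h (𝒰 ∪ (_root_.fragments 𝓗 W).filter fun T => m < #T) (by
    intro H hH
    have hT : minFragment 𝓗 W H ∈ _root_.fragments 𝓗 W := mem_image_of_mem _ hH
    have hs := minFragment_subset W hH
    by_cases hm : m < #(minFragment 𝓗 W H)
    · exact ⟨_, mem_union_right _ (mem_filter.2 ⟨hT, hm⟩), hs⟩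
    · obtain ⟨U, hU, hUs⟩ := h𝒰 _ (mem_filter.2 ⟨hT, not_lt.1 hm⟩)
      exact ⟨U, mem_union_left _ hU, hUs.trans hs⟩)
  have h2 : ∑ U ∈ 𝒰 ∪ (_root_.fragments 𝓗 W).filter fun T => m < #T, q ^ #U ≤
      ∑ U ∈ 𝒰, q ^ #U + ∑ T ∈ _root_.fragments 𝓗 W with m < #T, q ^ #T := by
    rw [← Finset.sum_union_inter]
    exact le_add_of_nonneg_right (Finset.sum_nonneg fun _ _ => by positivity)
  linarith

/-- One round of exposure. -/
theorem failProb_round {p₁ p₂ q B₁ B₂ θ : ℝ} (hp₁ : 0 < p₁) (hp₁' : p₁ ≤ 1) (hp₂ : 0 ≤ p₂)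
    (hp₂' : p₂ ≤ 1) (hq : 0 ≤ q) {l m : ℕ}
    (𝓗 : Finset (Finset E)) (hl : ∀ H ∈ 𝓗, #H ≤ l)
    (hB₁ : ∀ H : Finset E, #H ≤ l → ∑ T ∈ H.powerset with m < #T, (q / p₁) ^ #T ≤ B₁)
    (hB₂ : ∀ (𝓗' : Finset (Finset E)) (θ' : ℝ), (∀ H ∈ 𝓗', #H ≤ m) → CoverCost q 𝓗' θ' →
      θ' * failProb p₂ 𝓗' ≤ B₂)
    (hθ : CoverCost q 𝓗 θ) (hθ0 : 0 ≤ θ) :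
    θ * failProb (p₁ + p₂ - p₁ * p₂) 𝓗 ≤ B₁ + B₂ := by
  have h1 := sum_cost_fragments_le hp₁ hp₁' hq 𝓗 hl hB₁
  unfold failProb
  rw [← sum_bernWeight_union, Finset.mul_sum]
  calc _ ≤ ∑ W : Finset E, bernWeight p₁ W *
        (∑ T ∈ fragments 𝓗 W with m < #T, q ^ #T + B₂) := by
        refine Finset.sum_le_sum fun W _ => ?_
        rw [mul_left_comm]
        refine mul_le_mul_of_nonneg_left ?_ (bernWeight_nonneg hp₁.le hp₁' W)
        -- The cover cost left after the first round depends on `W` and may be negative. Bounding `θ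
        -- * failProb` rather than `failProb` keeps the estimate linear, so that it can be averaged
        -- over `W`.
        have h2 := hB₂ _ _ (fun H hH => (mem_filter.1 hH).2) (hθ.fragments hq W m)
        have h3 := failProb_le_one hp₂ hp₂' ((fragments 𝓗 W).filter fun T => #T ≤ m)
        have hc : 0 ≤ ∑ T ∈ fragments 𝓗 W with m < #T, q ^ #T :=
          Finset.sum_nonneg fun _ _ => by positivity
        have h4 : ∑ W₂ : Finset E, bernWeight p₂ W₂ *
            (if ∃ H ∈ 𝓗, H ⊆ W ∪ W₂ then (0 : ℝ) else 1) ≤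
            failProb p₂ ((fragments 𝓗 W).filter fun T => #T ≤ m) := by
          refine Finset.sum_le_sum fun W₂ _ =>
            mul_le_mul_of_nonneg_left ?_ (bernWeight_nonneg hp₂ hp₂' W₂)
          by_cases h : ∃ H ∈ (fragments 𝓗 W).filter fun T => #T ≤ m, H ⊆ W₂
          · rw [if_pos h, if_pos]
            obtain ⟨T, hT, hs⟩ := h
            obtain ⟨H, hH, hHs⟩ := exists_subset_union_of_mem_fragments (mem_filter.1 hT).1
            exact ⟨H, hH, hHs.trans (union_subset_union_right hs)⟩
          · rw [if_neg h]; split_ifs <;> norm_num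
        have h5 := mul_le_mul_of_nonneg_left h4 hθ0
        have h6 := mul_le_mul_of_nonneg_left h3 hc
        rw [sub_mul] at h2
        linarith
    _ = ∑ W : Finset E, bernWeight p₁ W * ∑ T ∈ fragments 𝓗 W with m < #T, q ^ #T + B₂ := by
        simp_rw [mul_add]
        rw [Finset.sum_add_distrib, ← Finset.sum_mul, sum_bernWeight, one_mul]
    _ ≤ _ := by linarith

/-- Either `𝓗` is empty, and the empty cover shows `θ ≤ 0`, or `∅ ∈ 𝓗` and failure is impossible. -/
theorem failProb_of_card_le_zero {p₂ q θ : ℝ} (𝓗 : Finset (Finset E)) (hl : ∀ H ∈ 𝓗, #H ≤ 0)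
    (hp₂ : 0 ≤ p₂) (hp₂' : p₂ ≤ 1) (hθ : CoverCost q 𝓗 θ) : θ * failProb p₂ 𝓗 ≤ 0 := by
  rcases 𝓗.eq_empty_or_nonempty with rfl | ⟨H, hH⟩
  · have := hθ ∅ (by simp)
    rw [Finset.sum_empty] at this
    exact mul_nonpos_of_nonpos_of_nonneg this (failProb_nonneg hp₂ hp₂' _)
  · have hH0 : H = ∅ := by simpa using hl H hH
    have : failProb p₂ 𝓗 = 0 := by
      refine Finset.sum_eq_zero fun W _ => ?_
      rw [if_pos ⟨H, hH, by simp [hH0]⟩, mul_zero]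
    rw [this, mul_zero]

theorem failProb_last_round {p q θ L : ℝ} (hL : 0 < L) (hq : 0 < q) (hp : q * L ≤ p)
    (hp1 : p ≤ 1) {m : ℕ} (𝓗 : Finset (Finset E)) (hl : ∀ H ∈ 𝓗, #H ≤ m)
    (hθ : CoverCost q 𝓗 θ) : θ * failProb p 𝓗 ≤ (1 + 1 / L) ^ m - 1 := by
  have hp0 : 0 < p := lt_of_lt_of_le (by positivity) hp
  have hB : (0 : ℝ) ≤ (1 + 1 / L) ^ m - 1 := by
    have : (1 : ℝ) ≤ (1 + 1 / L) ^ m := one_le_pow₀ (by simp [hL.le])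
    linarith
  rcases lt_or_ge θ 0 with h0 | h0
  · exact (mul_nonpos_of_nonpos_of_nonneg h0.le (failProb_nonneg hp0.le hp1 _)).trans hB
  -- With `m = 0` every nonempty fragment counts as large, and no second exposure is needed. The
  -- binomial sum over nonempty subsets is the bound.
  have := failProb_round (p₂ := 0) (B₂ := 0) (B₁ := (1 + 1 / L) ^ m - 1) hp0 hp1 le_rfl zero_le_one hq.le (m := 0) 𝓗 hl (by
    intro H hH
    have e1 : (H.powerset.filter fun T => 0 < #T) = H.powerset.erase ∅ := by
      ext T
      simp [card_pos, nonempty_iff_ne_empty, and_comm]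
    rw [e1]
    have e2 : ∑ T ∈ H.powerset, (q / p) ^ #T = (q / p + 1) ^ #H := by
      have := Finset.sum_pow_mul_eq_add_pow (q / p) 1 H
      simpa using this
    have e3 : ∑ T ∈ H.powerset.erase ∅, (q / p) ^ #T = (q / p + 1) ^ #H - 1 := by
      rw [← e2, ← Finset.sum_erase_add _ _ (empty_mem_powerset H)]
      simp
    rw [e3]
    have h1 : q / p + 1 ≤ 1 + 1 / L := by
      have : q / p ≤ 1 / L := by rw [div_le_div_iff₀ hp0 hL]; linarith
      linarith
    have h2 : (q / p + 1) ^ #H ≤ (1 + 1 / L) ^ #H := pow_le_pow_left₀ (by positivity) h1 _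
    have h3 : (1 + 1 / L) ^ #H ≤ (1 + 1 / L) ^ m := pow_le_pow_right₀ (by simp [hL.le]) hH
    linarith) (fun 𝓗' θ' hl' hθ' => failProb_of_card_le_zero 𝓗' hl' le_rfl zero_le_one hθ') hθ h0
  simpa using this

/-- Each round spends density `16 * q` to halve the size bound from `2 ^ (k + 1) * m` to `2 ^ k *
m`. A set of the larger size has at most `4 ^ (2 ^ k * m)` subsets, and each fragment above the
smaller size weighs at most `16 ^ (-(2 ^ k * m))`, so the round loses `(1 / 4) ^ (2 ^ k * m)`. The
constant-size remainder is handled by `failProb_last_round` with density `q * L`. -/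
theorem failProb_rounds {q L : ℝ} (hL : 0 < L) (hq : 0 < q) {m : ℕ} (k : ℕ) :
    ∀ p θ : ℝ, p ≤ 1 → q * L + 16 * q * k ≤ p → ∀ 𝓗 : Finset (Finset E),
      (∀ H ∈ 𝓗, #H ≤ 2 ^ k * m) → CoverCost q 𝓗 θ → θ * failProb p 𝓗 ≤
        (1 + 1 / L) ^ m - 1 + ∑ i ∈ range k, (1 / 4 : ℝ) ^ (2 ^ i * m) := by
  induction k with
  | zero =>
    intro p θ hp1 hp 𝓗 hl hθ
    have := failProb_last_round hL hq (by simpa using hp) hp1 𝓗 (by simpa using hl) hθ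
    simpa using this
  | succ k ih =>
    intro p θ hp1 hp 𝓗 hl hθ
    have hk : (0 : ℝ) ≤ k := Nat.cast_nonneg k
    push_cast at hp
    have hqk : 0 ≤ q * k := by positivity
    have hqL : 0 < q * L := by positivity
    have hB : (0 : ℝ) ≤ (1 + 1 / L) ^ m - 1 := by
      have : (1 : ℝ) ≤ (1 + 1 / L) ^ m := one_le_pow₀ (by simp [hL.le])
      linarith
    set p₂ := q * L + 16 * q * k with hp₂
    have h20 : 0 ≤ p₂ := by positivity
    have h21 : p₂ ≤ 1 := by linarith
    set p₁ := 16 * q with hp₁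
    have h10 : 0 < p₁ := by positivity
    have h11 : p₁ ≤ 1 := by linarith
    have h12 : 0 ≤ p₁ * p₂ := by positivity
    have h13 : p₁ * p₂ ≤ p₁ := by nlinarith
    have hle : failProb p 𝓗 ≤ failProb (p₁ + p₂ - p₁ * p₂) 𝓗 :=
      failProb_anti (by linarith) (by linarith) hp1 𝓗
    rcases lt_or_ge θ 0 with h0 | h0
    · refine (mul_nonpos_of_nonpos_of_nonneg h0.le (failProb_nonneg (by linarith) hp1 _)).trans ?_
      positivity
    have := failProb_round (B₁ := (1 / 4 : ℝ) ^ (2 ^ k * m)) h10 h11 h20 h21 hq.le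
      (m := 2 ^ k * m) 𝓗 hl (by
      intro H hH
      have hr : q / p₁ = 1 / 16 := by rw [hp₁]; field_simp
      rw [hr]
      calc ∑ T ∈ H.powerset with 2 ^ k * m < #T, (1 / 16 : ℝ) ^ #T
          ≤ ∑ T ∈ H.powerset with 2 ^ k * m < #T, (1 / 16 : ℝ) ^ (2 ^ k * m) :=
            Finset.sum_le_sum fun T hT => pow_le_pow_of_le_one (by norm_num) (by norm_num)
              (mem_filter.1 hT).2.le
        _ ≤ ∑ T ∈ H.powerset, (1 / 16 : ℝ) ^ (2 ^ k * m) :=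
            Finset.sum_le_sum_of_subset_of_nonneg (filter_subset _ _) fun _ _ _ => by positivity
        _ = 2 ^ #H * (1 / 16 : ℝ) ^ (2 ^ k * m) := by simp
        _ ≤ 2 ^ (2 ^ (k + 1) * m) * (1 / 16 : ℝ) ^ (2 ^ k * m) := by
            gcongr
            norm_num
        _ = (1 / 4 : ℝ) ^ (2 ^ k * m) := by
            rw [show 2 ^ (k + 1) * m = 2 * (2 ^ k * m) by ring, pow_mul, ← mul_pow]
            norm_num)
      (fun 𝓗' θ' hl' hθ' => ih p₂ θ' h21 le_rfl 𝓗' hl' hθ') hθ h0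
    rw [Finset.sum_range_succ]
    have h5 := mul_le_mul_of_nonneg_left hle h0
    linarith

/-- A family of sets of size at most `2 ^ k * m` which has no cheap cover
is likely to have a member inside a random set. -/
theorem failProb_le_of_coverCost {p q L : ℝ} (hL : 0 < L) (hq : 0 < q) {k m : ℕ} (hm : 0 < m)
    (hp1 : p ≤ 1) (hp : q * L + 16 * q * k ≤ p) (𝓗 : Finset (Finset E))
    (hl : ∀ H ∈ 𝓗, #H ≤ 2 ^ k * m) (hθ : CoverCost q 𝓗 1) :
    failProb p 𝓗 ≤ (1 + 1 / L) ^ m - 1 + 2 * (1 / 4 : ℝ) ^ m := by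
  have h := failProb_rounds hL hq k p 1 hp1 hp 𝓗 hl hθ
  have h2 : ∑ i ∈ range k, (1 / 4 : ℝ) ^ (2 ^ i * m) ≤
      ∑ i ∈ range k, (1 / 4 : ℝ) ^ m * (1 / 2 : ℝ) ^ i := by
    refine Finset.sum_le_sum fun i _ => ?_
    -- This replaces the doubly exponential errors by a geometric series; it needs `0 < m`.
    have h3 : i + m ≤ 2 ^ i * m := by
      have h4 : i + 1 ≤ 2 ^ i := Nat.lt_two_pow_self
      nlinarith
    calc (1 / 4 : ℝ) ^ (2 ^ i * m) ≤ (1 / 4 : ℝ) ^ (i + m) :=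
          pow_le_pow_of_le_one (by norm_num) (by norm_num) h3
      _ = (1 / 4 : ℝ) ^ m * (1 / 4 : ℝ) ^ i := by rw [pow_add, mul_comm]
      _ ≤ _ := by gcongr; norm_num
  have h5 : ∑ i ∈ range k, (1 / 2 : ℝ) ^ i ≤ 2 := sum_geometric_two_le k
  rw [← Finset.mul_sum] at h2
  have h6 : (0 : ℝ) ≤ (1 / 4 : ℝ) ^ m := by positivity
  nlinarith

end bernWeight

/-! ### The law of the random subgraph, and isolated vertices by the second moment method. -/

section randomSubgraph
variable {V : Type*} [Fintype V] [DecidableEq V]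

instance SimpleGraph.discreteMeasurableSpace_of_finite : DiscreteMeasurableSpace (SimpleGraph V) := by
  have : MeasurableSingletonClass (SimpleGraph V) := by
    refine ⟨fun H => ?_⟩
    have h : ({H} : Set (SimpleGraph V)) = SimpleGraph.edgeSet ⁻¹' {H.edgeSet} := by
      ext K; simp
    rw [h]
    exact SimpleGraph.measurable_edgeSet (measurableSet_singleton _)
  infer_instance

/-- The graph spanned by a finite set of edges. -/
abbrev SimpleGraph.ofEdges (W : Finset (Sym2 V)) : SimpleGraph V := fromEdgeSet (W : Set (Sym2 V))

open Classical in
theorem SimpleGraph.randomSubgraph_real (G : SimpleGraph V) [DecidableRel G.Adj] (p : unitInterval)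
    (A : Set (SimpleGraph V)) :
    (G.randomSubgraph p).real A =
      ∑ W ∈ G.edgeFinset.powerset with ofEdges W ∈ A,
        (p : ℝ) ^ #W * (1 - p) ^ (#G.edgeFinset - #W) := by
  unfold SimpleGraph.randomSubgraph
  rw [map_measureReal_apply measurable_fromEdgeSet (.of_discrete)]
  have h1 : (setBernoulli G.edgeSet p).real (fromEdgeSet ⁻¹' A) =
      (setBernoulli G.edgeSet p).real (⋃ W ∈ G.edgeFinset.powerset.filter
        (fun W => ofEdges W ∈ A), {(W : Set (Sym2 V))}) := by
    rw [measureReal_def, measureReal_def, setBernoulli_apply_eq_apply_subsets]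
    congr 2
    ext s
    simp only [Set.mem_ofPred_eq, Set.mem_iUnion, Finset.mem_filter, Finset.mem_powerset,
      Set.mem_singleton_iff, Set.mem_preimage, exists_prop]
    constructor
    · rintro ⟨h1, h2⟩
      refine ⟨(Set.toFinite s).toFinset, ⟨?_, by simpa [SimpleGraph.ofEdges] using h1⟩, by simp⟩
      intro e he
      simpa using h2 (by simpa using he)
    · rintro ⟨W, ⟨h1, h2⟩, rfl⟩
      refine ⟨h2, ?_⟩
      intro e he
      simpa using h1 (by simpa using he)
  rw [h1, measureReal_biUnion_finset]
  · refine Finset.sum_congr rfl fun W hW => ?_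
    have hs : (W : Set (Sym2 V)) ⊆ G.edgeSet := by
      have := mem_powerset.1 (mem_filter.1 hW).1
      intro e he
      simpa using this he
    rw [setBernoulli_real_singleton p hs (Set.toFinite _), Set.ncard_sdiff' hs (Set.toFinite _),
      Set.ncard_coe_finset, ← G.coe_edgeFinset, Set.ncard_coe_finset]
  · intro a _ b _ hab
    simpa [Function.onFun] using hab
  · intro _ _
    exact .of_discrete

/-- The weights restricted to subsets of `E₀` are the marginals of the Bernoulli weights. -/
theorem sum_bernWeight_inter {E : Type*} [Fintype E] [DecidableEq E] (p : ℝ) (E₀ : Finset E)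
    (φ : Finset E → ℝ) :
    ∑ W : Finset E, bernWeight p W * φ (W ∩ E₀) =
      ∑ W ∈ E₀.powerset, p ^ #W * (1 - p) ^ (#E₀ - #W) * φ W := by
  have key : ∑ W : Finset E, bernWeight p W * φ (W ∩ E₀) =
      ∑ x ∈ E₀.powerset ×ˢ E₀ᶜ.powerset, bernWeight p (x.1 ∪ x.2) * φ x.1 := by
    refine Finset.sum_nbij' (fun W => (W ∩ E₀, W ∩ E₀ᶜ)) (fun x => x.1 ∪ x.2) ?_ ?_ ?_ ?_ ?_
    · intro W _
      simp [inter_subset_right]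
    · intro x _; simp
    · intro W _
      ext e; simp; tauto
    · rintro ⟨a, b⟩ h
      simp only [mem_product, mem_powerset] at h
      ext e
      · have h1 := @h.1 e; have h2 := @h.2 e
        simp at h2 ⊢; tauto
      · have h1 := @h.1 e; have h2 := @h.2 e
        simp at h2 ⊢; tauto
    · intro W _
      congr 2
      ext e; simp; tauto
  rw [key, Finset.sum_product]
  refine Finset.sum_congr rfl fun W hW => ?_
  rw [mem_powerset] at hW
  have h1 : ∀ B ∈ E₀ᶜ.powerset, bernWeight p (W ∪ B) * φ W =
      p ^ #W * (1 - p) ^ (#E₀ - #W) * φ W * (p ^ #B * (1 - p) ^ (#E₀ᶜ - #B)) := by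
    intro B hB
    rw [mem_powerset] at hB
    have hd : Disjoint W B := by
      rw [Finset.disjoint_left]
      intro e h1 h2
      exact (mem_compl.1 (hB h2)) (hW h1)
    have c1 := card_le_card hW
    have c2 := card_le_card hB
    have c3 := card_add_card_compl E₀
    unfold bernWeight
    rw [card_union_of_disjoint hd]
    have : Fintype.card E - (#W + #B) = (#E₀ - #W) + (#E₀ᶜ - #B) := by omega
    rw [this, pow_add, pow_add]
    ring
  rw [Finset.sum_congr rfl h1, ← Finset.mul_sum, Finset.sum_pow_mul_eq_add_pow]
  simp

/-- If every edge set in `𝓗` spans a graph with a monotone property, then the random subgraph has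
this property with probability at least `1 - failProb p 𝓗`. -/
theorem SimpleGraph.one_sub_failProb_le (G : SimpleGraph V) [DecidableRel G.Adj] (p : unitInterval)
    (A : Set (SimpleGraph V)) (𝓗 : Finset (Finset (Sym2 V))) (hG : ∀ H ∈ 𝓗, H ⊆ G.edgeFinset)
    (hA : ∀ H ∈ 𝓗, ∀ W : Finset (Sym2 V), H ⊆ W → ofEdges W ∈ A) :
    1 - failProb (p : ℝ) 𝓗 ≤ (G.randomSubgraph p).real A := by
  classical
  have h0 := p.2.1
  have h1 := p.2.2
  rw [SimpleGraph.randomSubgraph_real]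
  have e1 : failProb (p : ℝ) 𝓗 = ∑ W ∈ G.edgeFinset.powerset,
      (p : ℝ) ^ #W * (1 - p) ^ (#G.edgeFinset - #W) * if ∃ H ∈ 𝓗, H ⊆ W then 0 else 1 := by
    rw [← sum_bernWeight_inter]
    refine Finset.sum_congr rfl fun W _ => ?_
    congr 1
    have : (∃ H ∈ 𝓗, H ⊆ W) ↔ ∃ H ∈ 𝓗, H ⊆ W ∩ G.edgeFinset :=
      exists_congr fun H => and_congr_right fun hH => by
        rw [subset_inter_iff]; exact ⟨fun h => ⟨h, hG H hH⟩, fun h => h.1⟩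
    simp only [this]
  have e2 : ∑ W ∈ G.edgeFinset.powerset, (p : ℝ) ^ #W * (1 - p) ^ (#G.edgeFinset - #W) -
      failProb (p : ℝ) 𝓗 = 1 - failProb (p : ℝ) 𝓗 := by
    rw [Finset.sum_pow_mul_eq_add_pow]; simp
  rw [← e2, e1, ← Finset.sum_sub_distrib, Finset.sum_filter]
  refine Finset.sum_le_sum fun W _ => ?_
  have hw : 0 ≤ (p : ℝ) ^ #W * (1 - p) ^ (#G.edgeFinset - #W) :=
    mul_nonneg (pow_nonneg h0 _) (pow_nonneg (by linarith) _)
  by_cases h : ∃ H ∈ 𝓗, H ⊆ W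
  · obtain ⟨H, hH, hs⟩ := h
    rw [if_pos ⟨H, hH, hs⟩, if_pos (hA H hH W hs)]
    simp
  · rw [if_neg h]
    split_ifs <;> linarith

theorem sum_weights_disjoint {E : Type*} [DecidableEq E] (p : ℝ) {E₀ D : Finset E} (hD : D ⊆ E₀) :
    ∑ W ∈ E₀.powerset with Disjoint D W, p ^ #W * (1 - p) ^ (#E₀ - #W) = (1 - p) ^ #D := by
  have h1 : E₀.powerset.filter (fun W => Disjoint D W) = (E₀ \ D).powerset := by
    ext W
    simp only [mem_filter, mem_powerset, subset_sdiff]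
    exact and_congr_right fun _ => disjoint_comm
  rw [h1]
  have h2 : ∀ W ∈ (E₀ \ D).powerset, p ^ #W * (1 - p) ^ (#E₀ - #W) =
      (1 - p) ^ #D * (p ^ #W * (1 - p) ^ (#(E₀ \ D) - #W)) := by
    intro W hW
    have c1 := card_le_card (mem_powerset.1 hW)
    have c2 := card_sdiff_of_subset hD
    have c3 := card_le_card hD
    have : #E₀ - #W = #D + (#(E₀ \ D) - #W) := by omega
    rw [this, pow_add]
    ring
  rw [Finset.sum_congr rfl h2, ← Finset.mul_sum, Finset.sum_pow_mul_eq_add_pow]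
  simp

theorem SimpleGraph.isIsolated_fromEdgeSet_iff (G : SimpleGraph V) [DecidableRel G.Adj]
    {W : Finset (Sym2 V)} (hW : W ⊆ G.edgeFinset) (v : V) :
    (ofEdges W).IsIsolated v ↔ Disjoint (G.incidenceFinset v) W := by
  unfold SimpleGraph.IsIsolated
  rw [Finset.disjoint_left]
  constructor
  · intro h e he heW
    rw [SimpleGraph.mem_incidenceFinset] at he
    obtain ⟨w, rfl⟩ : ∃ w, e = s(v, w) := (Sym2.mem_iff_exists).1 he.2
    exact h w (by
      rw [fromEdgeSet_adj]
      exact ⟨heW, G.ne_of_adj he.1⟩)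
  · intro h w hw
    rw [fromEdgeSet_adj] at hw
    have h2 : s(v, w) ∈ G.edgeFinset := hW hw.1
    rw [mem_edgeFinset] at h2
    refine h (a := s(v, w)) ?_ hw.1
    rw [SimpleGraph.mem_incidenceFinset]
    exact ⟨h2, by simp⟩

/-- Second moment bound for the number of isolated vertices. -/
theorem SimpleGraph.one_sub_le_real_exists_isIsolated (G : SimpleGraph V) [DecidableRel G.Adj]
    (p : unitInterval) (hp : (p : ℝ) < 1) {μ : ℝ} (hμ0 : 0 < μ)
    (hμ : μ ≤ ∑ v : V, (1 - (p : ℝ)) ^ G.degree v) :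
    1 - (1 / μ + p / (1 - p)) ≤ (G.randomSubgraph p).real {H | ∃ v, H.IsIsolated v} := by
  classical
  have h0 := p.2.1
  have hq : 0 < 1 - (p : ℝ) := by linarith
  have hq1 : 1 - (p : ℝ) ≤ 1 := by linarith
  obtain ⟨M, hM⟩ : ∃ M : ℝ, M = ∑ v : V, (1 - (p : ℝ)) ^ G.degree v := ⟨_, rfl⟩
  rw [← hM] at hμ
  have hM0 : 0 < M := lt_of_lt_of_le hμ0 hμ
  set wt : Finset (Sym2 V) → ℝ := fun W => (p : ℝ) ^ #W * (1 - p) ^ (#G.edgeFinset - #W) with hwt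
  have hw : ∀ W, 0 ≤ wt W := fun W => mul_nonneg (pow_nonneg h0 _) (pow_nonneg hq.le _)
  -- `X W` is the number of isolated vertices of the graph with edge set `W`, and `M` is its mean.
  set X : Finset (Sym2 V) → ℝ := fun W => ∑ v : V, if Disjoint (G.incidenceFinset v) W then 1 else 0
    with hX
  have e1 : ∑ W ∈ G.edgeFinset.powerset, wt W = 1 := by
    rw [Finset.sum_pow_mul_eq_add_pow]; simp
  have e2 : ∑ W ∈ G.edgeFinset.powerset, wt W * X W = M := by
    simp only [hX, Finset.mul_sum]
    rw [Finset.sum_comm, hM]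
    refine Finset.sum_congr rfl fun v _ => ?_
    rw [← G.card_incidenceFinset_eq_degree v, ← sum_weights_disjoint (p : ℝ) (G.incidenceFinset_subset v),
      Finset.sum_filter]
    exact Finset.sum_congr rfl fun W _ => by simp [hwt]
  have e3 : ∑ W ∈ G.edgeFinset.powerset, wt W * X W ^ 2 ≤ M + M ^ 2 / (1 - p) := by
    have h1 : ∑ W ∈ G.edgeFinset.powerset, wt W * X W ^ 2 = ∑ u : V, ∑ v : V,
        (1 - (p : ℝ)) ^ #(G.incidenceFinset u ∪ G.incidenceFinset v) := by
      have : ∀ W, wt W * X W ^ 2 = ∑ u : V, ∑ v : V, wt W *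
          if Disjoint (G.incidenceFinset u ∪ G.incidenceFinset v) W then 1 else 0 := by
        intro W
        rw [sq, hX]
        simp only
        rw [Finset.sum_mul_sum, Finset.mul_sum]
        refine Finset.sum_congr rfl fun u _ => ?_
        rw [Finset.mul_sum]
        refine Finset.sum_congr rfl fun v _ => ?_
        by_cases h1 : Disjoint (G.incidenceFinset u) W <;>
          by_cases h2 : Disjoint (G.incidenceFinset v) W <;> simp [disjoint_union_left, h1, h2]
      simp only [this]
      rw [Finset.sum_comm]
      refine Finset.sum_congr rfl fun u _ => ?_
      rw [Finset.sum_comm]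
      refine Finset.sum_congr rfl fun v _ => ?_
      rw [← sum_weights_disjoint (p : ℝ)
        (union_subset (G.incidenceFinset_subset u) (G.incidenceFinset_subset v)), Finset.sum_filter]
      exact Finset.sum_congr rfl fun W _ => by simp [hwt]
    rw [h1]
    -- Distinct vertices have at most one common incident edge, so the two isolation events are
    -- independent up to a factor `1 / (1 - p)`.
    have h2 : ∀ u v : V, (1 - (p : ℝ)) ^ #(G.incidenceFinset u ∪ G.incidenceFinset v) ≤
        (if u = v then (1 - (p : ℝ)) ^ G.degree u else 0) +
        (1 - (p : ℝ)) ^ G.degree u * (1 - (p : ℝ)) ^ G.degree v / (1 - p) := by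
      intro u v
      by_cases huv : u = v
      · subst huv
        rw [if_pos rfl, union_self, G.card_incidenceFinset_eq_degree]
        have : 0 ≤ (1 - (p : ℝ)) ^ G.degree u * (1 - (p : ℝ)) ^ G.degree u / (1 - p) := by positivity
        linarith
      · rw [if_neg huv, zero_add, le_div_iff₀ hq, ← pow_succ, ← pow_add]
        refine pow_le_pow_of_le_one hq.le hq1 ?_
        have h3 := card_union_add_card_inter (G.incidenceFinset u) (G.incidenceFinset v)
        rw [G.card_incidenceFinset_eq_degree, G.card_incidenceFinset_eq_degree] at h3
        have h4 : #(G.incidenceFinset u ∩ G.incidenceFinset v) ≤ 1 := by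
          rw [card_le_one]
          intro a ha b hb
          simp only [mem_inter, SimpleGraph.mem_incidenceFinset] at ha hb
          rw [(Sym2.mem_and_mem_iff huv).1 ⟨ha.1.2, ha.2.2⟩,
            (Sym2.mem_and_mem_iff huv).1 ⟨hb.1.2, hb.2.2⟩]
        omega
    calc _ ≤ ∑ u : V, ∑ v : V, ((if u = v then (1 - (p : ℝ)) ^ G.degree u else 0) +
        (1 - (p : ℝ)) ^ G.degree u * (1 - (p : ℝ)) ^ G.degree v / (1 - p)) :=
          Finset.sum_le_sum fun u _ => Finset.sum_le_sum fun v _ => h2 u v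
      _ = _ := by
          simp only [Finset.sum_add_distrib, ← Finset.sum_div]
          rw [← Finset.sum_mul_sum, ← hM, sq]
          congr 1
          simp [hM]
  -- Chebyshev's inequality, multiplied by `M ^ 2`.
  have e4 : (∑ W ∈ G.edgeFinset.powerset with X W = 0, wt W) * M ^ 2 ≤
      M + M ^ 2 / (1 - p) - M ^ 2 := by
    have h1 : (∑ W ∈ G.edgeFinset.powerset with X W = 0, wt W) * M ^ 2 ≤
        ∑ W ∈ G.edgeFinset.powerset, wt W * (X W - M) ^ 2 := by
      rw [Finset.sum_mul, Finset.sum_filter]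
      refine Finset.sum_le_sum fun W _ => ?_
      split_ifs with h
      · rw [h]; simp
      · exact mul_nonneg (hw W) (sq_nonneg _)
    have h2 : ∑ W ∈ G.edgeFinset.powerset, wt W * (X W - M) ^ 2 =
        ∑ W ∈ G.edgeFinset.powerset, wt W * X W ^ 2 -
          2 * M * ∑ W ∈ G.edgeFinset.powerset, wt W * X W +
          M ^ 2 * ∑ W ∈ G.edgeFinset.powerset, wt W := by
      rw [Finset.mul_sum, Finset.mul_sum, ← Finset.sum_sub_distrib, ← Finset.sum_add_distrib]
      exact Finset.sum_congr rfl fun W _ => by ring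
    rw [e1, e2] at h2
    nlinarith
  have e5 : ∑ W ∈ G.edgeFinset.powerset with X W = 0, wt W ≤ 1 / μ + p / (1 - p) := by
    have h1 : ∑ W ∈ G.edgeFinset.powerset with X W = 0, wt W ≤ 1 / M + p / (1 - p) := by
      rw [← mul_le_mul_iff_left₀ (show 0 < M ^ 2 by positivity)]
      refine e4.trans (le_of_eq ?_)
      field_simp
      ring
    have h2 : 1 / M ≤ 1 / μ := one_div_le_one_div_of_le hμ0 hμ
    linarith
  rw [SimpleGraph.randomSubgraph_real]
  have e6 : ∑ W ∈ G.edgeFinset.powerset with ∃ v, (SimpleGraph.ofEdges W).IsIsolated v, wt W =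
      ∑ W ∈ G.edgeFinset.powerset with ¬ X W = 0, wt W := by
    congr 1
    refine Finset.filter_congr fun W hW => ?_
    rw [mem_powerset] at hW
    simp only [G.isIsolated_fromEdgeSet_iff hW, hX]
    rw [Finset.sum_eq_zero_iff_of_nonneg (fun v _ => by split_ifs <;> norm_num)]
    push Not
    simp
  have e7 := Finset.sum_filter_add_sum_filter_not G.edgeFinset.powerset (fun W => X W = 0) wt
  rw [e1] at e7
  simp only [Set.mem_ofPred_eq]
  rw [e6]
  linarith

theorem SimpleGraph.IsHamiltonian.not_isIsolated {H : SimpleGraph V} (h : H.IsHamiltonian)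
    (hV : Fintype.card V ≠ 1) (v : V) : ¬ H.IsIsolated v := by
  intro hv
  obtain ⟨a, w, hw⟩ := h hV
  have hm : v ∈ w.support := hw.mem_support v
  have hn : ¬ (w.rotate v hm).Nil := (hw.isCycle.rotate hm).not_nil
  exact hv _ (SimpleGraph.Walk.adj_snd hn)
end randomSubgraph

/-! ### Tightness: isolated vertices below the threshold. -/

open Filter Topology in
theorem exists_isIsolated_of_le_log_div (c : ℝ) (hc : c < 1) (η : ℝ) (hη : 0 < η) :
    ∃ N : ℕ, ∀ n : ℕ, N ≤ n → ∀ (G : SimpleGraph (Fin n)) [DecidableRel G.Adj],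
      ∀ p : unitInterval, (p : ℝ) ≤ c * Real.log n / n →
        1 - η ≤ (G.randomSubgraph p).real {H | ∃ v, H.IsIsolated v} ∧
        1 - η ≤ (G.randomSubgraph p).real {H | ¬ H.IsHamiltonian} := by
  -- Raising `c` to at least `1 / 2` avoids negative constants. The midpoint `c₁` of `c₀` and `1`
  -- leaves room for the factor `1 / (1 - p)`, and the mean number of isolated vertices is at least
  -- `n ^ (1 - c₁)`.
  set c₀ := max c (1 / 2) with hc₀
  have h1 : c₀ < 1 := max_lt hc (by norm_num)
  have h2 : 1 / 2 ≤ c₀ := le_max_right _ _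
  set c₁ := (1 + c₀) / 2 with hc₁
  have hc11 : 0 < 1 - c₁ := by rw [hc₁]; linarith
  set δ := min ((1 - c₀) / 4) (η / 4) with hδ
  have hδ0 : 0 < δ := lt_min (by linarith) (by linarith)
  have t1 : Tendsto (fun n : ℕ => c₀ * Real.log n / n) atTop (𝓝 0) := by
    have h3 : Tendsto (fun x : ℝ => Real.log x / x) atTop (𝓝 0) :=
      Real.isLittleO_log_id_atTop.tendsto_div_nhds_zero
    have h4 := (h3.comp tendsto_natCast_atTop_atTop).const_mul c₀
    simp only [mul_zero, Function.comp_def] at h4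
    refine h4.congr fun n => ?_
    ring
  have t2 : Tendsto (fun n : ℕ => (n : ℝ) ^ (-(1 - c₁))) atTop (𝓝 0) :=
    (tendsto_rpow_neg_atTop hc11).comp tendsto_natCast_atTop_atTop
  have ev := ((t1.eventually (gt_mem_nhds hδ0)).and
    (t2.eventually (gt_mem_nhds (show 0 < η / 2 by linarith)))).and (eventually_ge_atTop 2)
  obtain ⟨N, hN⟩ := eventually_atTop.1 ev
  refine ⟨N, fun n hn G _ p hp => ?_⟩
  obtain ⟨⟨a1, a2⟩, a3⟩ := hN n hn
  have hn0 : (0 : ℝ) < n := by exact_mod_cast (by omega : 0 < n)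
  have hlog : 0 ≤ Real.log n := Real.log_nonneg (by exact_mod_cast (by omega : 1 ≤ n))
  have hp' : (p : ℝ) ≤ c₀ * Real.log n / n := hp.trans (by
    gcongr
    exact le_max_left _ _)
  have hpδ : (p : ℝ) < δ := lt_of_le_of_lt hp' a1
  have hp4 : (p : ℝ) < (1 - c₀) / 4 := hpδ.trans_le (min_le_left _ _)
  have hpη : (p : ℝ) < η / 4 := hpδ.trans_le (min_le_right _ _)
  have p0 := p.2.1
  have hpl : (p : ℝ) < 1 / 2 := by linarith
  have hq : 0 < 1 - (p : ℝ) := by linarith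
  have hμ : (n : ℝ) ^ (1 - c₁) ≤ ∑ v : Fin n, (1 - (p : ℝ)) ^ G.degree v := by
    have b1 : (n : ℝ) ^ (-c₁) ≤ (1 - (p : ℝ)) ^ n := by
      have b2 : Real.exp (-(p / (1 - p))) ≤ 1 - p := by
        have b3 := Real.add_one_le_exp ((p : ℝ) / (1 - p))
        rw [Real.exp_neg, inv_le_comm₀ (Real.exp_pos _) hq]
        refine le_trans (le_of_eq ?_) b3
        field_simp
        ring
      calc (n : ℝ) ^ (-c₁) = Real.exp (Real.log n * -c₁) := Real.rpow_def_of_pos hn0 _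
        _ ≤ Real.exp (n * -((p : ℝ) / (1 - p))) := by
            refine Real.exp_le_exp.2 ?_
            have b4 : n * ((p : ℝ) / (1 - p)) ≤ c₁ * Real.log n := by
              rw [le_div_iff₀ hn0] at hp'
              rw [← mul_div_assoc, div_le_iff₀ hq]
              have b5 : c₀ ≤ c₁ * (1 - p) := by
                rw [hc₁]; nlinarith
              calc (n : ℝ) * p = p * n := mul_comm _ _
                _ ≤ c₀ * Real.log n := hp'
                _ ≤ c₁ * (1 - p) * Real.log n := by gcongr
                _ = _ := by ring
            linarith
        _ = Real.exp (-(p / (1 - p))) ^ n := by rw [← Real.exp_nat_mul]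
        _ ≤ _ := pow_le_pow_left₀ (Real.exp_pos _).le b2 n
    calc (n : ℝ) ^ (1 - c₁) = n * (n : ℝ) ^ (-c₁) := by
          rw [sub_eq_add_neg, Real.rpow_add hn0, Real.rpow_one]
      _ ≤ n * (1 - (p : ℝ)) ^ n := by gcongr
      _ = ∑ v : Fin n, (1 - (p : ℝ)) ^ n := by simp
      _ ≤ _ := Finset.sum_le_sum fun v _ => pow_le_pow_of_le_one hq.le (by linarith) (by
          have := G.degree_lt_card_verts v
          rw [Fintype.card_fin] at this
          exact this.le)
  have main := G.one_sub_le_real_exists_isIsolated p (by linarith) (Real.rpow_pos_of_pos hn0 _) hμ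
  have hfin : 1 / (n : ℝ) ^ (1 - c₁) + p / (1 - p) ≤ η := by
    have f1 : 1 / (n : ℝ) ^ (1 - c₁) < η / 2 := by
      rw [one_div, ← Real.rpow_neg hn0.le]; exact a2
    have f2 : (p : ℝ) / (1 - p) ≤ η / 2 := by
      rw [div_le_iff₀ hq]; nlinarith
    linarith
  refine ⟨by linarith, ?_⟩
  have hsub : {H : SimpleGraph (Fin n) | ∃ v, H.IsIsolated v} ⊆ {H | ¬ H.IsHamiltonian} := by
    rintro H ⟨v, hv⟩ hH
    exact hH.not_isIsolated (by rw [Fintype.card_fin]; omega) v hv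
  have := measureReal_mono (μ := G.randomSubgraph p) hsub
  linarith

/-! ### Cyclic orderings as Hamilton cycles, rotations and moves. -/

section Ordering
variable {V : Type*} {n : ℕ} [NeZero n]

/-- The `i`-th vertex of a cyclic ordering. -/
def vtx (σ : Fin n ≃ V) (i : ℕ) : V := σ (Fin.ofNat n i)

theorem vtx_mod (σ : Fin n ≃ V) (i : ℕ) : vtx σ (i % n) = vtx σ i := by
  unfold vtx
  congr 1
  ext
  simp

theorem vtx_self (σ : Fin n ≃ V) : vtx σ n = vtx σ 0 := by
  rw [← vtx_mod, Nat.mod_self]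

theorem vtx_fin (σ : Fin n ≃ V) (i : Fin n) : vtx σ i = σ i := by
  unfold vtx
  congr 1
  ext
  simp

theorem vtx_inj {σ : Fin n ≃ V} {i j : ℕ} (hi : i < n) (hj : j < n) (h : vtx σ i = vtx σ j) :
    i = j := by
  have h1 := vtx_fin σ ⟨i, hi⟩
  have h2 := vtx_fin σ ⟨j, hj⟩
  simp only at h1 h2
  rw [h1, h2] at h
  simpa using σ.injective h

theorem exists_vtx (σ : Fin n ≃ V) (v : V) : ∃ i < n, vtx σ i = v :=
  ⟨σ.symm v, (σ.symm v).2, by rw [vtx_fin]; simp⟩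

/-- The `i`-th edge of the closed tour given by a cyclic ordering. -/
def tourEdge (σ : Fin n ≃ V) (i : ℕ) : Sym2 V := s(vtx σ i, vtx σ (i + 1))

theorem tourEdge_mod (σ : Fin n ≃ V) (i : ℕ) : tourEdge σ (i % n) = tourEdge σ i := by
  unfold tourEdge
  rw [vtx_mod, ← vtx_mod σ (i % n + 1), ← vtx_mod σ (i + 1)]
  simp

theorem tourEdge_last (σ : Fin n ≃ V) : tourEdge σ (n - 1) = s(vtx σ (n - 1), vtx σ 0) := by
  unfold tourEdge
  rw [Nat.sub_add_cancel (NeZero.one_le), vtx_self]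

/-- The condition `3 ≤ n` is needed: on two vertices the tour runs along the same edge twice. -/
theorem tourEdge_inj {σ : Fin n ≃ V} (hn : 3 ≤ n) {i j : ℕ} (hi : i < n) (hj : j < n)
    (h : tourEdge σ i = tourEdge σ j) : i = j := by
  have aux : ∀ k < n, ∃ k' < n, vtx σ (k + 1) = vtx σ k' ∧ (k' = k + 1 ∨ (k' = 0 ∧ k + 1 = n)) := by
    intro k hk
    by_cases h : k + 1 < n
    · exact ⟨k + 1, h, rfl, Or.inl rfl⟩
    · have : k + 1 = n := by omega
      exact ⟨0, by omega, by rw [this, vtx_self], Or.inr ⟨rfl, this⟩⟩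
  obtain ⟨i', hi', ei, ci⟩ := aux i hi
  obtain ⟨j', hj', ej, cj⟩ := aux j hj
  unfold tourEdge at h
  rw [ei, ej] at h
  rcases Sym2.eq_iff.1 h with ⟨h1, _⟩ | ⟨h1, h2⟩
  · exact vtx_inj hi hj h1
  · have e1 := vtx_inj hi hj' h1
    have e2 := vtx_inj hi' hj h2
    omega

variable [DecidableEq V]

/-- The edges of the closed tour. -/
def cycEdges (σ : Fin n ≃ V) : Finset (Sym2 V) := (range n).image (tourEdge σ)

/-- The edges of the tour without the closing edge. -/
def pathEdges (σ : Fin n ≃ V) : Finset (Sym2 V) := (range (n - 1)).image (tourEdge σ)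

theorem mem_cycEdges {σ : Fin n ≃ V} {e : Sym2 V} : e ∈ cycEdges σ ↔ ∃ i < n, tourEdge σ i = e := by
  simp [cycEdges]

theorem mem_pathEdges {σ : Fin n ≃ V} {e : Sym2 V} :
    e ∈ pathEdges σ ↔ ∃ i < n - 1, tourEdge σ i = e := by
  simp [pathEdges]

theorem cycEdges_eq_insert (σ : Fin n ≃ V) :
    cycEdges σ = insert (tourEdge σ (n - 1)) (pathEdges σ) := by
  have h1 := NeZero.one_le (n := n)
  ext e
  rw [mem_insert, mem_cycEdges, mem_pathEdges]
  constructor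
  · rintro ⟨i, hi, rfl⟩
    by_cases h : i = n - 1
    · exact Or.inl (by rw [h])
    · exact Or.inr ⟨i, by omega, rfl⟩
  · rintro (rfl | ⟨i, hi, rfl⟩)
    · exact ⟨n - 1, by omega, rfl⟩
    · exact ⟨i, by omega, rfl⟩

theorem pathEdges_subset_cycEdges (σ : Fin n ≃ V) : pathEdges σ ⊆ cycEdges σ := by
  rw [cycEdges_eq_insert]; exact subset_insert _ _

theorem tourEdge_last_notMem_pathEdges (hn : 3 ≤ n) (σ : Fin n ≃ V) :
    tourEdge σ (n - 1) ∉ pathEdges σ := by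
  rw [mem_pathEdges]
  rintro ⟨i, hi, h⟩
  have := tourEdge_inj hn (by omega) (by omega) h
  omega

theorem card_cycEdges (hn : 3 ≤ n) (σ : Fin n ≃ V) : #(cycEdges σ) = n := by
  unfold cycEdges
  rw [card_image_of_injOn, card_range]
  intro i hi j hj h
  exact tourEdge_inj hn (by simpa using hi) (by simpa using hj) h

theorem card_filter_tourEdge_mem (hn : 3 ≤ n) (σ : Fin n ≃ V) (T : Finset (Sym2 V)) {m : ℕ}
    (hm : m ≤ n) : #{i ∈ range m | tourEdge σ i ∈ T} ≤ #T := by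
  refine card_le_card_of_injOn (tourEdge σ) (fun i hi => (mem_filter.1 hi).2) ?_
  intro i hi j hj h
  have h1 := (mem_filter.1 (mem_coe.1 hi)).1
  have h2 := (mem_filter.1 (mem_coe.1 hj)).1
  rw [mem_range] at h1 h2
  exact tourEdge_inj hn (by omega) (by omega) h

/-! ### Operations on orderings -/

/-- Cyclic shift of an ordering. -/
def shiftOrd (t : Fin n) (σ : Fin n ≃ V) : Fin n ≃ V := (Equiv.addRight t).trans σ

omit [DecidableEq V] in
theorem vtx_shiftOrd (t : Fin n) (σ : Fin n ≃ V) (i : ℕ) :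
    vtx (shiftOrd t σ) i = vtx σ (i + t) := by
  unfold vtx shiftOrd
  simp only [Equiv.trans_apply, Equiv.coe_addRight]
  congr 1
  ext
  simp [Fin.val_add]

omit [DecidableEq V] in
theorem shiftOrd_injective (t : Fin n) : Function.Injective (shiftOrd (V := V) t) := by
  intro σ τ h
  ext i
  have := congrArg (fun f => f (i - t)) h
  simpa [shiftOrd] using this

omit [DecidableEq V] in
theorem tourEdge_shiftOrd (t : Fin n) (σ : Fin n ≃ V) (i : ℕ) :
    tourEdge (shiftOrd t σ) i = tourEdge σ (i + t) := by
  unfold tourEdge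
  rw [vtx_shiftOrd, vtx_shiftOrd, show i + 1 + (t : ℕ) = i + t + 1 by omega]

theorem cycEdges_shiftOrd (t : Fin n) (σ : Fin n ≃ V) : cycEdges (shiftOrd t σ) = cycEdges σ := by
  have h0 : 0 < n := NeZero.pos n
  ext e
  simp only [mem_cycEdges, tourEdge_shiftOrd]
  constructor
  · rintro ⟨i, _, rfl⟩
    exact ⟨(i + t) % n, Nat.mod_lt _ h0, tourEdge_mod σ _⟩
  · rintro ⟨i, hi, rfl⟩
    refine ⟨(i + (n - t)) % n, Nat.mod_lt _ h0, ?_⟩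
    have h1 : ((i + (n - (t : ℕ))) % n + t) % n = i := by
      have := t.2
      rw [Nat.mod_add_mod, show i + (n - (t : ℕ)) + t = i + n by omega, Nat.add_mod_right,
        Nat.mod_eq_of_lt hi]
    rw [← tourEdge_mod, h1]

/-- The reversed ordering. -/
def revOrd (σ : Fin n ≃ V) : Fin n ≃ V := Fin.revPerm.trans σ

omit [DecidableEq V] in
theorem vtx_revOrd (σ : Fin n ≃ V) {i : ℕ} (hi : i < n) : vtx (revOrd σ) i = vtx σ (n - 1 - i) := by
  unfold vtx revOrd
  simp only [Equiv.trans_apply, Fin.revPerm_apply]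
  congr 1
  ext
  rw [Fin.val_rev]
  simp only [Fin.val_ofNat]
  rw [Nat.mod_eq_of_lt hi, Nat.mod_eq_of_lt (by omega)]
  omega

omit [DecidableEq V] [NeZero n] in
theorem revOrd_injective : Function.Injective (revOrd (V := V) (n := n)) := by
  intro σ τ h
  ext i
  have := congrArg (fun f => f i.rev) h
  simpa [revOrd] using this

omit [DecidableEq V] in
theorem tourEdge_revOrd (σ : Fin n ≃ V) {i : ℕ} (hi : i + 1 < n) :
    tourEdge (revOrd σ) i = tourEdge σ (n - 2 - i) := by
  unfold tourEdge
  rw [vtx_revOrd σ (by omega), vtx_revOrd σ hi, Sym2.eq_swap]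
  have h1 : n - 1 - (i + 1) = n - 2 - i := by omega
  have h2 : n - 1 - i = n - 2 - i + 1 := by omega
  rw [h1, h2]

theorem pathEdges_revOrd (σ : Fin n ≃ V) : pathEdges (revOrd σ) = pathEdges σ := by
  ext e
  simp only [mem_pathEdges]
  constructor
  · rintro ⟨i, hi, rfl⟩
    exact ⟨n - 2 - i, by omega, (tourEdge_revOrd σ (by omega)).symm⟩
  · rintro ⟨i, hi, rfl⟩
    refine ⟨n - 2 - i, by omega, ?_⟩
    rw [tourEdge_revOrd σ (by omega)]
    congr 1
    omega

/-- The permutation reversing the positions `0, …, i`. -/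
def revPrefixPerm (i : Fin n) : Equiv.Perm (Fin n) :=
  Function.Involutive.toPerm
    (fun k : Fin n => if h : (k : ℕ) ≤ i then (⟨i - k, by omega⟩ : Fin n) else k) (by
      intro k
      by_cases h : (k : ℕ) ≤ i
      · simp only [h, dite_true]
        rw [dif_pos (by simp)]
        ext
        simp only
        omega
      · simp [h])

/-- Reverse the positions `0, …, i` of an ordering. -/
def revPrefix (i : Fin n) (σ : Fin n ≃ V) : Fin n ≃ V := (revPrefixPerm i).trans σ

omit [DecidableEq V] in
theorem vtx_revPrefix_of_le (i : Fin n) (σ : Fin n ≃ V) {k : ℕ} (hk : k ≤ i) :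
    vtx (revPrefix i σ) k = vtx σ (i - k) := by
  have hkn : k < n := by omega
  have h1 := vtx_fin (revPrefix i σ) ⟨k, hkn⟩
  have h2 := vtx_fin σ ⟨i - k, by omega⟩
  simp only at h1 h2
  rw [h1, h2]
  have h3 : (⟨k, hkn⟩ : Fin n) ≤ i := hk
  simp [revPrefix, revPrefixPerm, h3]

omit [DecidableEq V] in
theorem vtx_revPrefix_of_lt (i : Fin n) (σ : Fin n ≃ V) {k : ℕ} (hk : i < k) (hkn : k < n) :
    vtx (revPrefix i σ) k = vtx σ k := by
  have h1 := vtx_fin (revPrefix i σ) ⟨k, hkn⟩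
  have h2 := vtx_fin σ ⟨k, hkn⟩
  simp only at h1 h2
  rw [h1, h2]
  have h3 : ¬ (⟨k, hkn⟩ : Fin n) ≤ i := not_le.2 hk
  simp [revPrefix, revPrefixPerm, h3]

omit [DecidableEq V] [NeZero n] in
theorem revPrefix_injective (i : Fin n) : Function.Injective (revPrefix (V := V) i) := by
  intro σ τ h
  ext k
  have := congrArg (fun f => f ((revPrefixPerm i).symm k)) h
  simpa [revPrefix] using this

omit [DecidableEq V] in
theorem vtx_revPrefix_zero (i : Fin n) (σ : Fin n ≃ V) : vtx (revPrefix i σ) 0 = vtx σ i := by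
  rw [vtx_revPrefix_of_le i σ (Nat.zero_le _), Nat.sub_zero]

omit [DecidableEq V] in
theorem vtx_revPrefix_self (i : Fin n) (σ : Fin n ≃ V) : vtx (revPrefix i σ) i = vtx σ 0 := by
  rw [vtx_revPrefix_of_le i σ le_rfl, Nat.sub_self]

omit [DecidableEq V] in
theorem vtx_revPrefix_last {i : Fin n} (hi : (i : ℕ) < n - 1) (σ : Fin n ≃ V) :
    vtx (revPrefix i σ) (n - 1) = vtx σ (n - 1) :=
  vtx_revPrefix_of_lt i σ hi (by omega)

omit [DecidableEq V] in
theorem tourEdge_revPrefix_of_lt (i : Fin n) (σ : Fin n ≃ V) {k : ℕ} (hk : k < i) :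
    tourEdge (revPrefix i σ) k = tourEdge σ (i - k - 1) := by
  unfold tourEdge
  rw [vtx_revPrefix_of_le i σ hk.le, vtx_revPrefix_of_le i σ hk, Sym2.eq_swap]
  have h1 : (i : ℕ) - (k + 1) = i - k - 1 := by omega
  have h2 : (i : ℕ) - k = i - k - 1 + 1 := by omega
  rw [h1, ← h2]

omit [DecidableEq V] in
theorem tourEdge_revPrefix_self {i : Fin n} (hi : (i : ℕ) < n - 1) (σ : Fin n ≃ V) :
    tourEdge (revPrefix i σ) i = s(vtx σ 0, vtx σ (i + 1)) := by
  unfold tourEdge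
  rw [vtx_revPrefix_self, vtx_revPrefix_of_lt i σ (by omega) (by omega)]

omit [DecidableEq V] in
theorem tourEdge_revPrefix_of_gt (i : Fin n) (σ : Fin n ≃ V) {k : ℕ} (hk : i < k) (hkn : k < n - 1) :
    tourEdge (revPrefix i σ) k = tourEdge σ k := by
  unfold tourEdge
  rw [vtx_revPrefix_of_lt i σ hk (by omega), vtx_revPrefix_of_lt i σ (by omega) (by omega)]

/-- Pósa's rotation. For the path `v₀, …, v_{n-1}`, reversing the first `i + 1` vertices trades the
edge `v_i v_{i+1}` for `v₀ v_{i+1}`; the first vertex becomes `v_i` and the last one stays. -/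
theorem mem_pathEdges_revPrefix {i : Fin n} (hi : (i : ℕ) < n - 1) (σ : Fin n ≃ V) {e : Sym2 V} :
    e ∈ pathEdges (revPrefix i σ) ↔
      (∃ k < n - 1, k ≠ i ∧ tourEdge σ k = e) ∨ e = s(vtx σ 0, vtx σ (i + 1)) := by
  rw [mem_pathEdges]
  constructor
  · rintro ⟨k, hk, rfl⟩
    rcases lt_trichotomy k i with h | h | h
    · exact Or.inl ⟨i - k - 1, by omega, by omega, (tourEdge_revPrefix_of_lt i σ h).symm⟩
    · subst h
      exact Or.inr (tourEdge_revPrefix_self hi σ)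
    · exact Or.inl ⟨k, hk, by omega, (tourEdge_revPrefix_of_gt i σ h hk).symm⟩
  · rintro (⟨k, hk, hki, rfl⟩ | rfl)
    · rcases lt_or_gt_of_ne hki with h | h
      · refine ⟨i - k - 1, by omega, ?_⟩
        rw [tourEdge_revPrefix_of_lt i σ (by omega)]
        congr 1
        omega
      · exact ⟨k, hk, tourEdge_revPrefix_of_gt i σ h hk⟩
    · exact ⟨i, hi, tourEdge_revPrefix_self hi σ⟩

theorem pathEdges_revPrefix_subset {i : Fin n} (hi : (i : ℕ) < n - 1) (σ : Fin n ≃ V) :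
    pathEdges (revPrefix i σ) ⊆ insert s(vtx σ 0, vtx σ (i + 1)) (pathEdges σ) := by
  intro e he
  rcases (mem_pathEdges_revPrefix hi σ).1 he with ⟨k, hk, _, rfl⟩ | rfl
  · exact mem_insert_of_mem (mem_pathEdges.2 ⟨k, hk, rfl⟩)
  · exact mem_insert_self _ _

theorem subset_pathEdges_revPrefix {i : Fin n} (hi : (i : ℕ) < n - 1) {σ : Fin n ≃ V}
    {F : Finset (Sym2 V)} (hF : F ⊆ pathEdges σ) (hiF : tourEdge σ i ∉ F) :
    F ⊆ pathEdges (revPrefix i σ) := by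
  intro e he
  rw [mem_pathEdges_revPrefix hi]
  obtain ⟨k, hk, rfl⟩ := mem_pathEdges.1 (hF he)
  refine Or.inl ⟨k, hk, ?_, rfl⟩
  rintro rfl
  exact hiF he

/-- Closing a path by a pair of crossing edges. -/
theorem cycEdges_revPrefix_subset {i : Fin n} (hi : (i : ℕ) < n - 1) (σ : Fin n ≃ V)
    {A : Finset (Sym2 V)} (h1 : s(vtx σ 0, vtx σ (i + 1)) ∈ A)
    (h2 : s(vtx σ (n - 1), vtx σ i) ∈ A) :
    cycEdges (revPrefix i σ) ⊆ pathEdges σ ∪ A := by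
  rw [cycEdges_eq_insert, insert_subset_iff, tourEdge_last, vtx_revPrefix_last hi, vtx_revPrefix_zero]
  refine ⟨mem_union_right _ h2, (pathEdges_revPrefix_subset hi σ).trans ?_⟩
  rw [insert_subset_iff]
  exact ⟨mem_union_right _ h1, subset_union_left⟩

/-! ### Moves -/

/-- A move consists of a mode and three positions. -/
abbrev Move (n : ℕ) := Fin 3 × Fin n × Fin n × Fin n

/-- The effect of a move: cut open the closing edge, and close the path again after zero, one
or two rotations. -/
def Move.apply (m : Move n) (σ : Fin n ≃ V) : Fin n ≃ V :=
  match m.1 with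
  | 0 => shiftOrd m.2.1 (revPrefix m.2.2.2 σ)
  | 1 => shiftOrd m.2.2.1 (revPrefix m.2.2.2 (revPrefix m.2.1 σ))
  | 2 => revPrefix m.2.2.2 (revPrefix m.2.2.1 (revOrd (revPrefix m.2.1 σ)))

/-- The rotations keep the last vertex in place. -/
def Move.Proper (m : Move n) : Prop :=
  match m.1 with
  | 0 => (m.2.2.2 : ℕ) < n - 1
  | 1 => (m.2.1 : ℕ) < n - 1 ∧ (m.2.2.2 : ℕ) < n - 1
  | 2 => (m.2.1 : ℕ) < n - 1

/-- The coordinate of a move that is not determined by its result. -/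
def Move.free (m : Move n) : Fin n :=
  match m.1 with
  | 0 => m.2.2.1
  | 1 => m.2.2.2
  | 2 => m.2.2.2

omit [DecidableEq V] in
theorem Move.apply_injective (m : Move n) :
    Function.Injective (fun σ : Fin n ≃ V => m.apply σ) := by
  obtain ⟨t, i, j, l⟩ := m
  fin_cases t
  · exact fun σ τ h => revPrefix_injective _ (shiftOrd_injective _ h)
  · exact fun σ τ h => revPrefix_injective _ (revPrefix_injective _ (shiftOrd_injective _ h))
  · exact fun σ τ h => revPrefix_injective _ (revOrd_injective (revPrefix_injective _
      (revPrefix_injective _ h)))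

-- The last vertex is known, and its position after the shift reveals the amount of the shift.
omit [DecidableEq V] in
theorem shiftOrd_cancel {t t' : Fin n} {σ τ : Fin n ≃ V} (h : shiftOrd t σ = shiftOrd t' τ)
    (hb : vtx σ (n - 1) = vtx τ (n - 1)) : t = t' ∧ σ = τ := by
  have h0 : 0 < n := NeZero.pos n
  have key : t = t' := by
    have h1 : vtx (shiftOrd t σ) (n - 1 + (n - t)) = vtx σ (n - 1) := by
      rw [vtx_shiftOrd, show n - 1 + (n - (t : ℕ)) + t = (n - 1) + n by omega, ← vtx_mod]
      rw [Nat.add_mod_right, vtx_mod]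
    have h2 : vtx (shiftOrd t' τ) (n - 1 + (n - t')) = vtx τ (n - 1) := by
      rw [vtx_shiftOrd, show n - 1 + (n - (t' : ℕ)) + t' = (n - 1) + n by omega, ← vtx_mod]
      rw [Nat.add_mod_right, vtx_mod]
    rw [hb, ← h2, h, ← vtx_mod, ← vtx_mod _ (n - 1 + (n - (t' : ℕ)))] at h1
    have h3 := vtx_inj (Nat.mod_lt _ h0) (Nat.mod_lt _ h0) h1
    have e1 : ∀ s : Fin n, (n - 1 + (n - (s : ℕ))) % n = n - 1 - s := by
      intro s
      have := s.2
      rw [show n - 1 + (n - (s : ℕ)) = (n - 1 - s) + n by omega, Nat.add_mod_right,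
        Nat.mod_eq_of_lt (by omega)]
    rw [e1, e1] at h3
    ext
    omega
  subst key
  exact ⟨rfl, shiftOrd_injective t h⟩

-- The known first vertex is moved to position `t`, which reveals `t`.
omit [DecidableEq V] in
theorem revPrefix_cancel {t t' : Fin n} {σ τ : Fin n ≃ V} (h : revPrefix t σ = revPrefix t' τ)
    (ha : vtx σ 0 = vtx τ 0) : t = t' ∧ σ = τ := by
  have h1 := vtx_revPrefix_self t σ
  have h2 := vtx_revPrefix_self t' τ
  rw [ha, ← h2, h] at h1
  have h3 := vtx_inj t.2 t'.2 h1
  have key : t = t' := Fin.ext h3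
  subst key
  exact ⟨rfl, revPrefix_injective t h⟩

-- Let `a`, `b` be the known first and last vertices. In modes `0` and `1` the position of `b`
-- reveals the shift. In mode `2`, after the closing reversal is undone, the position of `b` reveals
-- the second rotation, because `b` was at the front when it was made. The position of `a` reveals
-- the one remaining reversal. In modes `1` and `2` the closing reversal must be given in advance,
-- as the free coordinate; in mode `0` the free coordinate has no effect.
omit [DecidableEq V] in
theorem Move.cancel {m m' : Move n} (hm : m.Proper) (hm' : m'.Proper) {σ τ : Fin n ≃ V}
    (ha : vtx σ 0 = vtx τ 0) (hb : vtx σ (n - 1) = vtx τ (n - 1))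
    (h1 : m.1 = m'.1) (h2 : m.free = m'.free) (h : m.apply σ = m'.apply τ) : σ = τ ∧ m = m' := by
  obtain ⟨t, i, j, l⟩ := m
  obtain ⟨t', i', j', l'⟩ := m'
  simp only at h1
  subst h1
  fin_cases t
  · simp only [Move.free, Move.apply, Move.Proper] at *
    subst h2
    obtain ⟨rfl, h3⟩ := shiftOrd_cancel h (by rw [vtx_revPrefix_last hm, vtx_revPrefix_last hm', hb])
    obtain ⟨rfl, h4⟩ := revPrefix_cancel h3 ha
    exact ⟨h4, rfl⟩
  · simp only [Move.free, Move.apply, Move.Proper] at *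
    subst h2
    obtain ⟨rfl, h3⟩ := shiftOrd_cancel h (by
      rw [vtx_revPrefix_last hm.2, vtx_revPrefix_last hm'.2, vtx_revPrefix_last hm.1,
        vtx_revPrefix_last hm'.1, hb])
    obtain ⟨rfl, h4⟩ := revPrefix_cancel (revPrefix_injective _ h3) ha
    exact ⟨h4, rfl⟩
  · simp only [Move.free, Move.apply, Move.Proper] at *
    subst h2
    obtain ⟨rfl, h3⟩ := revPrefix_cancel (revPrefix_injective _ h) (by
      rw [vtx_revOrd _ (NeZero.pos n), vtx_revOrd _ (NeZero.pos n), Nat.sub_zero,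
        vtx_revPrefix_last hm, vtx_revPrefix_last hm', hb])
    obtain ⟨rfl, h4⟩ := revPrefix_cancel (revOrd_injective h3) ha
    exact ⟨h4, rfl⟩

end Ordering

/-! ### Switching: flexibility implies spread. -/

section Switching
variable {V : Type*} [Fintype V] [DecidableEq V] {n : ℕ} [NeZero n]

variable (n) in
/-- The orderings whose tours contain `F` and are contained in `A`. -/
def tours (F A : Finset (Sym2 V)) : Finset (Fin n ≃ V) :=
  univ.filter fun σ => F ⊆ cycEdges σ ∧ cycEdges σ ⊆ A

theorem mem_tours {F A : Finset (Sym2 V)} {σ : Fin n ≃ V} :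
    σ ∈ tours n F A ↔ F ⊆ cycEdges σ ∧ cycEdges σ ⊆ A := by
  simp [tours]

theorem shiftOrd_mem_tours {F A : Finset (Sym2 V)} {σ : Fin n ≃ V} (h : σ ∈ tours n F A)
    (t : Fin n) : shiftOrd t σ ∈ tours n F A := by
  rw [mem_tours, cycEdges_shiftOrd]
  exact mem_tours.1 h

open Classical in
/-- The moves which keep `F` and only use edges of the path and of `A`. -/
noncomputable def goodMoves (A F : Finset (Sym2 V)) (σ : Fin n ≃ V) : Finset (Move n) :=
  univ.filter fun m => m.Proper ∧ F ⊆ cycEdges (m.apply σ) ∧ cycEdges (m.apply σ) ⊆ pathEdges σ ∪ A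

omit [Fintype V] in
theorem mem_goodMoves {A F : Finset (Sym2 V)} {σ : Fin n ≃ V} {m : Move n} :
    m ∈ goodMoves A F σ ↔ m.Proper ∧ F ⊆ cycEdges (m.apply σ) ∧
      cycEdges (m.apply σ) ⊆ pathEdges σ ∪ A := by
  simp [goodMoves]

variable (n) in
/-- Every tour in `K ∪ F₀` through `F₀` can be reclosed, after deleting its last edge, by a positive
proportion of all moves, even if a small set `F` of edges is protected. -/
def Flexible (A K F₀ : Finset (Sym2 V)) (ε c : ℝ) : Prop :=
  ∀ σ : Fin n ≃ V, σ ∈ tours n F₀ (K ∪ F₀) → tourEdge σ (n - 1) ∉ F₀ →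
    ∀ F : Finset (Sym2 V), F₀ ⊆ F → F ⊆ pathEdges σ → (#F : ℝ) ≤ ε * n →
      c * (n : ℝ) ^ 3 ≤ #(goodMoves A F σ)

-- A cyclic shift brings any edge of the tour into the last place, where it can be cut. The family
-- must be closed under shifts.
omit [Fintype V] [DecidableEq V] in
theorem card_filter_tourEdge_le (𝓕 : Finset (Fin n ≃ V)) (h𝓕 : ∀ σ ∈ 𝓕, ∀ t, shiftOrd t σ ∈ 𝓕)
    (P : Sym2 V → Prop) [DecidablePred P] (t : ℕ) :
    #{σ ∈ 𝓕 | P (tourEdge σ t)} ≤ #{σ ∈ 𝓕 | P (tourEdge σ (n - 1))} := by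
  have h0 : 0 < n := NeZero.pos n
  refine card_le_card_of_injOn (shiftOrd (⟨(t + 1) % n, Nat.mod_lt _ h0⟩ : Fin n)) ?_
    ((shiftOrd_injective _).injOn)
  intro σ hσ
  rw [mem_coe, mem_filter] at hσ ⊢
  refine ⟨h𝓕 σ hσ.1 _, ?_⟩
  rw [tourEdge_shiftOrd]
  have : tourEdge σ (n - 1 + (t + 1) % n) = tourEdge σ t := by
    rw [← tourEdge_mod, Nat.add_mod_mod, show n - 1 + (t + 1) = t + n by omega, Nat.add_mod_right,
      tourEdge_mod]
  simp only
  rw [this]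
  exact hσ.2

omit [Fintype V] [DecidableEq V] in
theorem sum_card_filter_tourEdge_le (𝓕 : Finset (Fin n ≃ V))
    (h𝓕 : ∀ σ ∈ 𝓕, ∀ t, shiftOrd t σ ∈ 𝓕) (P : Sym2 V → Prop) [DecidablePred P] :
    ∑ σ ∈ 𝓕, #{t ∈ range n | P (tourEdge σ t)} ≤ n * #{σ ∈ 𝓕 | P (tourEdge σ (n - 1))} := by
  have h1 : ∑ σ ∈ 𝓕, #{t ∈ range n | P (tourEdge σ t)} =
      ∑ t ∈ range n, #{σ ∈ 𝓕 | P (tourEdge σ t)} := by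
    simp only [card_filter]
    rw [Finset.sum_comm]
  rw [h1]
  calc _ ≤ ∑ t ∈ range n, #{σ ∈ 𝓕 | P (tourEdge σ (n - 1))} :=
        Finset.sum_le_sum fun t _ => card_filter_tourEdge_le 𝓕 h𝓕 P t
    _ = _ := by simp

-- By `Move.cancel`, a pair of an ordering and a move is determined by the result, the mode (`3`
-- choices) and the free coordinate (`n` choices).
omit [Fintype V] [DecidableEq V] in
theorem sum_card_moves_le (𝓐 𝓑 : Finset (Fin n ≃ V)) (a b : V)
    (h𝓐 : ∀ σ ∈ 𝓐, vtx σ 0 = a ∧ vtx σ (n - 1) = b) (g : (Fin n ≃ V) → Finset (Move n))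
    (hg : ∀ σ ∈ 𝓐, ∀ m ∈ g σ, m.Proper ∧ m.apply σ ∈ 𝓑) :
    ∑ σ ∈ 𝓐, #(g σ) ≤ #𝓑 * (3 * n) := by
  rw [← card_sigma]
  have h1 : #(𝓑 ×ˢ (univ : Finset (Fin 3 × Fin n))) = #𝓑 * (3 * n) := by
    simp [card_product]
  rw [← h1]
  refine card_le_card_of_injOn (fun x => (x.2.apply x.1, (x.2.1, x.2.free))) ?_ ?_
  · rintro ⟨σ, m⟩ h
    rw [mem_coe, mem_sigma] at h
    simp [(hg σ h.1 m h.2).2]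
  · rintro ⟨σ, m⟩ h ⟨τ, m'⟩ h' he
    rw [mem_coe, mem_sigma] at h h'
    simp only [Prod.mk.injEq] at he
    obtain ⟨e1, e2, e3⟩ := he
    have a1 := h𝓐 σ h.1
    have a2 := h𝓐 τ h'.1
    obtain ⟨rfl, rfl⟩ := Move.cancel (hg σ h.1 m h.2).1 (hg τ h'.1 m' h'.2).1
      (a1.1.trans a2.1.symm) (a1.2.trans a2.2.symm) e2 e3 e1
    rfl

omit [Fintype V] in
/-- Double counting of the ways to remove an edge `e` from a tour. -/
theorem card_mul_le_of_moves (𝓕 𝓑 : Finset (Fin n ≃ V)) (e : Sym2 V)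
    (h𝓕 : ∀ σ ∈ 𝓕, ∀ t, shiftOrd t σ ∈ 𝓕) (he : ∀ σ ∈ 𝓕, e ∈ cycEdges σ)
    (g : (Fin n ≃ V) → Finset (Move n))
    (hg : ∀ σ ∈ 𝓕, tourEdge σ (n - 1) = e → ∀ m ∈ g σ, m.Proper ∧ m.apply σ ∈ 𝓑)
    {x : ℝ} (hx0 : 0 ≤ x) (hx : ∀ σ ∈ 𝓕, tourEdge σ (n - 1) = e → x ≤ #(g σ)) :
    (#𝓕 : ℝ) * x ≤ 6 * (n : ℝ) ^ 2 * #𝓑 := by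
  have h1 : #𝓕 ≤ n * #{σ ∈ 𝓕 | tourEdge σ (n - 1) = e} := by
    refine le_trans ?_ (sum_card_filter_tourEdge_le 𝓕 h𝓕 (fun e' => e' = e))
    rw [card_eq_sum_ones]
    refine Finset.sum_le_sum fun σ hσ => ?_
    obtain ⟨t, ht, h⟩ := mem_cycEdges.1 (he σ hσ)
    exact card_pos.2 ⟨t, by simp [ht, h]⟩
  induction e with
  | _ a b =>
  -- The edge can be traversed in two directions. Fixing the direction fixes both ends of the path,
  -- as the double counting requires.
  have key : ∀ a' b' : V, s(a', b') = s(a, b) →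
      (#{σ ∈ 𝓕 | vtx σ 0 = a' ∧ vtx σ (n - 1) = b'} : ℝ) * x ≤ #𝓑 * (3 * n) := by
    intro a' b' hab
    have h2 := sum_card_moves_le {σ ∈ 𝓕 | vtx σ 0 = a' ∧ vtx σ (n - 1) = b'} 𝓑 a' b'
      (fun σ hσ => (mem_filter.1 hσ).2) g (fun σ hσ m hm => by
        rw [mem_filter] at hσ
        refine hg σ hσ.1 ?_ m hm
        rw [tourEdge_last, hσ.2.1, hσ.2.2, ← hab, Sym2.eq_swap])
    have h3 : (#{σ ∈ 𝓕 | vtx σ 0 = a' ∧ vtx σ (n - 1) = b'} : ℝ) * x ≤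
        ∑ σ ∈ 𝓕 with vtx σ 0 = a' ∧ vtx σ (n - 1) = b', (#(g σ) : ℝ) := by
      rw [← nsmul_eq_mul, ← Finset.sum_const]
      refine Finset.sum_le_sum fun σ hσ => ?_
      rw [mem_filter] at hσ
      refine hx σ hσ.1 ?_
      rw [tourEdge_last, hσ.2.1, hσ.2.2, ← hab, Sym2.eq_swap]
    refine h3.trans ?_
    exact_mod_cast h2
  have h4 : #{σ ∈ 𝓕 | tourEdge σ (n - 1) = s(a, b)} ≤
      #{σ ∈ 𝓕 | vtx σ 0 = a ∧ vtx σ (n - 1) = b} + #{σ ∈ 𝓕 | vtx σ 0 = b ∧ vtx σ (n - 1) = a} := by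
    refine le_trans (card_le_card ?_) (card_union_le _ _)
    intro σ hσ
    rw [mem_filter, tourEdge_last] at hσ
    rw [mem_union, mem_filter, mem_filter]
    rcases Sym2.eq_iff.1 hσ.2 with ⟨h, h'⟩ | ⟨h, h'⟩
    · exact Or.inr ⟨hσ.1, h', h⟩
    · exact Or.inl ⟨hσ.1, h', h⟩
  have k1 := key a b rfl
  have k2 := key b a Sym2.eq_swap
  have h5 : (#𝓕 : ℝ) ≤ n * (#{σ ∈ 𝓕 | vtx σ 0 = a ∧ vtx σ (n - 1) = b} +
      #{σ ∈ 𝓕 | vtx σ 0 = b ∧ vtx σ (n - 1) = a}) := by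
    have : #𝓕 ≤ n * (#{σ ∈ 𝓕 | vtx σ 0 = a ∧ vtx σ (n - 1) = b} +
      #{σ ∈ 𝓕 | vtx σ 0 = b ∧ vtx σ (n - 1) = a}) := h1.trans (Nat.mul_le_mul_left _ h4)
    exact_mod_cast this
  calc (#𝓕 : ℝ) * x ≤ n * (#{σ ∈ 𝓕 | vtx σ 0 = a ∧ vtx σ (n - 1) = b} +
      #{σ ∈ 𝓕 | vtx σ 0 = b ∧ vtx σ (n - 1) = a}) * x := by gcongr
    _ = n * (#{σ ∈ 𝓕 | vtx σ 0 = a ∧ vtx σ (n - 1) = b} * x +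
      #{σ ∈ 𝓕 | vtx σ 0 = b ∧ vtx σ (n - 1) = a} * x) := by ring
    _ ≤ n * (#𝓑 * (3 * n) + #𝓑 * (3 * n)) := by gcongr
    _ = _ := by ring

/-- In the complete graph. -/
theorem card_tours_univ_mul_le (hn : 3 ≤ n) (T : Finset (Sym2 V)) {e : Sym2 V} (he : e ∈ T) :
    #(tours n T univ) * (n - #T) ≤ 6 * #(tours n (T.erase e) univ) := by
  have h0 : (0 : ℝ) < n := by exact_mod_cast NeZero.pos n
  set L : (Fin n ≃ V) → Finset (Fin n) := fun σ =>
    univ.filter fun l : Fin n => (l : ℕ) < n - 1 ∧ tourEdge σ l ∉ T with hL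
  -- In the complete graph a single reversal always recloses the path. Only mode `0` is used, with
  -- arbitrary shift and idle coordinate, and with any position whose edge is not protected.
  set g : (Fin n ≃ V) → Finset (Move n) := fun σ =>
    {0} ×ˢ (univ ×ˢ (univ ×ˢ L σ)) with hg
  have main := card_mul_le_of_moves (tours n T univ) (tours n (T.erase e) univ) e
    (fun σ hσ t => shiftOrd_mem_tours hσ t) (fun σ hσ => (mem_tours.1 hσ).1 he) g
    (by
      rintro σ hσ hσe ⟨t, i, j, l⟩ hm
      simp only [hg, mem_product, mem_singleton, mem_univ, true_and, hL, mem_filter] at hm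
      obtain ⟨rfl, hl, hlT⟩ := hm
      refine ⟨hl, ?_⟩
      rw [mem_tours]
      refine ⟨?_, subset_univ _⟩
      simp only [Move.apply]
      rw [cycEdges_shiftOrd]
      have hsub : T.erase e ⊆ pathEdges σ := by
        intro f hf
        rw [mem_erase] at hf
        have := (mem_tours.1 hσ).1 hf.2
        rw [cycEdges_eq_insert, hσe, mem_insert] at this
        exact this.resolve_left hf.1
      exact (subset_pathEdges_revPrefix hl hsub (fun h => hlT (mem_of_mem_erase h))).trans
        (pathEdges_subset_cycEdges _))
    (x := (n : ℝ) ^ 2 * ((n - #T : ℕ) : ℝ)) (by positivity) (by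
      intro σ hσ hσe
      have hc : n - #T ≤ #(L σ) := by
        have h1 : #{i ∈ range (n - 1) | tourEdge σ i ∈ T.erase e} ≤ #(T.erase e) :=
          card_filter_tourEdge_mem hn σ _ (by omega)
        have h2 := card_filter_add_card_filter_not (s := range (n - 1))
          (fun i => tourEdge σ i ∈ T.erase e)
        rw [card_range] at h2
        rw [card_erase_of_mem he] at h1
        have h3 : #{i ∈ range (n - 1) | tourEdge σ i ∉ T.erase e} ≤ #(L σ) := by
          refine card_le_card_of_injOn (fun i => Fin.ofNat n i) ?_ ?_
          · intro i hi
            simp only [coe_filter, Set.mem_ofPred_eq, mem_range] at hi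
            have hi' : i % n = i := Nat.mod_eq_of_lt (by omega)
            simp only [hL, coe_filter, Set.mem_ofPred_eq, mem_univ, true_and, Fin.val_ofNat, hi']
            refine ⟨hi.1, fun h => hi.2 (mem_erase.2 ⟨?_, h⟩)⟩
            rintro heq
            have := tourEdge_inj hn (by omega) (by omega) (heq.trans hσe.symm)
            omega
          · intro i hi j hj hij
            simp only [coe_filter, Set.mem_ofPred_eq, mem_range] at hi hj
            have := congrArg Fin.val hij
            simp only [Fin.val_ofNat] at this
            rwa [Nat.mod_eq_of_lt (by omega), Nat.mod_eq_of_lt (by omega)] at this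
        have h4 := card_pos.2 ⟨e, he⟩
        omega
      have : #(g σ) = n ^ 2 * #(L σ) := by
        simp [hg, card_product]; ring
      rw [this]
      push_cast
      gcongr)
  have h2 : ((#(tours n T univ) * (n - #T) : ℕ) : ℝ) * (n : ℝ) ^ 2 ≤
      ((6 * #(tours n (T.erase e) univ) : ℕ) : ℝ) * (n : ℝ) ^ 2 := by
    push_cast
    linarith
  have h3 := le_of_mul_le_mul_right h2 (by positivity)
  exact_mod_cast h3

/-- The edges of `S` are removed one at a time. The factors gained form a falling factorial of `n -
1 - #F`, which is at least `k !`. -/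
theorem card_tours_univ_union_le (hn : 3 ≤ n) (F : Finset (Sym2 V)) (k : ℕ) :
    ∀ S : Finset (Sym2 V), Disjoint F S → #S = k → #F + k ≤ n - 1 →
      #(tours n (F ∪ S) univ) * k.factorial ≤ 6 ^ k * #(tours n F univ) := by
  suffices H : ∀ S : Finset (Sym2 V), Disjoint F S → #S = k → #F + k ≤ n - 1 →
      #(tours n (F ∪ S) univ) * (n - 1 - #F).descFactorial k ≤ 6 ^ k * #(tours n F univ) by
    intro S h1 h2 h3
    refine le_trans (Nat.mul_le_mul_left _ ?_) (H S h1 h2 h3)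
    rw [Nat.descFactorial_eq_factorial_mul_choose]
    exact Nat.le_mul_of_pos_right _ (Nat.choose_pos (by omega))
  induction k with
  | zero =>
    intro S _ hS _
    rw [card_eq_zero] at hS
    subst hS
    simp
  | succ k ih =>
    intro S hd hS hle
    obtain ⟨e, he⟩ : S.Nonempty := card_pos.1 (by omega)
    have h1 := ih (S.erase e) (hd.mono_right (erase_subset _ _))
      (by rw [card_erase_of_mem he]; omega) (by omega)
    have h2 := card_tours_univ_mul_le hn (F ∪ S) (mem_union_right F he)
    have heF : e ∉ F := fun h => (disjoint_left.1 hd h) he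
    have h3 : (F ∪ S).erase e = F ∪ S.erase e := by
      rw [erase_union_distrib, erase_eq_of_notMem heF]
    rw [h3, card_union_of_disjoint hd, hS] at h2
    rw [Nat.descFactorial_succ]
    have h4 : n - 1 - #F - k = n - (#F + (k + 1)) := by omega
    rw [h4]
    calc _ = (#(tours n (F ∪ S) univ) * (n - (#F + (k + 1)))) * (n - 1 - #F).descFactorial k := by
          ring
      _ ≤ (6 * #(tours n (F ∪ S.erase e) univ)) * (n - 1 - #F).descFactorial k :=
          Nat.mul_le_mul_right _ h2
      _ = 6 * (#(tours n (F ∪ S.erase e) univ) * (n - 1 - #F).descFactorial k) := by ring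
      _ ≤ 6 * (6 ^ k * #(tours n F univ)) := Nat.mul_le_mul_left _ h1
      _ = _ := by ring

/-- Cut the tour at `e` and reclose it, protecting the other prescribed edges: `c * n ^ 3` moves
forwards against `6 * n ^ 2` possible origins in `card_mul_le_of_moves`. -/
theorem Flexible.card_tours_le (hn : 3 ≤ n) {A K F₀ : Finset (Sym2 V)} {ε c : ℝ} (hc : 0 < c)
    (hAK : A ⊆ K) (h : Flexible n A K F₀ ε c) {S : Finset (Sym2 V)} (hd : Disjoint F₀ S)
    (hcard : (#F₀ : ℝ) + #S ≤ ε * n) {e : Sym2 V} (he : e ∈ S) :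
    (#(tours n (F₀ ∪ S) (A ∪ F₀)) : ℝ) ≤
      6 / c / n * #(tours n (F₀ ∪ S.erase e) (A ∪ F₀)) := by
  have h0 : (0 : ℝ) < n := by exact_mod_cast NeZero.pos n
  have heF : e ∉ F₀ := fun h => (disjoint_left.1 hd h) he
  have main := card_mul_le_of_moves (tours n (F₀ ∪ S) (A ∪ F₀))
    (tours n (F₀ ∪ S.erase e) (A ∪ F₀)) e
    (fun σ hσ t => shiftOrd_mem_tours hσ t)
    (fun σ hσ => (mem_tours.1 hσ).1 (mem_union_right _ he)) (goodMoves A (F₀ ∪ S.erase e))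
    (by
      intro σ hσ hσe m hm
      rw [mem_goodMoves] at hm
      refine ⟨hm.1, mem_tours.2 ⟨hm.2.1, hm.2.2.trans (union_subset ?_ subset_union_left)⟩⟩
      exact (pathEdges_subset_cycEdges σ).trans (mem_tours.1 hσ).2)
    (x := c * (n : ℝ) ^ 3) (by positivity) (by
      intro σ hσ hσe
      obtain ⟨h1, h2⟩ := mem_tours.1 hσ
      refine h σ (mem_tours.2 ⟨subset_union_left.trans h1, h2.trans (union_subset_union_left hAK)⟩)
        (by rwa [hσe]) _ subset_union_left ?_ ?_
      · intro f hf
        have hfe : f ≠ e := by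
          rintro rfl
          rcases mem_union.1 hf with hf | hf
          · exact heF hf
          · exact notMem_erase _ _ hf
        have := h1 (union_subset_union_right (erase_subset _ _) hf)
        rw [cycEdges_eq_insert, hσe, mem_insert] at this
        exact this.resolve_left hfe
      · refine le_trans ?_ hcard
        have : #(F₀ ∪ S.erase e) ≤ #F₀ + #S :=
          (card_union_le _ _).trans (Nat.add_le_add_left (card_erase_le) _)
        exact_mod_cast this)
  rw [div_div, div_mul_eq_mul_div, le_div_iff₀ (by positivity)]
  have : (#(tours n (F₀ ∪ S) (A ∪ F₀)) : ℝ) * (c * n) * (n : ℝ) ^ 2 ≤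
      6 * #(tours n (F₀ ∪ S.erase e) (A ∪ F₀)) * (n : ℝ) ^ 2 := by linarith
  exact le_of_mul_le_mul_right this (by positivity)

theorem Flexible.card_tours_union_le (hn : 3 ≤ n) {A K F₀ : Finset (Sym2 V)} {ε c : ℝ}
    (hc : 0 < c) (hAK : A ⊆ K) (h : Flexible n A K F₀ ε c) (k : ℕ) :
    ∀ S : Finset (Sym2 V), Disjoint F₀ S → #S = k → (#F₀ : ℝ) + k ≤ ε * n →
    (#(tours n (F₀ ∪ S) (A ∪ F₀)) : ℝ) ≤ (6 / c / n) ^ k * #(tours n F₀ (A ∪ F₀)) := by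
  induction k with
  | zero =>
    intro S _ hS _
    rw [card_eq_zero] at hS
    subst hS
    simp
  | succ k ih =>
    intro S hd hS hle
    push_cast at hle
    obtain ⟨e, he⟩ : S.Nonempty := card_pos.1 (by omega)
    have h1 := ih (S.erase e) (hd.mono_right (erase_subset _ _))
      (by rw [card_erase_of_mem he]; omega) (by linarith)
    have h2 := h.card_tours_le hn hc hAK hd (by rw [hS]; push_cast; linarith) he
    have : (0 : ℝ) ≤ 6 / c / n := by positivity
    calc _ ≤ 6 / c / n * #(tours n (F₀ ∪ S.erase e) (A ∪ F₀)) := h2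
      _ ≤ 6 / c / n * ((6 / c / n) ^ k * #(tours n F₀ (A ∪ F₀))) := by gcongr
      _ = _ := by ring

/-- Tours through `F₀` inside `K ∪ F₀` with at most `j` edges outside `A ∪ F₀`. -/
def nearTours (A K F₀ : Finset (Sym2 V)) (j : ℕ) : Finset (Fin n ≃ V) :=
  (tours n F₀ (K ∪ F₀)).filter fun σ => #(cycEdges σ \ (A ∪ F₀)) ≤ j

/-- In a tour with `j + 1` edges outside `A ∪ F₀`, cut one of them and apply a good move: the new
edges lie in `A`, so at most `j` such edges are left. Here the crude count suffices, since each of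
the `3 * n ^ 3` moves is injective. The factor `j + 1` gained from the choice of the edge matters in
`Flexible.card_host_le`. -/
theorem Flexible.card_nearTours_succ_le (hn : 3 ≤ n) {A K F₀ : Finset (Sym2 V)} {ε c : ℝ}
    (hc : 0 < c) (hAK : A ⊆ K) (h : Flexible n A K F₀ ε c) (hF : (#F₀ : ℝ) ≤ ε * n) (j : ℕ) :
    (#(nearTours (n := n) A K F₀ (j + 1)) : ℝ) ≤
      (1 + 3 * n / (c * (j + 1))) * #(nearTours (n := n) A K F₀ j) := by
  have h0 : (0 : ℝ) < n := by exact_mod_cast NeZero.pos n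
  set bad : (Fin n ≃ V) → Finset (Sym2 V) := fun σ => cycEdges σ \ (A ∪ F₀) with hbad
  set 𝓑 := (tours n F₀ (K ∪ F₀)).filter fun σ => #(bad σ) = j + 1 with h𝓑
  have hB : #(nearTours (n := n) A K F₀ (j + 1)) ≤ #(nearTours (n := n) A K F₀ j) + #𝓑 := by
    refine le_trans (card_le_card ?_) (card_union_le _ _)
    intro σ hσ
    simp only [nearTours, h𝓑, hbad, mem_union, mem_filter] at hσ ⊢
    have := hσ.2
    rcases Nat.lt_or_ge #(cycEdges σ \ (A ∪ F₀)) (j + 1) with h' | h'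
    · exact Or.inl ⟨hσ.1, by omega⟩
    · exact Or.inr ⟨hσ.1, by omega⟩
  have hs : ∀ σ ∈ 𝓑, ∀ t, shiftOrd t σ ∈ 𝓑 := by
    intro σ hσ t
    rw [h𝓑, mem_filter] at hσ ⊢
    refine ⟨shiftOrd_mem_tours hσ.1 t, ?_⟩
    rw [← hσ.2, hbad]
    simp only [cycEdges_shiftOrd]
  have h1 : (j + 1) * #𝓑 ≤ n * #{σ ∈ 𝓑 | tourEdge σ (n - 1) ∉ A ∪ F₀} := by
    refine le_trans ?_ (sum_card_filter_tourEdge_le 𝓑 hs (fun e => e ∉ A ∪ F₀))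
    rw [mul_comm, ← smul_eq_mul, ← Finset.sum_const]
    refine Finset.sum_le_sum fun σ hσ => ?_
    rw [h𝓑, mem_filter] at hσ
    rw [← hσ.2]
    have : bad σ ⊆ ({t ∈ range n | tourEdge σ t ∉ A ∪ F₀}).image (tourEdge σ) := by
      intro e he
      rw [hbad, mem_sdiff, mem_cycEdges] at he
      obtain ⟨⟨i, hi, rfl⟩, h'⟩ := he
      exact mem_image_of_mem _ (mem_filter.2 ⟨mem_range.2 hi, h'⟩)
    exact (card_le_card this).trans card_image_le
  have h2 : (#{σ ∈ 𝓑 | tourEdge σ (n - 1) ∉ A ∪ F₀} : ℝ) * (c * (n : ℝ) ^ 3) ≤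
      3 * (n : ℝ) ^ 3 * #(nearTours (n := n) A K F₀ j) := by
    have h3 : (#{σ ∈ 𝓑 | tourEdge σ (n - 1) ∉ A ∪ F₀} : ℝ) * (c * (n : ℝ) ^ 3) ≤
        ∑ σ ∈ 𝓑 with tourEdge σ (n - 1) ∉ A ∪ F₀, (#(goodMoves A F₀ σ) : ℝ) := by
      rw [← nsmul_eq_mul, ← Finset.sum_const]
      refine Finset.sum_le_sum fun σ hσ => ?_
      rw [mem_filter, h𝓑, mem_filter] at hσ
      obtain ⟨⟨h4, _⟩, h5⟩ := hσ
      have hwF : tourEdge σ (n - 1) ∉ F₀ := fun h' => h5 (mem_union_right _ h')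
      refine h σ h4 hwF F₀ subset_rfl ?_ hF
      intro f hf
      have := (mem_tours.1 h4).1 hf
      rw [cycEdges_eq_insert, mem_insert] at this
      exact this.resolve_left fun h' => hwF (h' ▸ hf)
    refine h3.trans ?_
    have h6 : ∑ σ ∈ 𝓑 with tourEdge σ (n - 1) ∉ A ∪ F₀, #(goodMoves A F₀ σ) ≤
        #(nearTours (n := n) A K F₀ j ×ˢ (univ : Finset (Move n))) := by
      rw [← card_sigma]
      refine card_le_card_of_injOn (fun x => (x.2.apply x.1, x.2)) ?_ ?_
      · rintro ⟨σ, m⟩ hx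
        rw [mem_coe, mem_sigma, mem_filter, h𝓑, mem_filter, mem_goodMoves] at hx
        obtain ⟨⟨⟨h4, h7⟩, h5⟩, _, h8, h9⟩ := hx
        rw [mem_coe, mem_product]
        refine ⟨?_, mem_univ _⟩
        simp only [nearTours, mem_filter]
        refine ⟨mem_tours.2 ⟨h8, h9.trans (union_subset ?_ (hAK.trans subset_union_left))⟩, ?_⟩
        · exact (pathEdges_subset_cycEdges σ).trans (mem_tours.1 h4).2
        · have hsub : cycEdges (m.apply σ) \ (A ∪ F₀) ⊆ (bad σ).erase (tourEdge σ (n - 1)) := by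
            intro f hf
            rw [mem_sdiff] at hf
            have hfp : f ∈ pathEdges σ :=
              (mem_union.1 (h9 hf.1)).resolve_right fun h' => hf.2 (mem_union_left _ h')
            rw [mem_erase]
            refine ⟨?_, mem_sdiff.2 ⟨pathEdges_subset_cycEdges σ hfp, hf.2⟩⟩
            rintro rfl
            exact tourEdge_last_notMem_pathEdges hn σ hfp
          have h10 := card_le_card hsub
          rw [card_erase_of_mem, h7] at h10
          · omega
          · rw [hbad, mem_sdiff]
            exact ⟨by rw [cycEdges_eq_insert]; exact mem_insert_self _ _, h5⟩
      · rintro ⟨σ, m⟩ _ ⟨τ, m'⟩ _ he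
        simp only [Prod.mk.injEq] at he
        obtain ⟨e1, rfl⟩ := he
        rw [m.apply_injective e1]
    have h7 : #(nearTours (n := n) A K F₀ j ×ˢ (univ : Finset (Move n))) =
        3 * n ^ 3 * #(nearTours (n := n) A K F₀ j) := by
      simp [card_product]; ring
    rw [h7] at h6
    exact_mod_cast h6
  have h3 : ((j : ℝ) + 1) * #𝓑 ≤ n * #{σ ∈ 𝓑 | tourEdge σ (n - 1) ∉ A ∪ F₀} := by
    exact_mod_cast h1
  have h4 : (#𝓑 : ℝ) ≤ 3 * n / (c * (j + 1)) * #(nearTours (n := n) A K F₀ j) := by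
    rw [div_mul_eq_mul_div, le_div_iff₀ (by positivity)]
    have h5 : (#{σ ∈ 𝓑 | tourEdge σ (n - 1) ∉ A ∪ F₀} : ℝ) * c ≤
        3 * #(nearTours (n := n) A K F₀ j) := by
      have : (#{σ ∈ 𝓑 | tourEdge σ (n - 1) ∉ A ∪ F₀} : ℝ) * c * (n : ℝ) ^ 3 ≤
        3 * #(nearTours (n := n) A K F₀ j) * (n : ℝ) ^ 3 := by linarith
      exact le_of_mul_le_mul_right this (by positivity)
    calc (#𝓑 : ℝ) * (c * (j + 1)) = ((j : ℝ) + 1) * #𝓑 * c := by ring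
      _ ≤ n * #{σ ∈ 𝓑 | tourEdge σ (n - 1) ∉ A ∪ F₀} * c := by gcongr
      _ = n * (#{σ ∈ 𝓑 | tourEdge σ (n - 1) ∉ A ∪ F₀} * c) := by ring
      _ ≤ n * (3 * #(nearTours (n := n) A K F₀ j)) := by gcongr
      _ = _ := by ring
  have h5 : (#(nearTours (n := n) A K F₀ (j + 1)) : ℝ) ≤ #(nearTours (n := n) A K F₀ j) + #𝓑 := by
    exact_mod_cast hB
  rw [add_mul, one_mul]
  linarith

theorem pow_le_factorial_mul_exp (n : ℕ) : (n : ℝ) ^ n ≤ n.factorial * Real.exp n := by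
  have := Real.pow_div_factorial_le_exp (n : ℝ) (Nat.cast_nonneg n) n
  rwa [div_le_iff₀ (by positivity), mul_comm] at this

/-- Removing all edges outside `A ∪ F₀` costs the product of the factors `1 + 3 * n / (c * (j + 1))`
over `j < n`. This is at most `((1 + 3 / c) * n) ^ n / n !`, hence only exponential in `n`. -/
theorem Flexible.card_host_le (hn : 3 ≤ n) {A K F₀ : Finset (Sym2 V)} {ε c : ℝ}
    (hc : 0 < c) (hAK : A ⊆ K) (h : Flexible n A K F₀ ε c) (hF : (#F₀ : ℝ) ≤ ε * n) :
    (#(tours n F₀ (K ∪ F₀)) : ℝ) ≤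
      ((1 + 3 / c) * Real.exp 1) ^ n * #(tours n F₀ (A ∪ F₀)) := by
  have h0 : (0 : ℝ) < n := by exact_mod_cast NeZero.pos n
  have h1 : ∀ j ≤ n, (j.factorial : ℝ) * #(nearTours (n := n) A K F₀ j) ≤
      ((1 + 3 / c) * n) ^ j * #(nearTours (n := n) A K F₀ 0) := by
    intro j
    induction j with
    | zero => simp
    | succ j ih =>
      intro hj
      have ih := ih (by omega)
      have h2 := h.card_nearTours_succ_le hn hc hAK hF j
      have hj' : (j : ℝ) + 1 ≤ n := by exact_mod_cast hj
      have h3 : ((j : ℝ) + 1) * (1 + 3 * n / (c * (j + 1))) ≤ (1 + 3 / c) * n := by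
        have : ((j : ℝ) + 1) * (1 + 3 * n / (c * (j + 1))) = (j + 1) + 3 / c * n := by
          field_simp
        rw [this, add_mul, one_mul]
        linarith
      rw [Nat.factorial_succ]
      push_cast
      calc ((j : ℝ) + 1) * j.factorial * #(nearTours (n := n) A K F₀ (j + 1))
          ≤ ((j : ℝ) + 1) * j.factorial *
            ((1 + 3 * n / (c * (j + 1))) * #(nearTours (n := n) A K F₀ j)) := by gcongr
        _ = (((j : ℝ) + 1) * (1 + 3 * n / (c * (j + 1)))) *
            (j.factorial * #(nearTours (n := n) A K F₀ j)) := by ring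
        _ ≤ ((1 + 3 / c) * n) * (((1 + 3 / c) * n) ^ j * #(nearTours (n := n) A K F₀ 0)) := by
            gcongr
        _ = _ := by ring
  have h2 : nearTours (n := n) A K F₀ n = tours n F₀ (K ∪ F₀) := by
    unfold nearTours
    rw [filter_eq_self]
    intro σ _
    exact (card_le_card sdiff_subset).trans (card_cycEdges hn σ).le
  have h3 : nearTours (n := n) A K F₀ 0 ⊆ tours n F₀ (A ∪ F₀) := by
    intro σ hσ
    rw [nearTours, mem_filter, mem_tours] at hσ
    rw [mem_tours]
    refine ⟨hσ.1.1, ?_⟩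
    have := hσ.2
    rw [Nat.le_zero, card_eq_zero, sdiff_eq_empty_iff_subset] at this
    exact this
  have h4 := h1 n le_rfl
  rw [h2] at h4
  have h5 : (#(nearTours (n := n) A K F₀ 0) : ℝ) ≤ #(tours n F₀ (A ∪ F₀)) := by
    exact_mod_cast card_le_card h3
  have hf : (0 : ℝ) < n.factorial := by positivity
  have h6 := pow_le_factorial_mul_exp n
  have h7 : (n.factorial : ℝ) * #(tours n F₀ (K ∪ F₀)) ≤
      n.factorial * (((1 + 3 / c) * Real.exp 1) ^ n * #(tours n F₀ (A ∪ F₀))) := by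
    calc _ ≤ _ := h4
      _ ≤ ((1 + 3 / c) * n) ^ n * #(tours n F₀ (A ∪ F₀)) := by gcongr
      _ = (1 + 3 / c) ^ n * (n : ℝ) ^ n * #(tours n F₀ (A ∪ F₀)) := by rw [mul_pow]
      _ ≤ (1 + 3 / c) ^ n * (n.factorial * Real.exp n) * #(tours n F₀ (A ∪ F₀)) := by gcongr
      _ = _ := by
          rw [mul_pow, ← Real.exp_nat_mul, mul_one]
          ring
  exact le_of_mul_le_mul_left h7 hf

/-- The constant in `Flexible.spread`. -/
noncomputable def spreadConst (ε c D : ℝ) : ℝ :=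
  max (6 / c) (48 * Real.exp 1 / ε * (D * ((1 + 3 / c) * Real.exp 1)) ^ (2 / ε))

/-- In a flexible graph, the uniform measure on tours is `O(1/n)`-spread. -/
theorem Flexible.spread (hn : 3 ≤ n) {A K F₀ : Finset (Sym2 V)} {ε c D : ℝ}
    (hε : 0 < ε) (hc : 0 < c) (hD : 1 ≤ D) (hAK : A ⊆ K) (h : Flexible n A K F₀ ε c)
    (hF : (#F₀ : ℝ) ≤ ε * n / 2)
    (hhost : (#(tours n F₀ (univ : Finset (Sym2 V))) : ℝ) ≤ D ^ n * #(tours n F₀ (K ∪ F₀)))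
    (S : Finset (Sym2 V)) (hd : Disjoint F₀ S) :
    (#(tours n (F₀ ∪ S) (A ∪ F₀)) : ℝ) ≤
      (spreadConst ε c D / n) ^ #S * #(tours n F₀ (A ∪ F₀)) := by
  have h0 : (0 : ℝ) < n := by exact_mod_cast NeZero.pos n
  -- Small `S`: iterate the switching in `A`. Large `S`: forget `A`, count in the complete graph,
  -- and compare the totals through the host.
  rcases le_or_gt (#S : ℝ) (ε * n / 2) with hS | hS
  · refine (h.card_tours_union_le hn hc hAK #S S hd rfl (by linarith)).trans ?_
    gcongr
    exact le_max_left _ _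
  · rcases (tours n (F₀ ∪ S) (A ∪ F₀)).eq_empty_or_nonempty with he | ⟨σ, hσ⟩
    · rw [he, card_empty, Nat.cast_zero]
      have : 0 ≤ spreadConst ε c D := le_trans (by positivity) (le_max_left _ _)
      positivity
    have hcn : #F₀ + #S ≤ n := by
      rw [← card_union_of_disjoint hd, ← card_cycEdges hn σ]
      exact card_le_card (mem_tours.1 hσ).1
    have hs0 : 0 < #S := by
      have : (0 : ℝ) < #S := lt_of_le_of_lt (by positivity) hS
      exact_mod_cast this
    obtain ⟨e, he⟩ := card_pos.1 hs0
    -- One edge of `S` is dropped because `F₀ ∪ S` may be a whole cycle, whereas the lemma needs one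
    -- edge to spare. The lost factor `s` is absorbed by `2 ^ s`.
    have h1 := card_tours_univ_union_le hn F₀ (#S - 1) (S.erase e)
      (hd.mono_right (erase_subset _ _)) (card_erase_of_mem he) (by omega)
    have h2 : #(tours n (F₀ ∪ S) (A ∪ F₀)) ≤ #(tours n (F₀ ∪ S.erase e) univ) := by
      refine card_le_card fun τ hτ => ?_
      rw [mem_tours] at hτ ⊢
      exact ⟨(union_subset_union_right (erase_subset _ _)).trans hτ.1, subset_univ _⟩
    have h3 := h.card_host_le hn hc hAK (by linarith)
    set s := #S with hs
    set N := (#(tours n F₀ (A ∪ F₀)) : ℝ) with hN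
    obtain ⟨D', hD'⟩ : ∃ D', D' = (1 + 3 / c) * Real.exp 1 := ⟨_, rfl⟩
    rw [← hD'] at h3
    have hD'1 : 1 ≤ D' := by
      rw [hD']
      have e1 : (1 : ℝ) ≤ Real.exp 1 := by
        have := Real.add_one_le_exp (1 : ℝ); linarith
      have e2 : (1 : ℝ) ≤ 1 + 3 / c := by
        have : 0 < 3 / c := by positivity
        linarith
      exact one_le_mul_of_one_le_of_one_le e2 e1
    have hN0 : 0 ≤ N := Nat.cast_nonneg _
    have h4 : (#(tours n (F₀ ∪ S) (A ∪ F₀)) : ℝ) * (s - 1).factorial ≤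
        6 ^ s * ((D * D') ^ n * N) := by
      calc (#(tours n (F₀ ∪ S) (A ∪ F₀)) : ℝ) * (s - 1).factorial
          ≤ #(tours n (F₀ ∪ S.erase e) univ) * (s - 1).factorial := by
            gcongr
        _ ≤ 6 ^ (s - 1) * #(tours n F₀ univ) := by exact_mod_cast h1
        _ ≤ 6 ^ s * #(tours n F₀ univ) := by
            gcongr
            · norm_num
            · omega
        _ ≤ 6 ^ s * (D ^ n * (D' ^ n * N)) := by
            gcongr
            exact hhost.trans (by gcongr)
        _ = _ := by rw [mul_pow]; ring
    have hs0' : (0 : ℝ) < s := by exact_mod_cast hs0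
    have h5 : (#(tours n (F₀ ∪ S) (A ∪ F₀)) : ℝ) * (s : ℝ) ^ s ≤
        (12 * Real.exp 1) ^ s * ((D * D') ^ n * N) := by
      have e1 : (s.factorial : ℝ) = s * (s - 1).factorial := by
        exact_mod_cast (Nat.mul_factorial_pred (by omega)).symm
      have e2 : (s : ℝ) ≤ 2 ^ s := by exact_mod_cast (Nat.lt_two_pow_self (n := s)).le
      calc (#(tours n (F₀ ∪ S) (A ∪ F₀)) : ℝ) * (s : ℝ) ^ s
          ≤ #(tours n (F₀ ∪ S) (A ∪ F₀)) * (s.factorial * Real.exp s) := by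
            gcongr
            exact pow_le_factorial_mul_exp s
        _ = s * Real.exp s * (#(tours n (F₀ ∪ S) (A ∪ F₀)) * (s - 1).factorial) := by
            rw [e1]; ring
        _ ≤ 2 ^ s * Real.exp s * (6 ^ s * ((D * D') ^ n * N)) := by gcongr
        _ = _ := by
            have e3 : (12 * Real.exp 1) ^ s = 2 ^ s * 6 ^ s * Real.exp s := by
              rw [mul_pow, ← mul_pow 2, ← Real.exp_nat_mul, mul_one]
              norm_num
            rw [e3]
            ring
    -- As `s > ε * n / 2`, a factor exponential in `n` is exponential in `s`.
    have h6 : (D * D') ^ n ≤ ((D * D') ^ (2 / ε)) ^ s := by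
      have hDD : 1 ≤ D * D' := one_le_mul_of_one_le_of_one_le hD hD'1
      rw [← Real.rpow_natCast, ← Real.rpow_natCast, ← Real.rpow_mul (by linarith)]
      refine Real.rpow_le_rpow_of_exponent_le hDD ?_
      rw [div_mul_eq_mul_div, le_div_iff₀ hε]
      linarith
    have h7 : (ε * n / 2) ^ s ≤ (s : ℝ) ^ s := pow_le_pow_left₀ (by positivity) hS.le s
    have h8 : (#(tours n (F₀ ∪ S) (A ∪ F₀)) : ℝ) * (ε * n / 2) ^ s ≤
        (12 * Real.exp 1 * (D * D') ^ (2 / ε)) ^ s * N := by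
      calc _ ≤ (#(tours n (F₀ ∪ S) (A ∪ F₀)) : ℝ) * (s : ℝ) ^ s := by gcongr
        _ ≤ _ := h5
        _ ≤ (12 * Real.exp 1) ^ s * (((D * D') ^ (2 / ε)) ^ s * N) := by gcongr
        _ = _ := by rw [mul_pow (12 * Real.exp 1)]; ring
    have hpos : 0 < (ε * n / 2) ^ s := by positivity
    have hDD0 : 0 ≤ D * D' := by positivity
    calc (#(tours n (F₀ ∪ S) (A ∪ F₀)) : ℝ)
        ≤ (12 * Real.exp 1 * (D * D') ^ (2 / ε)) ^ s * N / (ε * n / 2) ^ s := by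
          rw [le_div_iff₀ hpos]; exact h8
      _ = (24 * Real.exp 1 / ε * (D * D') ^ (2 / ε) / n) ^ s * N := by
          rw [mul_div_right_comm, ← div_pow]
          congr 2
          field_simp
          norm_num
      _ ≤ (spreadConst ε c D / n) ^ s * N := by
          gcongr
          refine le_trans ?_ (le_max_right _ _)
          rw [← hD']
          gcongr
          norm_num

end Switching

/-! ### Counting positions along an ordering. -/

section Positions
variable {V : Type*} [DecidableEq V] {n : ℕ} [NeZero n]

theorem card_filter_vtx_mem_le (σ : Fin n ≃ V) (W : Finset V) :
    #{i : Fin n | vtx σ i ∈ W} ≤ #W := by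
  refine card_le_card_of_injOn (fun i : Fin n => vtx σ i) (fun i hi => (mem_filter.1 hi).2) ?_
  intro i _ j _ h
  exact Fin.ext (vtx_inj i.2 j.2 h)

theorem card_filter_vtx_succ_mem_le (σ : Fin n ≃ V) (W : Finset V) :
    #{i : Fin n | (i : ℕ) < n - 1 ∧ vtx σ (i + 1) ∈ W} ≤ #W := by
  refine card_le_card_of_injOn (fun i : Fin n => vtx σ (i + 1))
    (fun i hi => (mem_filter.1 hi).2.2) ?_
  intro i hi j hj h
  have h1 := (mem_filter.1 (mem_coe.1 hi)).2.1
  have h2 := (mem_filter.1 (mem_coe.1 hj)).2.1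
  have := vtx_inj (by omega) (by omega) h
  exact Fin.ext (by omega)

theorem card_le_filter_vtx_succ_mem (σ : Fin n ≃ V) (W : Finset V) :
    #W ≤ #{i : Fin n | (i : ℕ) < n - 1 ∧ vtx σ (i + 1) ∈ W} + 1 := by
  have h1 : W ⊆ insert (vtx σ 0) (({i : Fin n | (i : ℕ) < n - 1 ∧ vtx σ (i + 1) ∈ W} :
      Finset (Fin n)).image fun i : Fin n => vtx σ (i + 1)) := by
    intro w hw
    obtain ⟨k, hk, rfl⟩ := exists_vtx σ w
    rcases Nat.eq_zero_or_pos k with rfl | hk0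
    · exact mem_insert_self _ _
    · refine mem_insert_of_mem (mem_image.2 ⟨⟨k - 1, by omega⟩, ?_, ?_⟩)
      · simp only [mem_filter, mem_univ, true_and]
        rw [show k - 1 + 1 = k by omega]
        exact ⟨by omega, hw⟩
      · simp only
        rw [show k - 1 + 1 = k by omega]
  calc #W ≤ _ := card_le_card h1
    _ ≤ _ := card_insert_le _ _
    _ ≤ _ := Nat.add_le_add_right card_image_le _

theorem card_filter_fin_tourEdge_mem (hn : 3 ≤ n) (σ : Fin n ≃ V) (T : Finset (Sym2 V)) :
    #{i : Fin n | tourEdge σ i ∈ T} ≤ #T := by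
  refine card_le_card_of_injOn (fun i : Fin n => tourEdge σ i) (fun i hi => (mem_filter.1 hi).2) ?_
  intro i _ j _ h
  exact Fin.ext (tourEdge_inj hn i.2 j.2 h)

end Positions

/-! ### Flexibility of graphs that are nearly complete inside a host. -/

section NearComplete
variable {V : Type*} [Fintype V] [DecidableEq V] {n : ℕ} [NeZero n]

/-- The vertices joined to `v` by an element of `A`. -/
def nbrs (A : Finset (Sym2 V)) (v : V) : Finset V := univ.filter fun w => s(v, w) ∈ A

@[simp] theorem mem_nbrs {A : Finset (Sym2 V)} {v w : V} : w ∈ nbrs A v ↔ s(v, w) ∈ A := by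
  simp [nbrs]

/-- A Hamilton path which can be rotated without leaving `K` and keeping `F`. -/
structure RotState (A K F : Finset (Sym2 V)) (P : Finset (Sym2 V)) (ρ : Fin n ≃ V) : Prop where
  keep : F ⊆ pathEdges ρ
  sub : pathEdges ρ ⊆ P ∪ A
  host : pathEdges ρ ⊆ K ∪ F
  ends : s(vtx ρ 0, vtx ρ (n - 1)) ∈ K

omit [Fintype V] in
theorem RotState.rev {A K F P : Finset (Sym2 V)} {ρ : Fin n ≃ V} (h : RotState A K F P ρ) :
    RotState A K F P (revOrd ρ) where
  keep := by rw [pathEdges_revOrd]; exact h.keep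
  sub := by rw [pathEdges_revOrd]; exact h.sub
  host := by rw [pathEdges_revOrd]; exact h.host
  ends := by
    have h0 : 0 < n := NeZero.pos n
    rw [vtx_revOrd _ h0, vtx_revOrd _ (by omega), Nat.sub_zero, Nat.sub_self, Sym2.eq_swap]
    exact h.ends

omit [Fintype V] in
theorem RotState.tourEdge_mem {A K F P : Finset (Sym2 V)} {ρ : Fin n ≃ V}
    (h : RotState A K F P ρ) {i : ℕ} (hi : i < n - 1) (hiF : tourEdge ρ i ∉ F) :
    s(vtx ρ i, vtx ρ (i + 1)) ∈ K :=
  (mem_union.1 (h.host (mem_pathEdges.2 ⟨i, hi, rfl⟩))).resolve_right hiF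

-- The condition on `K` says that the ends of a walk of three edges are adjacent, as in a union of
-- cliques or a complete bipartite graph. It keeps the ends of the path adjacent in `K`: the new
-- first vertex reaches the last one through `v_{i+1}` and the old first vertex.
omit [Fintype V] in
theorem RotState.rotate {A K F P : Finset (Sym2 V)} {ρ : Fin n ≃ V} (h : RotState A K F P ρ)
    (hAK : A ⊆ K)
    (hK : ∀ x y z w, s(x, y) ∈ K → s(y, z) ∈ K → s(z, w) ∈ K → s(x, w) ∈ K)
    {i : Fin n} (hi : (i : ℕ) < n - 1) (hiA : s(vtx ρ 0, vtx ρ (i + 1)) ∈ A)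
    (hiF : tourEdge ρ i ∉ F) : RotState A K F P (revPrefix i ρ) where
  keep := subset_pathEdges_revPrefix hi h.keep hiF
  sub := (pathEdges_revPrefix_subset hi ρ).trans
    (insert_subset (mem_union_right _ hiA) h.sub)
  host := (pathEdges_revPrefix_subset hi ρ).trans
    (insert_subset (mem_union_left _ (hAK hiA)) h.host)
  ends := by
    rw [vtx_revPrefix_zero, vtx_revPrefix_last hi]
    refine hK _ _ _ _ (h.tourEdge_mem hi hiF) ?_ h.ends
    rw [Sym2.eq_swap]
    exact hAK hiA

/-- The rotations of a path whose new first vertex is not exceptional. -/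
def rotations (A F : Finset (Sym2 V)) (X : Finset V) (ρ : Fin n ≃ V) : Finset (Fin n) :=
  univ.filter fun i => (i : ℕ) < n - 1 ∧ s(vtx ρ 0, vtx ρ (i + 1)) ∈ A ∧ tourEdge ρ i ∉ F ∧
    vtx ρ i ∉ X

/-- The ways to close a path with two crossing edges. -/
def closings (A F : Finset (Sym2 V)) (ρ : Fin n ≃ V) : Finset (Fin n) :=
  univ.filter fun i => (i : ℕ) < n - 1 ∧ s(vtx ρ 0, vtx ρ (i + 1)) ∈ A ∧ tourEdge ρ i ∉ F ∧
    s(vtx ρ (n - 1), vtx ρ i) ∈ A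

theorem card_nbrs_le_rotations (hn : 3 ≤ n) (A F : Finset (Sym2 V)) (X : Finset V)
    (ρ : Fin n ≃ V) : #(nbrs A (vtx ρ 0)) ≤ #(rotations A F X ρ) + 1 + #F + #X := by
  have h1 := card_le_filter_vtx_succ_mem ρ (nbrs A (vtx ρ 0))
  have h2 := card_filter_fin_tourEdge_mem hn ρ F
  have h3 := card_filter_vtx_mem_le ρ X
  have h4 : ({i : Fin n | (i : ℕ) < n - 1 ∧ vtx ρ (i + 1) ∈ nbrs A (vtx ρ 0)} : Finset (Fin n)) ⊆
      rotations A F X ρ ∪ (({i : Fin n | tourEdge ρ i ∈ F} : Finset (Fin n)) ∪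
        ({i : Fin n | vtx ρ i ∈ X} : Finset (Fin n))) := by
    intro i hi
    simp only [rotations, mem_union, mem_filter, mem_univ, true_and, mem_nbrs] at hi ⊢
    tauto
  have h5 := card_le_card h4
  have h6 := card_union_le (rotations A F X ρ)
    (({i : Fin n | tourEdge ρ i ∈ F} : Finset (Fin n)) ∪ ({i : Fin n | vtx ρ i ∈ X} : Finset (Fin n)))
  have h7 := card_union_le ({i : Fin n | tourEdge ρ i ∈ F} : Finset (Fin n))
    ({i : Fin n | vtx ρ i ∈ X} : Finset (Fin n))
  omega

/-- For every neighbour `v_{i+1}` of `v₀` in `K`, the walk `v_i, v_{i+1}, v₀, v_{n-1}` makes `v_i` a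
neighbour of `v_{n-1}` in `K`, unless the path edge at `i` is protected. So inside the host all
crossing pairs close the path, and only protected edges and the pairs of `K` missing from `A` at the
two ends are lost. -/
theorem RotState.card_nbrs_le_closings (hn : 3 ≤ n) {A K F P : Finset (Sym2 V)} {ρ : Fin n ≃ V}
    (h : RotState A K F P ρ)
    (hK : ∀ x y z w, s(x, y) ∈ K → s(y, z) ∈ K → s(z, w) ∈ K → s(x, w) ∈ K) :
    #(nbrs K (vtx ρ 0)) ≤ #(closings A F ρ) + 1 + #F + #(nbrs (K \ A) (vtx ρ 0)) +
      #(nbrs (K \ A) (vtx ρ (n - 1))) := by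
  have h1 := card_le_filter_vtx_succ_mem ρ (nbrs K (vtx ρ 0))
  have h2 := card_filter_fin_tourEdge_mem hn ρ F
  have h3 := card_filter_vtx_mem_le ρ (nbrs (K \ A) (vtx ρ (n - 1)))
  have h3' := card_filter_vtx_succ_mem_le ρ (nbrs (K \ A) (vtx ρ 0))
  set s1 : Finset (Fin n) := {i : Fin n | tourEdge ρ i ∈ F}
  set s2 : Finset (Fin n) := {i : Fin n | vtx ρ i ∈ nbrs (K \ A) (vtx ρ (n - 1))}
  set s3 : Finset (Fin n) := {i : Fin n | (i : ℕ) < n - 1 ∧ vtx ρ (i + 1) ∈ nbrs (K \ A) (vtx ρ 0)}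
  have h4 : ({i : Fin n | (i : ℕ) < n - 1 ∧ vtx ρ (i + 1) ∈ nbrs K (vtx ρ 0)} : Finset (Fin n)) ⊆
      closings A F ρ ∪ (s1 ∪ (s2 ∪ s3)) := by
    intro i hi
    simp only [closings, s1, s2, s3, mem_union, mem_filter, mem_univ, true_and, mem_nbrs,
      mem_sdiff] at hi ⊢
    by_cases hF : tourEdge ρ i ∈ F
    · tauto
    have h5 := h.tourEdge_mem hi.1 hF
    have h6 : s(vtx ρ (n - 1), vtx ρ i) ∈ K := by
      rw [Sym2.eq_swap]
      refine hK _ _ _ _ h5 ?_ h.ends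
      rw [Sym2.eq_swap]
      exact hi.2
    tauto
  have h5 := card_le_card h4
  have h6 := card_union_le (closings A F ρ) (s1 ∪ (s2 ∪ s3))
  have h7 := card_union_le s1 (s2 ∪ s3)
  have h8 := card_union_le s2 s3
  omega

/-- Graphs which are nearly complete inside `K` are flexible. -/
theorem flexible_of_nearComplete (hn : 3 ≤ n) {A K F₀ : Finset (Sym2 V)} {X : Finset V}
    {γ κ δ ε : ℝ} (hγ : 0 < γ) (hκ : 0 < κ) (hAK : A ⊆ K)
    (hK : ∀ x y z w, s(x, y) ∈ K → s(y, z) ∈ K → s(z, w) ∈ K → s(x, w) ∈ K)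
    (hA : ∀ v, γ * n ≤ #(nbrs A v)) (hKn : ∀ v, κ * n ≤ #(nbrs K v))
    (hX : (#X : ℝ) ≤ δ * n) (hXA : ∀ v, v ∉ X → (#(nbrs (K \ A) v) : ℝ) ≤ δ * n)
    (h1 : 1 + ε * n + δ * n ≤ γ * n / 2) (h2 : 1 + ε * n + 2 * (δ * n) ≤ κ * n / 2) :
    Flexible n A K F₀ ε (γ ^ 2 * κ / 8) := by
  intro σ hσ hlast F hF₀F hF hFcard
  have h0 : (0 : ℝ) < n := by exact_mod_cast NeZero.pos n
  have hstate : RotState A K F (pathEdges σ) σ := by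
    refine ⟨hF, subset_union_left, (pathEdges_subset_cycEdges σ).trans
      ((mem_tours.1 hσ).2.trans (union_subset_union_right hF₀F)), ?_⟩
    have h3 : tourEdge σ (n - 1) ∈ K ∪ F₀ := (mem_tours.1 hσ).2 (by
      rw [cycEdges_eq_insert]; exact mem_insert_self _ _)
    rw [Sym2.eq_swap, ← tourEdge_last]
    exact (mem_union.1 h3).resolve_right hlast
  -- Moves of mode `2`: one rotation at each end, then a closing.
  set Q : Finset (Σ _ : Fin n, Σ _ : Fin n, Fin n) :=
    (rotations A F X σ).sigma fun i => (rotations A F X (revOrd (revPrefix i σ))).sigma fun j =>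
      closings A F (revPrefix j (revOrd (revPrefix i σ))) with hQ
  have hcount : #Q ≤ #(goodMoves A F σ) := by
    refine card_le_card_of_injOn (fun x => ((2 : Fin 3), x.1, x.2.1, x.2.2)) ?_ ?_
    · rintro ⟨i, j, l⟩ hx
      rw [mem_coe, hQ, mem_sigma, mem_sigma] at hx
      obtain ⟨hi, hj, hl⟩ := hx
      simp only [rotations, closings, mem_filter, mem_univ, true_and] at hi hj hl
      have s1 := hstate.rotate hAK hK hi.1 hi.2.1 hi.2.2.1
      have s2 := s1.rev.rotate hAK hK hj.1 hj.2.1 hj.2.2.1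
      rw [mem_coe, mem_goodMoves]
      refine ⟨hi.1, ?_, ?_⟩
      · exact (subset_pathEdges_revPrefix hl.1 s2.keep hl.2.2.1).trans (pathEdges_subset_cycEdges _)
      · refine (cycEdges_revPrefix_subset hl.1 _ hl.2.1 hl.2.2.2).trans
          (union_subset s2.sub subset_union_right)
    · rintro ⟨i, j, l⟩ _ ⟨i', j', l'⟩ _ h
      simp only [Prod.mk.injEq, true_and] at h
      obtain ⟨rfl, rfl, rfl⟩ := h
      rfl
  have hrot : ∀ ρ : Fin n ≃ V, γ * n / 2 ≤ #(rotations A F X ρ) := by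
    intro ρ
    have h3 := card_nbrs_le_rotations hn A F X ρ
    have h4 := hA (vtx ρ 0)
    have h5 : (#(nbrs A (vtx ρ 0)) : ℝ) ≤ #(rotations A F X ρ) + 1 + #F + #X := by exact_mod_cast h3
    linarith
  have hcard : γ * n / 2 * (γ * n / 2 * (κ * n / 2)) ≤ #Q := by
    rw [hQ, card_sigma]
    push_cast
    calc γ * n / 2 * (γ * n / 2 * (κ * n / 2))
        ≤ #(rotations A F X σ) * (γ * n / 2 * (κ * n / 2)) := by
          have := hrot σ
          gcongr
      _ = ∑ i ∈ rotations A F X σ, γ * n / 2 * (κ * n / 2) := by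
          rw [Finset.sum_const, nsmul_eq_mul]
      _ ≤ _ := Finset.sum_le_sum fun i hi => ?_
    rw [card_sigma]
    push_cast
    calc γ * n / 2 * (κ * n / 2)
        ≤ #(rotations A F X (revOrd (revPrefix i σ))) * (κ * n / 2) := by
          have := hrot (revOrd (revPrefix i σ))
          gcongr
      _ = ∑ j ∈ rotations A F X (revOrd (revPrefix i σ)), κ * n / 2 := by
          rw [Finset.sum_const, nsmul_eq_mul]
      _ ≤ _ := Finset.sum_le_sum fun j hj => ?_
    simp only [rotations, mem_filter, mem_univ, true_and] at hi hj
    have s1 := hstate.rotate hAK hK hi.1 hi.2.1 hi.2.2.1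
    have s2 := s1.rev.rotate hAK hK hj.1 hj.2.1 hj.2.2.1
    have h3 := s2.card_nbrs_le_closings hn hK
    -- Both ends have been replaced by vertices outside `X`, so few pairs are missing at either of
    -- them.
    have e1 : vtx (revPrefix j (revOrd (revPrefix i σ))) 0 ∉ X := by
      rw [vtx_revPrefix_zero]; exact hj.2.2.2
    have e2 : vtx (revPrefix j (revOrd (revPrefix i σ))) (n - 1) ∉ X := by
      rw [vtx_revPrefix_last hj.1, vtx_revOrd _ (by omega), Nat.sub_self, vtx_revPrefix_zero]
      exact hi.2.2.2
    have h4 := hXA _ e1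
    have h5 := hXA _ e2
    have h6 := hKn (vtx (revPrefix j (revOrd (revPrefix i σ))) 0)
    have h7 : (#(nbrs K (vtx (revPrefix j (revOrd (revPrefix i σ))) 0)) : ℝ) ≤ _ := Nat.cast_le.2 h3
    push_cast at h7
    linarith
  calc γ ^ 2 * κ / 8 * (n : ℝ) ^ 3 = γ * n / 2 * (γ * n / 2 * (κ * n / 2)) := by ring
    _ ≤ #Q := hcard
    _ ≤ _ := by exact_mod_cast hcount

end NearComplete

/-! ### Paths that can hardly be closed: the extremal structures. -/

section Stuck

/-- `I` consists of the `m` smallest elements of `X`. A vertex picked from `I` has almost all of `X`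
above it, which is how `extremal_of_stuck` uses this. -/
theorem exists_initial_segment (X : Finset ℕ) {m : ℕ} (hm : m ≤ #X) :
    ∃ I ⊆ X, #I = m ∧ ∀ p ∈ I, #{q ∈ X | q ≤ p} ≤ m := by
  have hex : ∃ t, m ≤ #{q ∈ X | q < t} := by
    refine ⟨X.sup id + 1, hm.trans (card_le_card fun q hq => ?_)⟩
    rw [mem_filter]
    exact ⟨hq, Nat.lt_succ_of_le (le_sup (f := id) hq)⟩
  set t := Nat.find hex with ht
  have h1 : m ≤ #{q ∈ X | q < t} := Nat.find_spec hex
  have h2 : #{q ∈ X | q < t} ≤ m := by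
    rcases Nat.eq_zero_or_pos t with h0 | h0
    · rw [h0]; simp
    · have h3 := Nat.find_min hex (m := t - 1) (by omega)
      have h4 : X.filter (fun q => q < t) ⊆ insert (t - 1) (X.filter fun q => q < t - 1) := by
        intro q hq
        rw [mem_filter] at hq
        rw [mem_insert, mem_filter]
        rcases Nat.lt_or_ge q (t - 1) with h | h
        · exact Or.inr ⟨hq.1, h⟩
        · exact Or.inl (by omega)
      have h5 := card_le_card h4
      have h6 := card_insert_le (t - 1) (X.filter fun q => q < t - 1)
      omega
  refine ⟨X.filter fun q => q < t, filter_subset _ _, le_antisymm h2 h1, fun p hp => ?_⟩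
  refine le_trans (card_le_card fun q hq => ?_) h2
  rw [mem_filter] at hp hq ⊢
  exact ⟨hq.1, lt_of_le_of_lt hq.2 hp.2⟩

/-- A graph with minimum degree `n / 2` in which the Hamilton path `0, 1, …, n - 1` can hardly be
closed by two or three new edges is close to two cliques or to a balanced complete bipartite
graph. Here `X` is the set of predecessors of neighbours of `0` and `B` is the neighbourhood
of `n - 1`. -/
theorem extremal_of_stuck {n e m w : ℕ} {R : ℕ → ℕ → Prop} [DecidableRel R]
    (hsymm : ∀ i j, R i j → R j i) (hirr : ∀ i, ¬ R i i)
    (N : ℕ → Finset ℕ) (hN : ∀ i, N i = {k ∈ range n | R i k})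
    (hdeg : ∀ i < n, n ≤ 2 * #(N i)) (X B : Finset ℕ)
    (hX : X = {k ∈ range (n - 1) | R 0 (k + 1)}) (hB : B = N (n - 1))
    (he : 1 ≤ e) (hm : 1 ≤ m) (hmX : m ≤ #X) (h1 : #(X ∩ B) ≤ e)
    (h2 : ∑ i ∈ X, (#{k ∈ range n | i + 1 < k ∧ R i k ∧ k - 1 ∈ B} +
      #{k ∈ range n | k < i ∧ R i k ∧ k + 1 ∈ B}) ≤ e * n)
    (hw : 18 * e * n ≤ w * m) :
    n ≤ 2 * #X ∧ 2 * #X ≤ n + 2 * e ∧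
      (∑ i ∈ X, #(symmDiff (N i) X) ≤ n * (18 * e + 4 * (m + w + 2) + 4) ∨
        ∑ i ∈ X, #(symmDiff (N i) (range n \ X)) ≤ n * (18 * e + 4 * (m + w + 2) + 4)) := by
  have memN : ∀ i k, k ∈ N i ↔ k < n ∧ R i k := by intro i k; rw [hN]; simp
  have memX : ∀ k, k ∈ X ↔ k < n - 1 ∧ R 0 (k + 1) := by intro k; rw [hX]; simp
  have hXn : ∀ k ∈ X, k + 1 < n := fun k hk => by have := ((memX k).1 hk).1; omega
  have hn0 : 0 < n := by
    obtain ⟨k, hk⟩ := card_pos.1 (lt_of_lt_of_le hm hmX)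
    have := hXn k hk
    omega
  have hXr : X ⊆ range n := fun k hk => by have := hXn k hk; rw [mem_range]; omega
  have hBr : B ⊆ range n := by rw [hB, hN]; exact filter_subset _ _
  have hXcard : #X = #(N 0) := by
    refine card_bij (fun k _ => k + 1) ?_ ?_ ?_
    · intro k hk
      have := (memX k).1 hk
      exact (memN 0 (k + 1)).2 ⟨by omega, this.2⟩
    · intro a _ b _ h; omega
    · intro b hb
      have hb := (memN 0 b).1 hb
      have hb0 : b ≠ 0 := by rintro rfl; exact hirr 0 hb.2
      refine ⟨b - 1, (memX _).2 ⟨by omega, ?_⟩, by omega⟩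
      rw [Nat.sub_add_cancel (by omega)]
      exact hb.2
  have hX1 : n ≤ 2 * #X := by rw [hXcard]; exact hdeg 0 hn0
  have hB1 : n ≤ 2 * #B := by rw [hB]; exact hdeg _ (by omega)
  have hUI := card_union_add_card_inter X B
  have hUn : #(X ∪ B) ≤ n := by
    have := card_le_card (union_subset hXr hBr)
    rwa [card_range] at this
  -- `X` and `B` each contain at least half of the vertices and meet in at most `e`, so they are
  -- complementary up to the at most `e` vertices of `Y`.
  have hX2 : 2 * #X ≤ n + 2 * e := by omega
  have hXle : #X ≤ n := by have := card_le_card hXr; rwa [card_range] at this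
  set Y := range n \ (X ∪ B) with hY
  have hYc : #Y ≤ e := by
    rw [hY, card_sdiff_of_subset (union_subset hXr hBr), card_range]
    omega
  -- After the rotation at `i`, the vertex preceding `k` on the new path is `k - 1` for `k > i + 1`
  -- and `k + 1` for `k < i`. A neighbour `k` of `i` whose predecessor lies in `B` gives a closing.
  -- As these are rare, most neighbours have predecessors in `X`, so `T i` is a model of `N i`.
  set T : ℕ → Finset ℕ := fun i => {k ∈ range n | (i + 1 < k ∧ k - 1 ∈ X) ∨ (k < i ∧ k + 1 ∈ X)}
    with hT
  have memT : ∀ i k, k ∈ T i ↔ k < n ∧ ((i + 1 < k ∧ k - 1 ∈ X) ∨ (k < i ∧ k + 1 ∈ X)) := by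
    intro i k; rw [hT]; simp
  have hTle : ∀ i, #(T i) ≤ #X := by
    intro i
    refine card_le_card_of_injOn (fun k => if i + 1 < k then k - 1 else k + 1) ?_ ?_
    · intro k hk
      have hk := (memT i k).1 hk
      simp only
      split_ifs with h
      · rcases hk.2 with h' | h'
        · exact h'.2
        · omega
      · rcases hk.2 with h' | h'
        · omega
        · exact h'.2
    · intro a ha b hb hab
      have ha := (memT i a).1 ha
      have hb := (memT i b).1 hb
      simp only at hab
      split_ifs at hab <;> omega
  set z : ℕ → ℕ := fun i => #{k ∈ range n | i + 1 < k ∧ R i k ∧ k - 1 ∈ B} +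
      #{k ∈ range n | k < i ∧ R i k ∧ k + 1 ∈ B} with hz
  have hNT : ∀ i ∈ X, #(N i \ T i) ≤ z i + 2 * e + 1 := by
    intro i hi
    have hsub : N i \ T i ⊆ ({k ∈ range n | i + 1 < k ∧ R i k ∧ k - 1 ∈ B} ∪
        {k ∈ range n | k < i ∧ R i k ∧ k + 1 ∈ B}) ∪
        ((Y.image fun k => k + 1) ∪ (Y.image fun k => k - 1)) ∪ {i + 1} := by
      intro k hk
      rw [mem_sdiff, memN, memT] at hk
      obtain ⟨⟨hkn, hR⟩, hk2⟩ := hk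
      have hki : k ≠ i := by rintro rfl; exact hirr _ hR
      have hin := hXn i hi
      simp only [mem_union, mem_filter, mem_range, mem_image, mem_singleton, hY, mem_sdiff]
      rcases lt_trichotomy k (i + 1) with h | h | h
      · have hlt : k < i := by omega
        by_cases hkB : k + 1 ∈ B
        · exact Or.inl (Or.inl (Or.inr ⟨hkn, hlt, hR, hkB⟩))
        · refine Or.inl (Or.inr (Or.inr ⟨k + 1, ⟨by omega, ?_⟩, by omega⟩))
          rintro (h' | h')
          · exact hk2 ⟨hkn, Or.inr ⟨hlt, h'⟩⟩
          · exact hkB h'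
      · exact Or.inr h
      · by_cases hkB : k - 1 ∈ B
        · exact Or.inl (Or.inl (Or.inl ⟨hkn, h, hR, hkB⟩))
        · refine Or.inl (Or.inr (Or.inl ⟨k - 1, ⟨by omega, ?_⟩, by omega⟩))
          rintro (h' | h')
          · exact hk2 ⟨hkn, Or.inl ⟨h, h'⟩⟩
          · exact hkB h'
    have c1 := card_le_card hsub
    have c2 := card_union_le (({k ∈ range n | i + 1 < k ∧ R i k ∧ k - 1 ∈ B} ∪
        {k ∈ range n | k < i ∧ R i k ∧ k + 1 ∈ B}) ∪
        ((Y.image fun k => k + 1) ∪ (Y.image fun k => k - 1))) {i + 1}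
    have c3 := card_union_le ({k ∈ range n | i + 1 < k ∧ R i k ∧ k - 1 ∈ B} ∪
        {k ∈ range n | k < i ∧ R i k ∧ k + 1 ∈ B})
        ((Y.image fun k => k + 1) ∪ (Y.image fun k => k - 1))
    have c4 := card_union_le {k ∈ range n | i + 1 < k ∧ R i k ∧ k - 1 ∈ B}
        {k ∈ range n | k < i ∧ R i k ∧ k + 1 ∈ B}
    have c5 := card_union_le (Y.image fun k => k + 1) (Y.image fun k => k - 1)
    have c6 := card_image_le (s := Y) (f := fun k => k + 1)
    have c7 := card_image_le (s := Y) (f := fun k => k - 1)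
    rw [card_singleton] at c2
    simp only [hz]
    omega
  set d : ℕ → ℕ := fun i => #(symmDiff (N i) (T i)) with hd
  have hsd : ∀ a b : Finset ℕ, #(symmDiff a b) = #(a \ b) + #(b \ a) := by
    intro a b
    rw [symmDiff_def, sup_eq_union, card_union_of_disjoint disjoint_sdiff_sdiff]
  have hcs : ∀ a b : Finset ℕ, #(a \ b) + #b = #(b \ a) + #a := by
    intro a b
    have g1 := card_sdiff_add_card a b
    have g2 := card_sdiff_add_card b a
    rw [union_comm] at g2
    omega
  -- `N i` is almost contained in `T i`, has at least `n / 2` elements, and `T i` has at most `n / 2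
  -- + e`. Hence the symmetric difference is controlled as well.
  have hdz : ∀ i ∈ X, d i ≤ 2 * z i + 7 * e := by
    intro i hi
    have a1 := hNT i hi
    have a2 := hTle i
    have a3 := hdeg i (by have := hXn i hi; omega)
    have a4 := hcs (N i) (T i)
    simp only [hd, hsd]
    omega
  have hdsum : ∑ i ∈ X, d i ≤ 9 * e * n := by
    calc ∑ i ∈ X, d i ≤ ∑ i ∈ X, (2 * z i + 7 * e) := Finset.sum_le_sum hdz
      _ = 2 * ∑ i ∈ X, z i + #X * (7 * e) := by
          rw [Finset.sum_add_distrib, ← Finset.mul_sum]; simp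
      _ ≤ 2 * (e * n) + n * (7 * e) := by gcongr
      _ = _ := by ring
  obtain ⟨I, hIX, hIc, hI⟩ := exists_initial_segment X hmX
  -- The errors of the model in row and column `p`. By averaging, some `p` among the first `m`
  -- elements of `X` has at most `w` of them.
  set g : ℕ → ℕ := fun p => d p + #{q ∈ X | p ∈ symmDiff (N q) (T q)} with hg
  have hgsum : ∑ p ∈ I, g p ≤ 18 * e * n := by
    calc ∑ p ∈ I, g p ≤ ∑ p ∈ X, d p + ∑ p ∈ I, #{q ∈ X | p ∈ symmDiff (N q) (T q)} := by
          rw [hg, Finset.sum_add_distrib]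
          gcongr
      _ ≤ ∑ p ∈ X, d p + ∑ q ∈ X, d q := by
          gcongr
          simp only [card_filter]
          rw [Finset.sum_comm]
          refine Finset.sum_le_sum fun q _ => ?_
          rw [← card_filter]
          refine card_le_card fun p hp => ?_
          exact (mem_filter.1 hp).2
      _ ≤ 9 * e * n + 9 * e * n := by gcongr
      _ = _ := by ring
  obtain ⟨p, hpI, hpg⟩ : ∃ p ∈ I, g p ≤ w := by
    by_contra hcon
    push Not at hcon
    have : ∑ p ∈ I, (w + 1) ≤ ∑ p ∈ I, g p := Finset.sum_le_sum fun p hp => hcon p hp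
    rw [Finset.sum_const, hIc, smul_eq_mul] at this
    nlinarith
  have hpX := hIX hpI
  -- For `p + 1 < q` in `X` the model predicts `q ∈ N p` iff `q - 1 ∈ X`, and `p ∈ N q` iff `p + 1 ∈
  -- X`. Adjacency is symmetric, so for almost all `q ∈ X` the truth of `q - 1 ∈ X` equals the fixed
  -- truth of `p + 1 ∈ X`.
  have hviol : #{q ∈ X | ¬ ((1 ≤ q ∧ q - 1 ∈ X) ↔ p + 1 ∈ X)} ≤ m + w + 1 := by
    have hsub : X.filter (fun q => ¬ ((1 ≤ q ∧ q - 1 ∈ X) ↔ p + 1 ∈ X)) ⊆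
        (X.filter (fun q => q ≤ p) ∪ {p + 1}) ∪ (symmDiff (N p) (T p) ∪
          X.filter (fun q => p ∈ symmDiff (N q) (T q))) := by
      intro q hq
      rw [mem_filter] at hq
      obtain ⟨hqX, hq2⟩ := hq
      by_contra hcon
      simp only [mem_union, mem_filter, mem_singleton, not_or, not_and, not_le] at hcon
      obtain ⟨⟨c1, c2⟩, c3, c4⟩ := hcon
      have c1 := c1 hqX
      have c4 := c4 hqX
      have hpq : p + 1 < q := by omega
      have hqn := hXn q hqX
      rw [mem_symmDiff, memN, memT] at c3 c4
      have hs : R p q ↔ R q p := ⟨hsymm _ _, hsymm _ _⟩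
      apply hq2
      have d1 : R p q ↔ q - 1 ∈ X := by
        constructor
        · intro h
          by_contra h'
          refine c3 (Or.inl ⟨⟨by omega, h⟩, ?_⟩)
          rintro ⟨_, h'' | h''⟩
          · exact h' h''.2
          · omega
        · intro h
          by_contra h'
          exact c3 (Or.inr ⟨⟨by omega, Or.inl ⟨hpq, h⟩⟩, fun h'' => h' h''.2⟩)
      have d2 : R q p ↔ p + 1 ∈ X := by
        constructor
        · intro h
          by_contra h'
          refine c4 (Or.inl ⟨⟨by omega, h⟩, ?_⟩)
          rintro ⟨_, h'' | h''⟩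
          · omega
          · exact h' h''.2
        · intro h
          by_contra h'
          exact c4 (Or.inr ⟨⟨by omega, Or.inr ⟨by omega, h⟩⟩, fun h'' => h' h''.2⟩)
      rw [← d2, ← hs, d1]
      exact ⟨fun h => h.2, fun h => ⟨by omega, h⟩⟩
    have c1 := card_le_card hsub
    have c2 := card_union_le (X.filter (fun q => q ≤ p) ∪ {p + 1}) (symmDiff (N p) (T p) ∪
          X.filter (fun q => p ∈ symmDiff (N q) (T q)))
    have c3 := card_union_le (X.filter (fun q => q ≤ p)) {p + 1}
    have c4 := card_union_le (symmDiff (N p) (T p)) (X.filter (fun q => p ∈ symmDiff (N q) (T q)))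
    have c5 := hI p hpI
    rw [card_singleton] at c3
    simp only [hg, hd] at hpg
    omega
  -- Consecutive pairs of elements of `X` are counted from either end.
  have hshift : #{q ∈ X | 1 ≤ q ∧ q - 1 ∈ X} = #{q ∈ X | q + 1 ∈ X} := by
    refine card_bij (fun q _ => q - 1) ?_ ?_ ?_
    · intro q hq
      rw [mem_filter] at hq ⊢
      refine ⟨hq.2.2, ?_⟩
      rw [Nat.sub_add_cancel hq.2.1]
      exact hq.1
    · intro a ha b hb h
      rw [mem_filter] at ha hb
      omega
    · intro b hb
      rw [mem_filter] at hb
      exact ⟨b + 1, mem_filter.2 ⟨hb.2, by omega, by simpa using hb.1⟩, by omega⟩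
  have s1 := card_filter_add_card_filter_not (s := X) (fun q => 1 ≤ q ∧ q - 1 ∈ X)
  have s2 := card_filter_add_card_filter_not (s := X) (fun q => q + 1 ∈ X)
  refine ⟨hX1, hX2, ?_⟩
  -- If `p + 1 ∈ X`, then `X` is almost closed under both neighbours on the path, and `T i` is close
  -- to `X`: two cliques. Otherwise `X` has almost no consecutive elements, and `T i` is close to
  -- the complement: bipartite.
  by_cases hβ : p + 1 ∈ X
  · left
    have v1 : #{q ∈ X | ¬ (1 ≤ q ∧ q - 1 ∈ X)} ≤ m + w + 1 := by
      refine le_trans (card_le_card fun q hq => ?_) hviol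
      rw [mem_filter] at hq ⊢
      exact ⟨hq.1, fun h => hq.2 (h.2 hβ)⟩
    have v2 : #{q ∈ X | ¬ (q + 1 ∈ X)} ≤ m + w + 1 := by omega
    have key : ∀ i ∈ X, #(symmDiff (N i) X) ≤ d i + (4 * (m + w + 2) + 2) := by
      intro i hi
      have k1 : #(T i \ X) ≤ 2 * (m + w + 1) := by
        have hsub : T i \ X ⊆ (X.filter fun q => ¬ (q + 1 ∈ X)).image (fun q => q + 1) ∪
            (X.filter fun q => ¬ (1 ≤ q ∧ q - 1 ∈ X)).image (fun q => q - 1) := by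
          intro k hk
          rw [mem_sdiff, memT] at hk
          obtain ⟨⟨hkn, h⟩, hkX⟩ := hk
          rw [mem_union, mem_image, mem_image]
          rcases h with ⟨h, h'⟩ | ⟨h, h'⟩
          · refine Or.inl ⟨k - 1, mem_filter.2 ⟨h', ?_⟩, by omega⟩
            rw [Nat.sub_add_cancel (by omega)]
            exact hkX
          · refine Or.inr ⟨k + 1, mem_filter.2 ⟨h', ?_⟩, by omega⟩
            rintro ⟨_, h''⟩
            exact hkX (by simpa using h'')
        have c1 := card_le_card hsub
        have c2 := card_union_le ((X.filter fun q => ¬ (q + 1 ∈ X)).image (fun q => q + 1))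
            ((X.filter fun q => ¬ (1 ≤ q ∧ q - 1 ∈ X)).image (fun q => q - 1))
        have c3 := card_image_le (s := X.filter fun q => ¬ (q + 1 ∈ X)) (f := fun q => q + 1)
        have c4 := card_image_le (s := X.filter fun q => ¬ (1 ≤ q ∧ q - 1 ∈ X))
          (f := fun q => q - 1)
        omega
      have k2 : #(X \ T i) ≤ 2 * (m + w + 1) + 2 := by
        have hsub : X \ T i ⊆ ((X.filter fun q => ¬ (q + 1 ∈ X)) ∪
            (X.filter fun q => ¬ (1 ≤ q ∧ q - 1 ∈ X))) ∪ {i, i + 1} := by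
          intro k hk
          rw [mem_sdiff, memT] at hk
          obtain ⟨hkX, h⟩ := hk
          have hkn := hXn k hkX
          simp only [mem_union, mem_filter, mem_insert, mem_singleton]
          rcases lt_trichotomy k i with h' | h' | h'
          · exact Or.inl (Or.inl ⟨hkX, fun h'' => h ⟨by omega, Or.inr ⟨h', h''⟩⟩⟩)
          · exact Or.inr (Or.inl h')
          · by_cases h3 : k = i + 1
            · exact Or.inr (Or.inr h3)
            · exact Or.inl (Or.inr ⟨hkX, fun h'' => h ⟨by omega, Or.inl ⟨by omega, h''.2⟩⟩⟩)
        have c1 := card_le_card hsub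
        have c2 := card_union_le ((X.filter fun q => ¬ (q + 1 ∈ X)) ∪
            (X.filter fun q => ¬ (1 ≤ q ∧ q - 1 ∈ X))) {i, i + 1}
        have c3 := card_union_le (X.filter fun q => ¬ (q + 1 ∈ X))
            (X.filter fun q => ¬ (1 ≤ q ∧ q - 1 ∈ X))
        have c4 : #({i, i + 1} : Finset ℕ) ≤ 2 := card_le_two
        omega
      have k3 : #(symmDiff (T i) X) ≤ 4 * (m + w + 2) + 2 := by rw [hsd]; omega
      calc #(symmDiff (N i) X) ≤ #(symmDiff (N i) (T i) ∪ symmDiff (T i) X) :=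
            card_le_card (symmDiff_triangle _ _ _)
        _ ≤ d i + #(symmDiff (T i) X) := card_union_le _ _
        _ ≤ _ := by omega
    calc ∑ i ∈ X, #(symmDiff (N i) X) ≤ ∑ i ∈ X, (d i + (4 * (m + w + 2) + 2)) :=
          Finset.sum_le_sum key
      _ = ∑ i ∈ X, d i + #X * (4 * (m + w + 2) + 2) := by rw [Finset.sum_add_distrib]; simp
      _ ≤ 9 * e * n + n * (4 * (m + w + 2) + 2) := by gcongr
      _ ≤ _ := by nlinarith
  · right
    have v1 : #{q ∈ X | 1 ≤ q ∧ q - 1 ∈ X} ≤ m + w + 1 := by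
      refine le_trans (card_le_card fun q hq => ?_) hviol
      rw [mem_filter] at hq ⊢
      exact ⟨hq.1, fun h => hβ (h.1 hq.2)⟩
    have v2 : #{q ∈ X | q + 1 ∈ X} ≤ m + w + 1 := by omega
    have key : ∀ i ∈ X, #(symmDiff (N i) (range n \ X)) ≤ 2 * d i + (4 * (m + w + 2) + 2) := by
      intro i hi
      have k1 : #(T i \ (range n \ X)) ≤ 2 * (m + w + 1) := by
        have hsub : T i \ (range n \ X) ⊆ (X.filter fun q => q + 1 ∈ X) ∪
            (X.filter fun q => 1 ≤ q ∧ q - 1 ∈ X) := by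
          intro k hk
          rw [mem_sdiff, memT, mem_sdiff, mem_range] at hk
          obtain ⟨⟨hkn, h⟩, h2⟩ := hk
          have hkX : k ∈ X := by
            by_contra h'
            exact h2 ⟨hkn, h'⟩
          simp only [mem_union, mem_filter]
          rcases h with ⟨h, h'⟩ | ⟨h, h'⟩
          · exact Or.inr ⟨hkX, by omega, h'⟩
          · exact Or.inl ⟨hkX, h'⟩
        have c1 := card_le_card hsub
        have c2 := card_union_le (X.filter fun q => q + 1 ∈ X)
            (X.filter fun q => 1 ≤ q ∧ q - 1 ∈ X)
        omega
      -- `T i` almost avoids `X`. It nearly fills the complement because it has at least `n / 2 - d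
      -- i` elements, while the complement has at most `n / 2`.
      have k2 : #(N i) ≤ #(T i) + d i := by
        have g1 := hcs (N i) (T i)
        have g2 : #(N i \ T i) ≤ d i := by simp only [hd, hsd]; omega
        omega
      have k3 := hdeg i (by have := hXn i hi; omega)
      have k4 := hcs (T i) (range n \ X)
      have k5 : #(range n \ X) = n - #X := by rw [card_sdiff_of_subset hXr, card_range]
      have k6 : #(symmDiff (T i) (range n \ X)) ≤ 4 * (m + w + 2) + 2 + d i := by
        rw [hsd]; omega
      calc #(symmDiff (N i) (range n \ X))
          ≤ #(symmDiff (N i) (T i) ∪ symmDiff (T i) (range n \ X)) :=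
            card_le_card (symmDiff_triangle _ _ _)
        _ ≤ d i + #(symmDiff (T i) (range n \ X)) := card_union_le _ _
        _ ≤ _ := by omega
    calc ∑ i ∈ X, #(symmDiff (N i) (range n \ X))
        ≤ ∑ i ∈ X, (2 * d i + (4 * (m + w + 2) + 2)) := Finset.sum_le_sum key
      _ = 2 * ∑ i ∈ X, d i + #X * (4 * (m + w + 2) + 2) := by
          rw [Finset.sum_add_distrib, ← Finset.mul_sum]; simp
      _ ≤ 2 * (9 * e * n) + n * (4 * (m + w + 2) + 2) := by gcongr
      _ ≤ _ := by nlinarith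

end Stuck

/-! ### Flexibility of Dirac graphs that are not nearly extremal. -/

section Extremal
variable {V : Type*} [Fintype V] [DecidableEq V] {n : ℕ} [NeZero n]

/-- There is a set `X` of about half of all vertices such that the neighbourhoods of the vertices
of `X` are, on average, close to `X` or to its complement. -/
def NearExtremal (A : Finset (Sym2 V)) (β : ℝ) : Prop :=
  ∃ X : Finset V, Fintype.card V ≤ 2 * #X ∧ (2 * #X : ℝ) ≤ (1 + β) * Fintype.card V ∧
    ((∑ u ∈ X, (#(symmDiff (nbrs A u) X) : ℝ) ≤ β * (Fintype.card V : ℝ) ^ 2) ∨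
      ∑ u ∈ X, (#(symmDiff (nbrs A u) Xᶜ) : ℝ) ≤ β * (Fintype.card V : ℝ) ^ 2)

-- On the path rotated at `i`, the closing that uses the edge from `v_i` to `v_k` is at position `k
-- - 1` if `k > i + 1` and at position `i - k - 1` if `k < i`. These two ranges do not overlap.
omit [Fintype V] in
theorem card_filter_crossing_le (hn : 3 ≤ n) (A F : Finset (Sym2 V)) (σ : Fin n ≃ V) (i : Fin n)
    (hi : (i : ℕ) < n - 1) :
    #{k ∈ range n | (i : ℕ) + 1 < k ∧ s(vtx σ i, vtx σ k) ∈ A ∧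
        s(vtx σ (n - 1), vtx σ (k - 1)) ∈ A} +
      #{k ∈ range n | k < (i : ℕ) ∧ s(vtx σ i, vtx σ k) ∈ A ∧
        s(vtx σ (n - 1), vtx σ (k + 1)) ∈ A} ≤
      #(closings A F (revPrefix i σ)) + #F := by
  refine le_trans ?_ (Nat.add_le_add_left (card_filter_fin_tourEdge_mem hn (revPrefix i σ) F) _)
  refine le_trans ?_ (card_union_le _ _)
  set Q := closings A F (revPrefix i σ) ∪
    ({l : Fin n | tourEdge (revPrefix i σ) l ∈ F} : Finset (Fin n)) with hQ
  have hmem : ∀ l : Fin n, (l : ℕ) < n - 1 → s(vtx σ i, vtx (revPrefix i σ) (l + 1)) ∈ A →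
      s(vtx σ (n - 1), vtx (revPrefix i σ) l) ∈ A → l ∈ Q := by
    intro l h1 h2 h3
    rw [hQ, mem_union]
    by_cases hF : tourEdge (revPrefix i σ) l ∈ F
    · exact Or.inr (mem_filter.2 ⟨mem_univ _, hF⟩)
    · refine Or.inl (mem_filter.2 ⟨mem_univ _, h1, ?_, hF, ?_⟩)
      · rwa [vtx_revPrefix_zero]
      · rwa [vtx_revPrefix_last hi]
  have hval : ∀ l < n, ((Fin.ofNat n l : Fin n) : ℕ) = l := fun l hl => Nat.mod_eq_of_lt hl
  rw [← card_filter_add_card_filter_not (s := Q) fun l => i < l]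
  refine Nat.add_le_add ?_ ?_
  · refine card_le_card_of_injOn (fun k => (Fin.ofNat n (k - 1) : Fin n)) ?_ ?_
    · intro k hk
      obtain ⟨h2, h3, h4, h5⟩ := mem_filter.1 (mem_coe.1 hk)
      rw [mem_range] at h2
      have e0 := hval (k - 1) (by omega)
      refine mem_filter.2 ⟨hmem _ ?_ ?_ ?_, ?_⟩
      · rw [e0]; omega
      · rw [e0, vtx_revPrefix_of_lt i σ (by omega) (by omega), Nat.sub_add_cancel (by omega)]
        exact h4
      · rw [e0, vtx_revPrefix_of_lt i σ (by omega) (by omega)]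
        exact h5
      · rw [Fin.lt_def, e0]; omega
    · intro k hk k' hk' h
      obtain ⟨h2, h3, -⟩ := mem_filter.1 (mem_coe.1 hk)
      obtain ⟨h2', h3', -⟩ := mem_filter.1 (mem_coe.1 hk')
      rw [mem_range] at h2 h2'
      have := congrArg Fin.val h
      simp only [hval (k - 1) (by omega), hval (k' - 1) (by omega)] at this
      omega
  · refine card_le_card_of_injOn (fun k => (Fin.ofNat n (i - k - 1) : Fin n)) ?_ ?_
    · intro k hk
      obtain ⟨h2, h3, h4, h5⟩ := mem_filter.1 (mem_coe.1 hk)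
      rw [mem_range] at h2
      have e0 := hval (i - k - 1) (by omega)
      refine mem_filter.2 ⟨hmem _ ?_ ?_ ?_, ?_⟩
      · rw [e0]; omega
      · rw [e0, vtx_revPrefix_of_le i σ (by omega),
          show (i : ℕ) - (i - k - 1 + 1) = k by omega]
        exact h4
      · rw [e0, vtx_revPrefix_of_le i σ (by omega), show (i : ℕ) - (i - k - 1) = k + 1 by omega]
        exact h5
      · rw [Fin.lt_def, e0]; omega
    · intro k hk k' hk' h
      obtain ⟨h2, h3, -⟩ := mem_filter.1 (mem_coe.1 hk)
      obtain ⟨h2', h3', -⟩ := mem_filter.1 (mem_coe.1 hk')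
      have := congrArg Fin.val h
      simp only [hval (i - k - 1) (by omega), hval (i - k' - 1) (by omega)] at this
      omega

-- Moves of mode `0`: each closing is counted with all shifts and all values of the idle coordinate.
omit [Fintype V] in
theorem card_closings_mul_le_goodMoves {A F : Finset (Sym2 V)} {σ : Fin n ≃ V}
    (hF : F ⊆ pathEdges σ) : #(closings A F σ) * n ^ 2 ≤ #(goodMoves A F σ) := by
  have h1 : #(({0} : Finset (Fin 3)) ×ˢ ((univ : Finset (Fin n)) ×ˢ ((univ : Finset (Fin n)) ×ˢ
      closings A F σ))) = #(closings A F σ) * n ^ 2 := by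
    simp only [card_product, card_singleton, card_univ, Fintype.card_fin]
    ring
  rw [← h1]
  refine card_le_card ?_
  rintro ⟨t, i, j, l⟩ hx
  simp only [mem_product, mem_singleton, mem_univ, true_and] at hx
  obtain ⟨rfl, hl⟩ := hx
  simp only [closings, mem_filter, mem_univ, true_and] at hl
  rw [mem_goodMoves]
  refine ⟨hl.1, ?_, ?_⟩
  · change F ⊆ cycEdges (shiftOrd i (revPrefix l σ))
    rw [cycEdges_shiftOrd]
    exact (subset_pathEdges_revPrefix hl.1 hF hl.2.2.1).trans (pathEdges_subset_cycEdges _)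
  · change cycEdges (shiftOrd i (revPrefix l σ)) ⊆ _
    rw [cycEdges_shiftOrd]
    exact cycEdges_revPrefix_subset hl.1 _ hl.2.1 hl.2.2.2

-- Moves of mode `1`: one rotation, one closing and an arbitrary shift.
omit [Fintype V] in
theorem sum_closings_mul_le_goodMoves {A F : Finset (Sym2 V)} {σ : Fin n ≃ V}
    (hF : F ⊆ pathEdges σ) :
    (∑ i ∈ rotations A F ∅ σ, #(closings A F (revPrefix i σ))) * n ≤ #(goodMoves A F σ) := by
  set Q : Finset (Σ _ : Fin n, Σ _ : Fin n, Fin n) :=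
    (rotations A F ∅ σ).sigma fun i => (univ : Finset (Fin n)).sigma fun _ =>
      closings A F (revPrefix i σ) with hQ
  have h1 : #Q = (∑ i ∈ rotations A F ∅ σ, #(closings A F (revPrefix i σ))) * n := by
    rw [hQ, card_sigma, Finset.sum_mul]
    refine Finset.sum_congr rfl fun i _ => ?_
    rw [card_sigma, Finset.sum_const, card_univ, Fintype.card_fin, smul_eq_mul, mul_comm]
  rw [← h1]
  refine card_le_card_of_injOn (fun x => ((1 : Fin 3), x.1, x.2.1, x.2.2)) ?_ ?_
  · rintro ⟨i, j, l⟩ hx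
    rw [mem_coe, hQ, mem_sigma, mem_sigma] at hx
    obtain ⟨hi, -, hl⟩ := hx
    simp only [rotations, closings, mem_filter, mem_univ, true_and] at hi hl
    rw [mem_coe, mem_goodMoves]
    refine ⟨⟨hi.1, hl.1⟩, ?_, ?_⟩
    · change F ⊆ cycEdges (shiftOrd j (revPrefix l (revPrefix i σ)))
      rw [cycEdges_shiftOrd]
      exact (subset_pathEdges_revPrefix hl.1 (subset_pathEdges_revPrefix hi.1 hF hi.2.2.1)
        hl.2.2.1).trans (pathEdges_subset_cycEdges _)
    · change cycEdges (shiftOrd j (revPrefix l (revPrefix i σ))) ⊆ _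
      rw [cycEdges_shiftOrd]
      refine (cycEdges_revPrefix_subset hl.1 _ hl.2.1 hl.2.2.2).trans
        (union_subset ((pathEdges_revPrefix_subset hi.1 σ).trans ?_) subset_union_right)
      exact insert_subset (mem_union_right _ hi.2.1) subset_union_left
  · rintro ⟨i, j, l⟩ _ ⟨i', j', l'⟩ _ h
    simp only [Prod.mk.injEq, true_and] at h
    obtain ⟨rfl, rfl, rfl⟩ := h
    rfl

theorem card_symmDiff_nbrs_le (σ : Fin n ≃ V) (A : Finset (Sym2 V)) {Y : Finset ℕ} {Z : Finset V}
    (hZ : ∀ k < n, vtx σ k ∈ Z ↔ k ∈ Y) (i : ℕ) :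
    #(symmDiff (nbrs A (vtx σ i)) Z) ≤
      #(symmDiff {k ∈ range n | s(vtx σ i, vtx σ k) ∈ A} Y) := by
  refine le_trans (card_le_card ?_) (card_image_le (f := vtx σ))
  intro v hv
  obtain ⟨k, hk, rfl⟩ := exists_vtx σ v
  refine mem_image.2 ⟨k, ?_, rfl⟩
  rw [mem_symmDiff] at hv ⊢
  rw [hZ k hk, mem_nbrs] at hv
  simpa [hk] using hv

set_option maxHeartbeats 1000000 in
/-- A graph of minimum degree at least `n / 2` is flexible unless it is nearly extremal. -/
theorem flexible_of_not_nearExtremal {A : Finset (Sym2 V)} (hdiag : ∀ v, s(v, v) ∉ A)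
    (hdeg : ∀ v, n ≤ 2 * #(nbrs A v)) {θ : ℝ} (hθ : 0 < θ) (hθ1 : θ ≤ 1 / 100)
    (hn : 100 ≤ θ ^ 2 * n) (hA : ¬ NearExtremal A (100 * θ)) :
    Flexible n A univ ∅ (θ ^ 2 / 10) (θ ^ 2 / 10) := by
  intro σ _ _ F _ hF hFcard
  by_contra! hlt
  apply hA
  have hn0 : (0 : ℝ) < n := by exact_mod_cast NeZero.pos n
  have hcardV : Fintype.card V = n := by rw [← Fintype.card_congr σ, Fintype.card_fin]
  have hn1 : (100 : ℝ) ≤ θ * n := by nlinarith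
  have hn100 : (100 : ℝ) ≤ n := by nlinarith
  have hn3 : 3 ≤ n := by
    have : (3 : ℝ) ≤ n := by linarith
    exact_mod_cast this
  -- The parameters satisfy `18 * e * n ≤ m * m`, so `m` also serves as `w` in `extremal_of_stuck`;
  -- the resulting error is at most `100 * θ * n ^ 2`.
  obtain ⟨e, he⟩ : ∃ e, e = ⌈θ ^ 2 * n⌉₊ := ⟨_, rfl⟩
  obtain ⟨m, hm⟩ : ∃ m, m = ⌈5 * θ * n⌉₊ := ⟨_, rfl⟩
  have he1 : θ ^ 2 * n ≤ e := by rw [he]; exact Nat.le_ceil _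
  have he2 : (e : ℝ) < θ ^ 2 * n + 1 := by rw [he]; exact Nat.ceil_lt_add_one (by positivity)
  have hm1 : 5 * θ * n ≤ m := by rw [hm]; exact Nat.le_ceil _
  have hm2 : (m : ℝ) < 5 * θ * n + 1 := by rw [hm]; exact Nat.ceil_lt_add_one (by positivity)
  set R : ℕ → ℕ → Prop := fun i j => s(vtx σ i, vtx σ j) ∈ A with hR
  set N : ℕ → Finset ℕ := fun i => {k ∈ range n | R i k} with hN
  set X : Finset ℕ := {k ∈ range (n - 1) | R 0 (k + 1)} with hX
  have hXn : ∀ k ∈ X, k < n - 1 ∧ R 0 (k + 1) := fun k hk => by simpa [hX] using hk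
  have hNcard : ∀ i, #(N i) = #(nbrs A (vtx σ i)) := by
    intro i
    refine card_bij (fun k _ => vtx σ k) ?_ ?_ ?_
    · intro k hk
      exact mem_nbrs.2 (mem_filter.1 hk).2
    · intro k hk k' hk' h
      exact vtx_inj (mem_range.1 (mem_filter.1 hk).1) (mem_range.1 (mem_filter.1 hk').1) h
    · intro v hv
      obtain ⟨k, hk, rfl⟩ := exists_vtx σ v
      exact ⟨k, mem_filter.2 ⟨mem_range.2 hk, mem_nbrs.1 hv⟩, rfl⟩
  have hXcard : n ≤ 2 * #X + 2 := by
    have h1 : n ≤ 2 * #(N 0) := by rw [hNcard]; exact hdeg _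
    have h2 : N 0 ⊆ insert 0 (X.image (· + 1)) := by
      intro k hk
      obtain ⟨h3, h4⟩ := mem_filter.1 hk
      rw [mem_range] at h3
      rcases Nat.eq_zero_or_pos k with rfl | h0
      · exact mem_insert_self _ _
      · refine mem_insert_of_mem (mem_image.2 ⟨k - 1, ?_, by omega⟩)
        rw [hX, mem_filter, mem_range, Nat.sub_add_cancel h0]
        exact ⟨by omega, h4⟩
    have h3 := (card_le_card h2).trans (card_insert_le _ _)
    have h4 := card_image_le (s := X) (f := (· + 1))
    omega
  have hcl : (#(closings A F σ) : ℝ) < θ ^ 2 / 10 * n := by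
    have h1 : ((#(closings A F σ) * n ^ 2 : ℕ) : ℝ) ≤ #(goodMoves A F σ) :=
      Nat.cast_le.2 (card_closings_mul_le_goodMoves hF)
    push_cast at h1
    by_contra! h2
    have : θ ^ 2 / 10 * n * n ^ 2 ≤ #(closings A F σ) * (n : ℝ) ^ 2 := by gcongr
    nlinarith
  have hcl2 : ((∑ i ∈ rotations A F ∅ σ, #(closings A F (revPrefix i σ)) : ℕ) : ℝ) <
      θ ^ 2 / 10 * n ^ 2 := by
    have h1 : (((∑ i ∈ rotations A F ∅ σ, #(closings A F (revPrefix i σ))) * n : ℕ) : ℝ) ≤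
      #(goodMoves A F σ) := Nat.cast_le.2 (sum_closings_mul_le_goodMoves hF)
    rw [Nat.cast_mul] at h1
    by_contra! h2
    have := mul_le_mul_of_nonneg_right h2 hn0.le
    nlinarith
  have hXB : #(X ∩ N (n - 1)) ≤ e := by
    have h1 : #(X ∩ N (n - 1)) ≤ #(closings A F σ) + #F := by
      refine le_trans ?_ (Nat.add_le_add_left (card_filter_fin_tourEdge_mem hn3 σ F) _)
      refine le_trans ?_ (card_union_le _ _)
      refine card_le_card_of_injOn (fun k => (Fin.ofNat n k : Fin n)) ?_ ?_
      · intro k hk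
        rw [mem_coe, mem_inter] at hk
        have h1 := hXn k hk.1
        have h2 := (mem_filter.1 hk.2).2
        have e0 : ((Fin.ofNat n k : Fin n) : ℕ) = k := Nat.mod_eq_of_lt (by omega)
        simp only [closings, mem_coe, mem_union, mem_filter, mem_univ, true_and, e0]
        by_cases hFk : tourEdge σ k ∈ F
        · exact Or.inr hFk
        · exact Or.inl ⟨h1.1, h1.2, hFk, h2⟩
      · intro k hk k' hk' h
        have h1 := (hXn k (mem_inter.1 hk).1).1
        have h2 := (hXn k' (mem_inter.1 hk').1).1
        have := congrArg Fin.val h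
        simp only [Fin.val_ofNat] at this
        rwa [Nat.mod_eq_of_lt (by omega), Nat.mod_eq_of_lt (by omega)] at this
    have h2 : (#(X ∩ N (n - 1)) : ℝ) ≤ #(closings A F σ) + #F := by exact_mod_cast h1
    have : (#(X ∩ N (n - 1)) : ℝ) ≤ e := by nlinarith
    exact_mod_cast this
  have hcross : ∑ i ∈ X, (#{k ∈ range n | i + 1 < k ∧ R i k ∧ k - 1 ∈ N (n - 1)} +
      #{k ∈ range n | k < i ∧ R i k ∧ k + 1 ∈ N (n - 1)}) ≤ e * n := by
    set f : ℕ → ℕ := fun i => #{k ∈ range n | i + 1 < k ∧ R i k ∧ k - 1 ∈ N (n - 1)} +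
      #{k ∈ range n | k < i ∧ R i k ∧ k + 1 ∈ N (n - 1)} with hf
    have hf1 : ∀ i : Fin n, (i : ℕ) < n - 1 → f i ≤ #(closings A F (revPrefix i σ)) + #F := by
      intro i hi
      refine le_trans (Nat.add_le_add (card_le_card ?_) (card_le_card ?_))
        (card_filter_crossing_le hn3 A F σ i hi)
      · intro k hk
        simp only [hN, hR, mem_filter, mem_range] at hk ⊢
        tauto
      · intro k hk
        simp only [hN, hR, mem_filter, mem_range] at hk ⊢
        tauto
    have hf2 : ∀ i, f i ≤ 2 * n := by
      intro i
      have h1 := card_filter_le (range n) fun k => i + 1 < k ∧ R i k ∧ k - 1 ∈ N (n - 1)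
      have h2 := card_filter_le (range n) fun k => k < i ∧ R i k ∧ k + 1 ∈ N (n - 1)
      rw [card_range] at h1 h2
      simp only [hf]
      omega
    -- The elements of `X` that are not admissible rotations have a protected edge. There are at
    -- most `#F` of them, and each contributes at most `2 * n`.
    have h1 : ∑ i ∈ X, f i ≤ ∑ i ∈ (rotations A F ∅ σ ∪
        ({i : Fin n | tourEdge σ i ∈ F} : Finset (Fin n))).image Fin.val with i < n - 1, f i := by
      refine Finset.sum_le_sum_of_subset ?_
      intro k hk
      have h1 := hXn k hk
      refine mem_filter.2 ⟨mem_image.2 ⟨⟨k, by omega⟩, ?_, rfl⟩, h1.1⟩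
      simp only [rotations, mem_union, mem_filter, mem_univ, true_and, notMem_empty,
        not_false_eq_true, and_true]
      by_cases hFk : tourEdge σ k ∈ F
      · exact Or.inr hFk
      · exact Or.inl ⟨h1.1, h1.2, hFk⟩
    have h2 : ∑ i ∈ (rotations A F ∅ σ ∪
        ({i : Fin n | tourEdge σ i ∈ F} : Finset (Fin n))).image Fin.val with i < n - 1, f i ≤
        ∑ i ∈ rotations A F ∅ σ, (#(closings A F (revPrefix i σ)) + #F) +
        ∑ i ∈ ({i : Fin n | tourEdge σ i ∈ F} : Finset (Fin n)), 2 * n := by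
      rw [Finset.sum_filter, Finset.sum_image (fun _ _ _ _ h => Fin.ext h)]
      refine (Nat.le_add_right _ _).trans ((Finset.sum_union_inter).le.trans (Nat.add_le_add ?_ ?_))
      · refine Finset.sum_le_sum fun i _ => ?_
        split_ifs with h
        · exact hf1 i h
        · exact Nat.zero_le _
      · refine Finset.sum_le_sum fun i _ => ?_
        split_ifs with h
        · exact hf2 i
        · exact Nat.zero_le _
    clear_value f
    have h3 := h1.trans h2
    rw [Finset.sum_add_distrib, Finset.sum_const, Finset.sum_const, smul_eq_mul, smul_eq_mul] at h3
    have h4 := card_filter_fin_tourEdge_mem hn3 σ F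
    have h5 : #(rotations A F ∅ σ) ≤ n := by simpa using card_le_univ (rotations A F ∅ σ)
    have h6 : ∑ i ∈ X, f i ≤ ∑ i ∈ rotations A F ∅ σ, #(closings A F (revPrefix i σ)) + n * #F +
        #F * (2 * n) := h3.trans (by gcongr)
    have h7 : ((∑ i ∈ X, f i : ℕ) : ℝ) ≤
        ((∑ i ∈ rotations A F ∅ σ, #(closings A F (revPrefix i σ)) : ℕ) : ℝ) + n * #F +
          #F * (2 * n) := by exact_mod_cast h6
    have h8 : (n : ℝ) * #F ≤ n * (θ ^ 2 / 10 * n) := by gcongr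
    have : ((∑ i ∈ X, f i : ℕ) : ℝ) ≤ ((e * n : ℕ) : ℝ) := by
      push_cast at h7 hcl2 ⊢
      nlinarith [mul_le_mul_of_nonneg_right he1 hn0.le]
    exact_mod_cast this
  have hkey := extremal_of_stuck (n := n) (e := e) (m := m) (w := m) (R := R)
    (fun i j h => by rw [hR] at h ⊢; simp only at h ⊢; rwa [Sym2.eq_swap])
    (fun i => hdiag _) N (fun i => rfl) (fun i _ => by rw [hNcard]; exact hdeg _) X (N (n - 1))
    rfl rfl (by
      have : (1 : ℝ) ≤ e := by linarith
      exact_mod_cast this) (by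
      have : (1 : ℝ) ≤ m := by linarith
      exact_mod_cast this) (by
      have h1 : (n : ℝ) ≤ 2 * #X + 2 := by exact_mod_cast hXcard
      have : (m : ℝ) ≤ #X := by nlinarith
      exact_mod_cast this) hXB hcross (by
      have h1 : (5 * θ * n) * (5 * θ * n) ≤ (m : ℝ) * m := by gcongr
      have h2 : (18 * e * n : ℝ) ≤ m * m := by nlinarith
      exact_mod_cast h2)
  obtain ⟨k1, k2, k3⟩ := hkey
  set Y : Finset V := X.image (vtx σ) with hY
  have hinj : Set.InjOn (vtx σ) X := by
    intro k hk k' hk' h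
    have h1 := (hXn k hk).1
    have h2 := (hXn k' hk').1
    exact vtx_inj (by omega) (by omega) h
  have hYX : ∀ k < n, vtx σ k ∈ Y ↔ k ∈ X := by
    intro k hk
    rw [hY, mem_image]
    constructor
    · rintro ⟨k', hk', h⟩
      have h1 := (hXn k' hk').1
      rwa [← vtx_inj (by omega) hk h]
    · exact fun h => ⟨k, h, rfl⟩
  have hYX' : ∀ k < n, vtx σ k ∈ Yᶜ ↔ k ∈ range n \ X := by
    intro k hk
    rw [mem_compl, hYX k hk, mem_sdiff, mem_range]
    tauto
  have hbound : ((n * (18 * e + 4 * (m + m + 2) + 4) : ℕ) : ℝ) ≤ 100 * θ * (n : ℝ) ^ 2 := by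
    push_cast
    have : (18 * e + 4 * (m + m + 2) + 4 : ℝ) ≤ 100 * θ * n := by nlinarith
    nlinarith
  refine ⟨Y, ?_, ?_, ?_⟩
  · rw [hcardV, hY, card_image_of_injOn hinj]; exact k1
  · rw [hcardV, hY, card_image_of_injOn hinj]
    have : (2 * #X : ℝ) ≤ n + 2 * e := by exact_mod_cast k2
    nlinarith
  · rw [hcardV, hY, Finset.sum_image hinj, Finset.sum_image hinj]
    rcases k3 with k3 | k3
    · left
      refine le_trans ?_ hbound
      refine le_trans ?_ (Nat.cast_le.2 k3)
      push_cast
      exact Finset.sum_le_sum fun i _ => Nat.cast_le.2 (card_symmDiff_nbrs_le σ A hYX i)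
    · right
      refine le_trans ?_ hbound
      refine le_trans ?_ (Nat.cast_le.2 k3)
      push_cast
      exact Finset.sum_le_sum fun i _ => Nat.cast_le.2 (card_symmDiff_nbrs_le σ A hYX' i)
end Extremal

/-! ### Spread distributions and their mixtures. -/

section Spread
variable {E : Type*} [Fintype E] [DecidableEq E]

/-- There is a probability distribution on the members of `𝓗` such that a random member contains
any given set `S` with probability at most `q ^ #(S \ F)`. -/
def HasSpread (q : ℝ) (𝓗 : Finset (Finset E)) (F : Finset E) : Prop :=
  ∃ μ : Finset E → ℝ, (∀ H, 0 ≤ μ H) ∧ (∀ H, H ∉ 𝓗 → μ H = 0) ∧ ∑ H, μ H = 1 ∧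
    ∀ S, ∑ H with S ⊆ H, μ H ≤ q ^ #(S \ F)

/-- Weak duality: a random member contains some set of the cover with certainty, and the union bound
compares this with the cost of the cover. -/
theorem HasSpread.coverCost {q : ℝ} {𝓗 : Finset (Finset E)} (h : HasSpread q 𝓗 ∅) :
    CoverCost q 𝓗 1 := by
  obtain ⟨μ, h0, hsupp, h1, hS⟩ := h
  intro 𝒰 h𝒰
  rw [← h1]
  calc ∑ H, μ H ≤ ∑ H, ∑ U ∈ 𝒰, if U ⊆ H then μ H else 0 := by
        refine Finset.sum_le_sum fun H _ => ?_
        by_cases hH : H ∈ 𝓗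
        · obtain ⟨U, hU, hUH⟩ := h𝒰 H hH
          have := Finset.single_le_sum (f := fun U => if U ⊆ H then μ H else 0)
            (fun i _ => by split_ifs; exacts [h0 H, le_rfl]) hU
          simpa [hUH] using this
        · rw [hsupp H hH]
          exact Finset.sum_nonneg fun i _ => by split_ifs <;> exact le_rfl
    _ = ∑ U ∈ 𝒰, ∑ H with U ⊆ H, μ H := by
        rw [Finset.sum_comm]
        exact Finset.sum_congr rfl fun U _ => (Finset.sum_filter _ _).symm
    _ ≤ ∑ U ∈ 𝒰, q ^ #U := Finset.sum_le_sum fun U _ => by simpa using hS U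

theorem hasSpread_of_card_le {Ω : Type*} {q : ℝ} {𝓗 : Finset (Finset E)} {F : Finset E}
    (T : Finset Ω) (hT : T.Nonempty) (f : Ω → Finset E) (hf : ∀ ω ∈ T, f ω ∈ 𝓗)
    (h : ∀ S, (#{ω ∈ T | S ⊆ f ω} : ℝ) ≤ q ^ #(S \ F) * #T) : HasSpread q 𝓗 F := by
  have hT0 : (0 : ℝ) < #T := by exact_mod_cast hT.card_pos
  refine ⟨fun H => #{ω ∈ T | f ω = H} / #T, fun H => by positivity, ?_, ?_, ?_⟩
  · intro H hH
    have : #{ω ∈ T | f ω = H} = 0 := by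
      rw [card_eq_zero, filter_eq_empty_iff]
      rintro ω hω rfl
      exact hH (hf ω hω)
    simp [this]
  · rw [← Finset.sum_div, ← Nat.cast_sum, ← card_eq_sum_card_fiberwise (fun _ _ => mem_coe.2 (mem_univ _)),
      div_self hT0.ne']
  · intro S
    rw [← Finset.sum_div, div_le_iff₀ hT0]
    refine le_trans (le_of_eq ?_) (h S)
    rw [card_eq_sum_card_fiberwise (f := f) (t := ({H | S ⊆ H} : Finset (Finset E)))]
    · push_cast
      refine Finset.sum_congr rfl fun H hH => ?_
      rw [filter_filter]
      congr 2
      ext ω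
      simp only [mem_filter, mem_univ, true_and] at hH ⊢
      constructor
      · rintro ⟨h1, rfl⟩
        exact ⟨h1, hH, rfl⟩
      · rintro ⟨h1, -, h3⟩
        exact ⟨h1, h3⟩
    · intro ω hω
      simpa using (mem_filter.1 (mem_coe.1 hω)).2

/-- Mixtures of spread distributions. -/
theorem hasSpread_mix {Ω : Type*} {q₁ q₂ : ℝ} (hq₂ : 0 ≤ q₂)
    {𝓗 : Finset (Finset E)} (T : Finset Ω) (hT : T.Nonempty) (F : Ω → Finset E)
    (hF : ∀ S, (#{ω ∈ T | S ⊆ F ω} : ℝ) ≤ q₁ ^ #S * #T)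
    (h : ∀ ω ∈ T, HasSpread q₂ 𝓗 (F ω)) : HasSpread (q₁ + q₂) 𝓗 ∅ := by
  have hT0 : (0 : ℝ) < #T := by exact_mod_cast hT.card_pos
  choose! μ h0 hsupp h1 hS using h
  refine ⟨fun H => (∑ ω ∈ T, μ ω H) / #T, fun H => ?_, fun H hH => ?_, ?_, fun S => ?_⟩
  · exact div_nonneg (Finset.sum_nonneg fun ω hω => h0 ω hω H) hT0.le
  · beta_reduce
    rw [Finset.sum_eq_zero fun ω hω => hsupp ω hω H hH, zero_div]
  · rw [← Finset.sum_div, Finset.sum_comm, Finset.sum_congr rfl h1]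
    simp [hT0.ne']
  · rw [← Finset.sum_div, div_le_iff₀ hT0, Finset.sum_comm, sdiff_empty]
    calc ∑ ω ∈ T, ∑ H with S ⊆ H, μ ω H ≤ ∑ ω ∈ T, q₂ ^ #(S \ F ω) :=
          Finset.sum_le_sum fun ω hω => hS ω hω S
      -- The actual intersection of `S` with `F ω` is one of the summands. Summing over all possible
      -- parts `R` leads to the binomial expansion of `(q₁ + q₂) ^ #S`.
      _ ≤ ∑ ω ∈ T, ∑ R ∈ S.powerset, if R ⊆ F ω then q₂ ^ (#S - #R) else 0 := by
          refine Finset.sum_le_sum fun ω _ => ?_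
          have h2 : S ∩ F ω ∈ S.powerset := mem_powerset.2 inter_subset_left
          have := Finset.single_le_sum (f := fun R => if R ⊆ F ω then q₂ ^ (#S - #R) else 0)
            (fun i _ => by split_ifs <;> positivity) h2
          simp only [inter_subset_right, if_true] at this
          have h3 := card_sdiff_add_card_inter S (F ω)
          rwa [show #(S \ F ω) = #S - #(S ∩ F ω) by omega]
      _ = ∑ R ∈ S.powerset, #{ω ∈ T | R ⊆ F ω} * q₂ ^ (#S - #R) := by
          rw [Finset.sum_comm]
          refine Finset.sum_congr rfl fun R _ => ?_
          rw [← Finset.sum_filter, Finset.sum_const, nsmul_eq_mul]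
      _ ≤ ∑ R ∈ S.powerset, q₁ ^ #R * #T * q₂ ^ (#S - #R) := by
          refine Finset.sum_le_sum fun R _ => ?_
          have := hF R
          gcongr
      _ = (q₁ + q₂) ^ #S * #T := by
          rw [← Finset.sum_pow_mul_eq_add_pow, Finset.sum_mul]
          exact Finset.sum_congr rfl fun R _ => by ring

end Spread

/-! ### Spread distributions from flexible graphs. -/

section SpreadTours
variable {V : Type*} [Fintype V] [DecidableEq V] {n : ℕ} [NeZero n]

variable (n) in
/-- The edge sets of the Hamilton cycles with edges in `A`. -/
def hamCycles (A : Finset (Sym2 V)) : Finset (Finset (Sym2 V)) := (tours n ∅ A).image cycEdges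

theorem card_tours_empty_univ (h : Fintype.card V = n) :
    #(tours (V := V) n ∅ univ) = n.factorial := by
  have : tours (V := V) n ∅ univ = univ := by
    ext σ; simp [mem_tours]
  rw [this, card_univ, Fintype.card_equiv (Fintype.equivFinOfCardEq h).symm, Fintype.card_fin]

/-- The uniform distribution on the tours through `F₀` with edges in `A ∪ F₀` is spread. -/
theorem Flexible.hasSpread (hn : 3 ≤ n) {A K F₀ B : Finset (Sym2 V)} {ε c D : ℝ}
    (hε : 0 < ε) (hc : 0 < c) (hD : 1 ≤ D) (hAK : A ⊆ K) (h : Flexible n A K F₀ ε c)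
    (hF : (#F₀ : ℝ) ≤ ε * n / 2)
    (hhost : (#(tours n F₀ (univ : Finset (Sym2 V))) : ℝ) ≤ D ^ n * #(tours n F₀ (K ∪ F₀)))
    (hne : (tours n F₀ (K ∪ F₀)).Nonempty) (hB : A ∪ F₀ ⊆ B) :
    HasSpread (spreadConst ε c D / n) (hamCycles n B) F₀ := by
  have h0 : (0 : ℝ) < n := by exact_mod_cast NeZero.pos n
  have hne' : (tours n F₀ (A ∪ F₀)).Nonempty := by
    rw [← card_pos]
    have h1 := h.card_host_le hn hc hAK (hF.trans (by nlinarith))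
    have h2 : (0 : ℝ) < #(tours n F₀ (K ∪ F₀)) := by exact_mod_cast hne.card_pos
    by_contra h3
    rw [Nat.eq_zero_of_not_pos h3] at h1
    simp only [Nat.cast_zero, mul_zero] at h1
    linarith
  refine hasSpread_of_card_le (tours n F₀ (A ∪ F₀)) hne' cycEdges ?_ fun S => ?_
  · intro σ hσ
    rw [mem_tours] at hσ
    exact mem_image_of_mem _ (mem_tours.2 ⟨empty_subset _, hσ.2.trans hB⟩)
  · refine le_trans (Nat.cast_le.2 (card_le_card ?_))
      (h.spread hn hε hc hD hAK hF hhost (S \ F₀) disjoint_sdiff)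
    intro σ hσ
    obtain ⟨h1, h2⟩ := mem_filter.1 hσ
    rw [mem_tours] at h1 ⊢
    exact ⟨union_subset h1.1 (sdiff_subset.trans h2), h1.2⟩

end SpreadTours

/-! ### Counting tours of a host through a prescribed matching. -/

section Matched
variable {V : Type*} [Fintype V] [DecidableEq V] {d : ℕ}

/-- A matching of `d` pairs `u i, v i`. -/
structure IsPairing (u v : Fin d → V) : Prop where
  injl : Function.Injective u
  injr : Function.Injective v
  ne : ∀ i j, u i ≠ v j

/-- The edges of a pairing. -/
def pairEdges (u v : Fin d → V) : Finset (Sym2 V) := univ.image fun i => s(u i, v i)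

/-- The vertices of a given class which are not covered by the pairing. -/
def unpaired (cl : V → Bool) (u v : Fin d → V) (b : Bool) : Finset V :=
  univ.filter fun w => cl w = b ∧ (∀ i, u i ≠ w) ∧ ∀ i, v i ≠ w

theorem mem_unpaired {cl : V → Bool} {u v : Fin d → V} {b : Bool} {w : V} :
    w ∈ unpaired cl u v b ↔ cl w = b ∧ (∀ i, u i ≠ w) ∧ ∀ i, v i ≠ w := by
  simp [unpaired]

omit [Fintype V] in
theorem mem_pairEdges {u v : Fin d → V} {e : Sym2 V} :
    e ∈ pairEdges u v ↔ ∃ i, s(u i, v i) = e := by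
  simp [pairEdges]

omit [Fintype V] in
theorem IsPairing.card_pairEdges {u v : Fin d → V} (h : IsPairing u v) :
    #(pairEdges u v) = d := by
  unfold pairEdges
  rw [card_image_of_injective, card_univ, Fintype.card_fin]
  intro i j hij
  rcases Sym2.eq_iff.1 hij with ⟨h1, _⟩ | ⟨h1, _⟩
  · exact h.injl h1
  · exact absurd h1 (h.ne _ _)

/-- The vertices, split into the two sides of the pairing and the two unpaired classes. -/
noncomputable def pairingEquiv (cl : V → Bool) {u v : Fin d → V} (h : IsPairing u v) :
    (Fin d ⊕ Fin d) ⊕ (unpaired cl u v true ⊕ unpaired cl u v false) ≃ V :=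
  Equiv.ofBijective (Sum.elim (Sum.elim u v) (Sum.elim Subtype.val Subtype.val)) (by
    constructor
    · rintro ((i | i) | (i | i)) ((j | j) | (j | j)) hij <;>
        simp only [Sum.elim_inl, Sum.elim_inr] at hij
      · rw [h.injl hij]
      · exact absurd hij (h.ne _ _)
      · exact absurd hij ((mem_unpaired.1 j.2).2.1 _)
      · exact absurd hij ((mem_unpaired.1 j.2).2.1 _)
      · exact absurd hij.symm (h.ne _ _)
      · rw [h.injr hij]
      · exact absurd hij ((mem_unpaired.1 j.2).2.2 _)
      · exact absurd hij ((mem_unpaired.1 j.2).2.2 _)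
      · exact absurd hij.symm ((mem_unpaired.1 i.2).2.1 _)
      · exact absurd hij.symm ((mem_unpaired.1 i.2).2.2 _)
      · rw [Subtype.ext hij]
      · have h1 := (mem_unpaired.1 i.2).1
        rw [hij, (mem_unpaired.1 j.2).1] at h1
        exact absurd h1 (by simp)
      · exact absurd hij.symm ((mem_unpaired.1 i.2).2.1 _)
      · exact absurd hij.symm ((mem_unpaired.1 i.2).2.2 _)
      · have h1 := (mem_unpaired.1 i.2).1
        rw [hij, (mem_unpaired.1 j.2).1] at h1
        exact absurd h1 (by simp)
      · rw [Subtype.ext hij]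
    · intro w
      by_cases h1 : ∃ i, u i = w
      · obtain ⟨i, hi⟩ := h1
        exact ⟨Sum.inl (Sum.inl i), hi⟩
      by_cases h2 : ∃ i, v i = w
      · obtain ⟨i, hi⟩ := h2
        exact ⟨Sum.inl (Sum.inr i), hi⟩
      push Not at h1 h2
      rcases hb : cl w with _ | _
      · exact ⟨Sum.inr (Sum.inr ⟨w, mem_unpaired.2 ⟨hb, h1, h2⟩⟩), rfl⟩
      · exact ⟨Sum.inr (Sum.inl ⟨w, mem_unpaired.2 ⟨hb, h1, h2⟩⟩), rfl⟩)

theorem IsPairing.card_eq (cl : V → Bool) {u v : Fin d → V} (h : IsPairing u v) :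
    Fintype.card V = d + d + (#(unpaired cl u v true) + #(unpaired cl u v false)) := by
  rw [← Fintype.card_congr (pairingEquiv cl h)]
  simp

/-- The permutations of the vertices which respect the pairing and the classes. -/
noncomputable def pairingPerm (cl : V → Bool) {u v : Fin d → V} (h : IsPairing u v)
    (x : Equiv.Perm (Fin d) × Equiv.Perm (unpaired cl u v true) ×
      Equiv.Perm (unpaired cl u v false)) : Equiv.Perm V :=
  (pairingEquiv cl h).permCongr
    (Equiv.sumCongr (Equiv.sumCongr x.1 x.1) (Equiv.sumCongr x.2.1 x.2.2))

theorem pairingPerm_injective (cl : V → Bool) {u v : Fin d → V} (h : IsPairing u v) :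
    Function.Injective (pairingPerm cl h) := by
  rintro ⟨a, b, c⟩ ⟨a', b', c'⟩ hx
  have h1 := (pairingEquiv cl h).permCongr.injective hx
  have h2 := fun y => congrArg (fun f => f y) h1
  simp only [Prod.mk.injEq]
  refine ⟨?_, ?_, ?_⟩
  · ext i; have := h2 (Sum.inl (Sum.inl i)); simp at this; rw [this]
  · ext i; have := h2 (Sum.inr (Sum.inl i)); simp at this; rw [this]
  · ext i; have := h2 (Sum.inr (Sum.inr i)); simp at this; rw [this]

variable {cl : V → Bool} {u v : Fin d → V}

theorem pairingPerm_left (h : IsPairing u v) (x) (i : Fin d) : pairingPerm cl h x (u i) = u (x.1 i) := by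
  have h1 : (pairingEquiv cl h).symm (u i) = Sum.inl (Sum.inl i) := by
    rw [Equiv.symm_apply_eq]; rfl
  rw [pairingPerm, Equiv.permCongr_apply, h1]
  rfl

theorem pairingPerm_right (h : IsPairing u v) (x) (i : Fin d) : pairingPerm cl h x (v i) = v (x.1 i) := by
  have h1 : (pairingEquiv cl h).symm (v i) = Sum.inl (Sum.inr i) := by
    rw [Equiv.symm_apply_eq]; rfl
  rw [pairingPerm, Equiv.permCongr_apply, h1]
  rfl

theorem cl_pairingPerm (h : IsPairing u v) (hu : ∀ i j, cl (u i) = cl (u j)) (hv : ∀ i j, cl (v i) = cl (v j)) (x)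
    (w : V) : cl (pairingPerm cl h x w) = cl w := by
  obtain ⟨y, rfl⟩ := (pairingEquiv cl h).surjective w
  rw [pairingPerm, Equiv.permCongr_apply, Equiv.symm_apply_apply]
  rcases y with (i | i) | (i | i)
  · exact hu _ _
  · exact hv _ _
  · exact (mem_unpaired.1 (x.2.1 i).2).1.trans (mem_unpaired.1 i.2).1.symm
  · exact (mem_unpaired.1 (x.2.2 i).2).1.trans (mem_unpaired.1 i.2).1.symm

variable {n : ℕ} [NeZero n]

omit [Fintype V] in
theorem cycEdges_trans (σ : Fin n ≃ V) (τ : Equiv.Perm V) :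
    cycEdges (σ.trans τ) = (cycEdges σ).image (Sym2.map τ) := by
  unfold cycEdges
  rw [image_image]
  rfl

/-- One tour is enough: the permutations that preserve the pairing and the classes preserve the host
and act freely on its tours. -/
theorem card_unpaired_factorial_le_card_tours (h : IsPairing u v) (hu : ∀ i j, cl (u i) = cl (u j))
    (hv : ∀ i j, cl (v i) = cl (v j)) {K : Finset (Sym2 V)}
    (hK : ∀ x y x' y', cl x = cl x' → cl y = cl y' → s(x, y) ∈ K → s(x', y') ∈ K)
    (hne : (tours n (pairEdges u v) (K ∪ pairEdges u v)).Nonempty) :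
    d.factorial * ((#(unpaired cl u v true)).factorial * (#(unpaired cl u v false)).factorial) ≤
      #(tours n (pairEdges u v) (K ∪ pairEdges u v)) := by
  obtain ⟨σ, hσ⟩ := hne
  rw [mem_tours] at hσ
  have h1 : #(univ : Finset (Equiv.Perm (Fin d) × Equiv.Perm (unpaired cl u v true) ×
      Equiv.Perm (unpaired cl u v false))) = d.factorial * ((#(unpaired cl u v true)).factorial *
        (#(unpaired cl u v false)).factorial) := by
    simp [Fintype.card_perm]
  rw [← h1]
  have hpair : ∀ x, ∀ e ∈ pairEdges u v, Sym2.map (pairingPerm cl h x) e ∈ pairEdges u v := by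
    intro x e he
    obtain ⟨i, rfl⟩ := mem_pairEdges.1 he
    rw [Sym2.map_mk, pairingPerm_left, pairingPerm_right]
    exact mem_pairEdges.2 ⟨_, rfl⟩
  refine card_le_card_of_injOn (fun x => σ.trans (pairingPerm cl h x)) ?_ ?_
  · intro x _
    rw [mem_coe, mem_tours, cycEdges_trans]
    constructor
    · intro e he
      obtain ⟨i, rfl⟩ := mem_pairEdges.1 he
      refine mem_image.2 ⟨s(u (x.1.symm i), v (x.1.symm i)), hσ.1 (mem_pairEdges.2 ⟨_, rfl⟩), ?_⟩
      rw [Sym2.map_mk, pairingPerm_left, pairingPerm_right]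
      simp
    · intro e he
      obtain ⟨e', he', rfl⟩ := mem_image.1 he
      rcases mem_union.1 (hσ.2 he') with h2 | h2
      · refine mem_union_left _ ?_
        induction e' with | _ a b =>
        rw [Sym2.map_mk]
        exact hK _ _ _ _ (cl_pairingPerm h hu hv x a).symm (cl_pairingPerm h hu hv x b).symm h2
      · exact mem_union_right _ (hpair x _ h2)
  · intro x _ y _ hxy
    apply pairingPerm_injective cl h
    ext w
    have := congrArg (fun f => f (σ.symm w)) hxy
    simpa using this

theorem factorial_le_of_sum (d p q : ℕ) : (d + d + (p + q)).factorial ≤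
    4 ^ (d + d + (p + q)) * (d.factorial * d.factorial * (p.factorial * q.factorial)) := by
  have key : ∀ a b : ℕ, (a + b).factorial ≤ 2 ^ (a + b) * (a.factorial * b.factorial) := by
    intro a b
    have h1 := Nat.add_choose_mul_factorial_mul_factorial a b
    have h2 := Nat.choose_le_two_pow (a + b) b
    calc (a + b).factorial = (a + b).choose b * (a.factorial * b.factorial) := by
          rw [← h1, mul_assoc]
      _ ≤ _ := Nat.mul_le_mul_right _ h2
  calc (d + d + (p + q)).factorial
      ≤ 2 ^ (d + d + (p + q)) * ((d + d).factorial * (p + q).factorial) := key _ _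
    _ ≤ 2 ^ (d + d + (p + q)) * ((2 ^ (d + d) * (d.factorial * d.factorial)) *
          (2 ^ (p + q) * (p.factorial * q.factorial))) := by
        gcongr
        · exact key _ _
        · exact key _ _
    _ = (2 ^ (d + d + (p + q)) * 2 ^ (d + d + (p + q))) *
          (d.factorial * d.factorial * (p.factorial * q.factorial)) := by
        rw [pow_add 2 (d + d) (p + q)]; ring
    _ = _ := by rw [← mul_pow]; norm_num

/-- The upper bound is `6 ^ d * n ! / d !`. Since `n ! ≤ 4 ^ n * (d !) ^ 2 * p ! * q !`, where `p`
and `q` count the unpaired vertices, it exceeds the lower bound `d ! * p ! * q !` by a factor of at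
most `24 ^ n`. This supplies the host comparison in `Flexible.spread` with `D = 24`. -/
theorem card_tours_pairEdges_univ_le (h : IsPairing u v) (hn : 3 ≤ n) (hcard : Fintype.card V = n)
    (hu : ∀ i j, cl (u i) = cl (u j))
    (hv : ∀ i j, cl (v i) = cl (v j)) {K : Finset (Sym2 V)}
    (hK : ∀ x y x' y', cl x = cl x' → cl y = cl y' → s(x, y) ∈ K → s(x', y') ∈ K)
    (hne : (tours n (pairEdges u v) (K ∪ pairEdges u v)).Nonempty) :
    #(tours n (pairEdges u v) univ) ≤ 24 ^ n * #(tours n (pairEdges u v) (K ∪ pairEdges u v)) := by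
  have h1 := card_unpaired_factorial_le_card_tours h hu hv hK hne
  have h2 := h.card_eq cl
  rw [hcard] at h2
  have h3 := factorial_le_of_sum d (#(unpaired cl u v true)) (#(unpaired cl u v false))
  rw [← h2] at h3
  have h4 := card_tours_univ_union_le hn ∅ d (pairEdges u v) (disjoint_empty_left _)
    h.card_pairEdges (by rw [card_empty]; omega)
  rw [empty_union, card_tours_empty_univ hcard] at h4
  have h5 : 6 ^ d ≤ 6 ^ n := Nat.pow_le_pow_right (by norm_num) (by omega)
  refine Nat.le_of_mul_le_mul_right ?_ d.factorial_pos
  calc _ ≤ 6 ^ d * n.factorial := h4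
    _ ≤ 6 ^ n * (4 ^ n * (d.factorial * d.factorial * ((#(unpaired cl u v true)).factorial *
          (#(unpaired cl u v false)).factorial))) := Nat.mul_le_mul h5 h3
    _ = 24 ^ n * (d.factorial * ((#(unpaired cl u v true)).factorial *
          (#(unpaired cl u v false)).factorial)) * d.factorial := by
        rw [show (24 : ℕ) = 6 * 4 by norm_num, mul_pow]; ring
    _ ≤ _ := by gcongr

end Matched

/-! ### Explicit tours through prescribed pairs. -/

section HostTours
variable {V : Type*} [Fintype V] [DecidableEq V] {n d : ℕ} [NeZero n]

omit [DecidableEq V] in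
theorem exists_vtx_eq {Y : Type*} [Fintype Y] (e : Y ≃ V) (pos : Y → ℕ) (hlt : ∀ y, pos y < n)
    (hinj : Function.Injective pos) (hcard : Fintype.card V = n) :
    ∃ σ : Fin n ≃ V, ∀ y, vtx σ (pos y) = e y := by
  have hbij : Function.Bijective (fun y => (⟨pos y, hlt y⟩ : Fin n)) := by
    rw [Fintype.bijective_iff_injective_and_card, Fintype.card_congr e, hcard, Fintype.card_fin]
    exact ⟨fun x y h => hinj (by simpa using h), rfl⟩
  refine ⟨(Equiv.ofBijective _ hbij).symm.trans e, fun y => ?_⟩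
  have h1 := vtx_fin ((Equiv.ofBijective _ hbij).symm.trans e) ⟨pos y, hlt y⟩
  simp only at h1
  rw [h1, Equiv.trans_apply]
  congr 1
  rw [Equiv.symm_apply_eq]
  rfl

theorem exists_pairingEquiv (cl : V → Bool) {u v : Fin d → V} (h : IsPairing u v) {p q : ℕ}
    (hp : #(unpaired cl u v true) = p) (hq : #(unpaired cl u v false) = q) :
    ∃ e : (Fin d ⊕ Fin d) ⊕ (Fin p ⊕ Fin q) ≃ V,
      (∀ i, e (Sum.inl (Sum.inl i)) = u i) ∧ (∀ i, e (Sum.inl (Sum.inr i)) = v i) ∧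
      (∀ i, cl (e (Sum.inr (Sum.inl i))) = true) ∧ ∀ i, cl (e (Sum.inr (Sum.inr i))) = false := by
  subst hp hq
  refine ⟨(Equiv.sumCongr (Equiv.refl _) (Equiv.sumCongr (unpaired cl u v true).equivFin.symm
    (unpaired cl u v false).equivFin.symm)).trans (pairingEquiv cl h), fun i => rfl, fun i => rfl,
    fun i => ?_, fun i => ?_⟩
  · exact (mem_unpaired.1 ((unpaired cl u v true).equivFin.symm i).2).1
  · exact (mem_unpaired.1 ((unpaired cl u v false).equivFin.symm i).2).1

/-- A Hamilton cycle which alternates between the two classes apart from the given pairs. -/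
theorem nonempty_tours_of_alternating (hcard : Fintype.card V = n) (cl : V → Bool)
    {u v : Fin d → V} (h : IsPairing u v) (hu : ∀ i, cl (u i) = true) (hv : ∀ i, cl (v i) = true)
    (hpq : #(unpaired cl u v false) = #(unpaired cl u v true) + d) {K : Finset (Sym2 V)}
    (hK : ∀ x y, cl x ≠ cl y → s(x, y) ∈ K) :
    (tours n (pairEdges u v) (K ∪ pairEdges u v)).Nonempty := by
  have h0 := h.card_eq cl
  obtain ⟨p, hp⟩ : ∃ p, #(unpaired cl u v true) = p := ⟨_, rfl⟩
  obtain ⟨q, hq⟩ : ∃ q, #(unpaired cl u v false) = q := ⟨_, rfl⟩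
  obtain ⟨e, e1, e2, e3, e4⟩ := exists_pairingEquiv cl h hp hq
  rw [hcard, hp, hq] at h0
  rw [hp, hq] at hpq
  have hnpos := NeZero.pos n
  -- First `d` blocks `u i, v i, y` with `y` unpaired in class `false`, then the remaining unpaired
  -- vertices, alternating between the classes.
  obtain ⟨σ, hσ⟩ := exists_vtx_eq (n := n) e
    (Sum.elim (Sum.elim (fun i => 3 * i) (fun i => 3 * i + 1)) (Sum.elim (fun i => 3 * d + 2 * i)
      (fun i => if (i : ℕ) < d then 3 * i + 2 else 3 * d + 2 * (i - d) + 1)))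
    (by
      rintro ((i | i) | (i | i)) <;> have := i.2 <;>
        simp only [Sum.elim_inl, Sum.elim_inr] <;> (try split_ifs) <;> omega)
    (by
      rintro ((i | i) | (i | i)) ((j | j) | (j | j)) hij <;> have hi := i.2 <;> have hj := j.2 <;>
        simp only [Sum.elim_inl, Sum.elim_inr] at hij <;> (try split_ifs at hij) <;>
        first
          | (exfalso; omega)
          | (have : i = j := Fin.ext (by omega)
             rw [this])) hcard
  have pu : ∀ (i : ℕ) (hi : i < d), vtx σ (3 * i) = u ⟨i, hi⟩ := fun i hi => by
    have := hσ (Sum.inl (Sum.inl ⟨i, hi⟩)); rwa [e1] at this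
  have pv : ∀ (i : ℕ) (hi : i < d), vtx σ (3 * i + 1) = v ⟨i, hi⟩ := fun i hi => by
    have := hσ (Sum.inl (Sum.inr ⟨i, hi⟩)); rwa [e2] at this
  have pp : ∀ i < p, cl (vtx σ (3 * d + 2 * i)) = true := fun i hi => by
    have := hσ (Sum.inr (Sum.inl ⟨i, hi⟩)); simp only [Sum.elim_inl, Sum.elim_inr] at this
    rw [this, e3]
  have pq1 : ∀ i < d, cl (vtx σ (3 * i + 2)) = false := fun i hi => by
    have := hσ (Sum.inr (Sum.inr ⟨i, by omega⟩)); simp only [Sum.elim_inr, if_pos hi] at this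
    rw [this, e4]
  have pq2 : ∀ i < p, cl (vtx σ (3 * d + 2 * i + 1)) = false := fun i hi => by
    have := hσ (Sum.inr (Sum.inr ⟨d + i, by omega⟩))
    simp only [Sum.elim_inr, if_neg (show ¬ d + i < d by omega)] at this
    rw [Nat.add_sub_cancel_left] at this
    rw [this, e4]
  have p0 : cl (vtx σ 0) = true := by
    rcases Nat.eq_zero_or_pos d with hd | hd
    · have := pp 0 (by omega); rwa [hd] at this
    · have := pu 0 hd; rw [mul_zero] at this; rw [this, hu]
  refine ⟨σ, mem_tours.2 ⟨?_, ?_⟩⟩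
  · intro x hx
    obtain ⟨i, rfl⟩ := mem_pairEdges.1 hx
    refine mem_cycEdges.2 ⟨3 * i, by omega, ?_⟩
    rw [tourEdge, pu i i.2, pv i i.2]
  · intro x hx
    obtain ⟨k, hk, rfl⟩ := mem_cycEdges.1 hx
    have goal1 : cl (vtx σ k) ≠ cl (vtx σ (k + 1)) → tourEdge σ k ∈ K ∪ pairEdges u v :=
      fun h => mem_union_left _ (hK _ _ h)
    by_cases hk1 : k < 3 * d
    · obtain ⟨i, hi | hi | hi⟩ : ∃ i, k = 3 * i ∨ k = 3 * i + 1 ∨ k = 3 * i + 2 :=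
        ⟨k / 3, by omega⟩
      · subst hi
        refine mem_union_right _ (mem_pairEdges.2 ⟨⟨i, by omega⟩, ?_⟩)
        rw [tourEdge, pu i (by omega), pv i (by omega)]
      · subst hi
        apply goal1
        rw [pv i (by omega), hv, pq1 i (by omega)]
        simp
      · subst hi
        apply goal1
        rw [pq1 i (by omega)]
        by_cases hid : i + 1 < d
        · rw [show 3 * i + 2 + 1 = 3 * (i + 1) by ring, pu (i + 1) hid, hu]
          simp
        · rcases Nat.eq_zero_or_pos p with hp0 | hp0
          · rw [show 3 * i + 2 + 1 = n by omega, vtx_self, p0]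
            simp
          · rw [show 3 * i + 2 + 1 = 3 * d + 2 * 0 by omega, pp 0 hp0]
            simp
    · obtain ⟨i, hi | hi⟩ : ∃ i, k = 3 * d + 2 * i ∨ k = 3 * d + 2 * i + 1 :=
        ⟨(k - 3 * d) / 2, by omega⟩
      · subst hi
        apply goal1
        rw [pp i (by omega), pq2 i (by omega)]
        simp
      · subst hi
        apply goal1
        rw [pq2 i (by omega)]
        by_cases hid : i + 1 < p
        · rw [show 3 * d + 2 * i + 1 + 1 = 3 * d + 2 * (i + 1) by ring, pp (i + 1) hid]
          simp
        · rw [show 3 * d + 2 * i + 1 + 1 = n by omega, vtx_self, p0]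
          simp

/-- A Hamilton cycle which stays in the two classes apart from two given pairs. -/
theorem nonempty_tours_of_two_pairs (hcard : Fintype.card V = n) (cl : V → Bool)
    {u v : Fin 2 → V} (h : IsPairing u v) (hu : ∀ i, cl (u i) = true) (hv : ∀ i, cl (v i) = false)
    {K : Finset (Sym2 V)} (hK : ∀ x y, cl x = cl y → s(x, y) ∈ K) :
    (tours n (pairEdges u v) (K ∪ pairEdges u v)).Nonempty := by
  have h0 := h.card_eq cl
  obtain ⟨p, hp⟩ : ∃ p, #(unpaired cl u v true) = p := ⟨_, rfl⟩
  obtain ⟨q, hq⟩ : ∃ q, #(unpaired cl u v false) = q := ⟨_, rfl⟩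
  obtain ⟨e, e1, e2, e3, e4⟩ := exists_pairingEquiv cl h hp hq
  rw [hcard, hp, hq] at h0
  -- The order is `u 1`, the unpaired vertices of class `true`, `u 0`, `v 0`, the unpaired vertices
  -- of class `false`, `v 1`. The closing edge is the second pair.
  obtain ⟨σ, hσ⟩ := exists_vtx_eq (n := n) e
    (Sum.elim (Sum.elim (fun i => if (i : ℕ) = 0 then 1 + p else 0)
      (fun i => if (i : ℕ) = 0 then p + 2 else p + q + 3))
      (Sum.elim (fun i => 1 + i) (fun i => p + 3 + i)))
    (by
      rintro ((i | i) | (i | i)) <;> have := i.2 <;>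
        simp only [Sum.elim_inl, Sum.elim_inr] <;> (try split_ifs) <;> omega)
    (by
      rintro ((i | i) | (i | i)) ((j | j) | (j | j)) hij <;> have hi := i.2 <;> have hj := j.2 <;>
        simp only [Sum.elim_inl, Sum.elim_inr] at hij <;> (try split_ifs at hij) <;>
        first
          | (exfalso; omega)
          | (have : i = j := Fin.ext (by omega)
             rw [this])) hcard
  have pu0 : vtx σ (1 + p) = u 0 := by have := hσ (Sum.inl (Sum.inl 0)); rwa [e1] at this
  have pu1 : vtx σ 0 = u 1 := by have := hσ (Sum.inl (Sum.inl 1)); rwa [e1] at this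
  have pv0 : vtx σ (p + 2) = v 0 := by have := hσ (Sum.inl (Sum.inr 0)); rwa [e2] at this
  have pv1 : vtx σ (p + q + 3) = v 1 := by have := hσ (Sum.inl (Sum.inr 1)); rwa [e2] at this
  have ht : ∀ k < p + 2, cl (vtx σ k) = true := by
    intro k hk
    rcases Nat.eq_zero_or_pos k with rfl | hk0
    · rw [pu1, hu]
    by_cases hkp : k = 1 + p
    · rw [hkp, pu0, hu]
    · have := hσ (Sum.inr (Sum.inl ⟨k - 1, by omega⟩))
      simp only [Sum.elim_inl, Sum.elim_inr] at this
      rw [show 1 + (k - 1) = k by omega] at this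
      rw [this, e3]
  have hf : ∀ k, p + 2 ≤ k → k < n → cl (vtx σ k) = false := by
    intro k hk hkn
    by_cases hk0 : k = p + 2
    · rw [hk0, pv0, hv]
    by_cases hkp : k = p + q + 3
    · rw [hkp, pv1, hv]
    · have := hσ (Sum.inr (Sum.inr ⟨k - (p + 3), by omega⟩))
      simp only [Sum.elim_inr] at this
      rw [show p + 3 + (k - (p + 3)) = k by omega] at this
      rw [this, e4]
  have t0 : tourEdge σ (1 + p) = s(u 0, v 0) := by
    rw [tourEdge, pu0, show 1 + p + 1 = p + 2 by ring, pv0]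
  have t1 : tourEdge σ (p + q + 3) = s(u 1, v 1) := by
    rw [tourEdge, pv1, show p + q + 3 + 1 = n by omega, vtx_self, pu1, Sym2.eq_swap]
  refine ⟨σ, mem_tours.2 ⟨?_, ?_⟩⟩
  · intro x hx
    obtain ⟨i, rfl⟩ := mem_pairEdges.1 hx
    fin_cases i
    · exact mem_cycEdges.2 ⟨1 + p, by omega, t0⟩
    · exact mem_cycEdges.2 ⟨p + q + 3, by omega, t1⟩
  · intro x hx
    obtain ⟨k, hk, rfl⟩ := mem_cycEdges.1 hx
    by_cases k0 : k = 1 + p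
    · subst k0
      exact mem_union_right _ (mem_pairEdges.2 ⟨0, t0.symm⟩)
    by_cases k1 : k = p + q + 3
    · subst k1
      exact mem_union_right _ (mem_pairEdges.2 ⟨1, t1.symm⟩)
    refine mem_union_left _ (hK _ _ ?_)
    by_cases hk2 : k < p + 2
    · rw [ht k hk2, ht (k + 1) (by omega)]
    · rw [hf k (by omega) hk, hf (k + 1) (by omega) (by omega)]

end HostTours

/-! ### Random matchings are spread. -/

section Matchings
variable {V : Type*} [DecidableEq V]

open Classical in
/-- The matchings with `d` edges, all of them in `𝓔`. -/
noncomputable def matchings (𝓔 : Finset (Sym2 V)) (d : ℕ) : Finset (Finset (Sym2 V)) :=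
  (𝓔.powersetCard d).filter fun M => ∀ e ∈ M, ∀ f ∈ M, ∀ v, v ∈ e → v ∈ f → e = f

omit [DecidableEq V] in
theorem mem_matchings {𝓔 : Finset (Sym2 V)} {d : ℕ} {M : Finset (Sym2 V)} :
    M ∈ matchings 𝓔 d ↔ M ⊆ 𝓔 ∧ #M = d ∧ ∀ e ∈ M, ∀ f ∈ M, ∀ v, v ∈ e → v ∈ f → e = f := by
  simp [matchings, mem_powersetCard, and_assoc]

theorem erase_mem_matchings {𝓔 : Finset (Sym2 V)} {d : ℕ} {M : Finset (Sym2 V)}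
    (hM : M ∈ matchings 𝓔 d) {e : Sym2 V} (he : e ∈ M) : M.erase e ∈ matchings 𝓔 (d - 1) := by
  rw [mem_matchings] at hM ⊢
  refine ⟨(erase_subset _ _).trans hM.1, by rw [card_erase_of_mem he, hM.2.1], ?_⟩
  intro f hf g hg
  exact hM.2.2 f (mem_of_mem_erase hf) g (mem_of_mem_erase hg)

open Classical in
/-- The edges which extend a matching. -/
noncomputable def extensions (𝓔 M : Finset (Sym2 V)) : Finset (Sym2 V) :=
  𝓔.filter fun f => ∀ e ∈ M, ∀ v, v ∈ e → v ∉ f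

omit [DecidableEq V] in
theorem mem_extensions {𝓔 M : Finset (Sym2 V)} {f : Sym2 V} :
    f ∈ extensions 𝓔 M ↔ f ∈ 𝓔 ∧ ∀ e ∈ M, ∀ v, v ∈ e → v ∉ f := by
  simp [extensions]

omit [DecidableEq V] in
theorem notMem_of_mem_extensions {𝓔 M : Finset (Sym2 V)} {f : Sym2 V} (hf : f ∈ extensions 𝓔 M) :
    f ∉ M := by
  intro h
  induction f with | _ a b =>
  exact (mem_extensions.1 hf).2 _ h a (Sym2.mem_mk_left a b) (Sym2.mem_mk_left a b)

theorem insert_mem_matchings {𝓔 : Finset (Sym2 V)} {d : ℕ} {M : Finset (Sym2 V)}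
    (hM : M ∈ matchings 𝓔 d) {f : Sym2 V} (hf : f ∈ extensions 𝓔 M) :
    insert f M ∈ matchings 𝓔 (d + 1) := by
  have hfM := notMem_of_mem_extensions hf
  rw [mem_matchings] at hM ⊢
  rw [mem_extensions] at hf
  refine ⟨insert_subset hf.1 hM.1, by rw [card_insert_of_notMem hfM, hM.2.1], ?_⟩
  intro e he g hg v hve hvg
  rcases mem_insert.1 he with rfl | he' <;> rcases mem_insert.1 hg with rfl | hg'
  · rfl
  · exact absurd hve (hf.2 g hg' v hvg)
  · exact absurd hvg (hf.2 e he' v hve)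
  · exact hM.2.2 e he' g hg' v hve hvg

/-- Each of the at most `2 * #M` vertices covered by `M` blocks at most `Δ` edges. -/
theorem card_le_card_extensions {𝓔 : Finset (Sym2 V)} {Δ : ℕ}
    (hΔ : ∀ v, #{e ∈ 𝓔 | v ∈ e} ≤ Δ) (M : Finset (Sym2 V)) :
    #𝓔 ≤ #(extensions 𝓔 M) + #M * (2 * Δ) := by
  have h1 : 𝓔 ⊆ extensions 𝓔 M ∪ M.biUnion fun e => e.toFinset.biUnion fun v => {f ∈ 𝓔 | v ∈ f} := by
    intro f hf
    by_cases h : ∀ e ∈ M, ∀ v, v ∈ e → v ∉ f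
    · exact mem_union_left _ (mem_extensions.2 ⟨hf, h⟩)
    · push Not at h
      obtain ⟨e, he, v, hv, hvf⟩ := h
      refine mem_union_right _ (mem_biUnion.2 ⟨e, he, mem_biUnion.2 ⟨v, by simpa using hv, ?_⟩⟩)
      exact mem_filter.2 ⟨hf, hvf⟩
  have h2 := (card_le_card h1).trans (card_union_le _ _)
  refine h2.trans (Nat.add_le_add_left ?_ _)
  refine card_biUnion_le_card_mul _ _ _ fun e _ => ?_
  refine (card_biUnion_le_card_mul _ _ Δ fun v _ => hΔ v).trans ?_
  refine Nat.mul_le_mul_right _ ?_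
  induction e with | _ a b =>
  have : (s(a, b)).toFinset ⊆ {a, b} := by intro x; simp
  exact (card_le_card this).trans card_le_two

theorem matchings_nonempty {𝓔 : Finset (Sym2 V)} {Δ d : ℕ} (hΔ : ∀ v, #{e ∈ 𝓔 | v ∈ e} ≤ Δ)
    (h : d ≠ 0 → (d - 1) * (2 * Δ) < #𝓔) : (matchings 𝓔 d).Nonempty := by
  induction d with
  | zero => exact ⟨∅, mem_matchings.2 (by simp)⟩
  | succ d ih =>
    have h1 := h (by omega)
    rw [Nat.add_sub_cancel] at h1
    obtain ⟨M, hM⟩ := ih (fun _ => lt_of_le_of_lt (Nat.mul_le_mul_right _ (Nat.sub_le _ _)) h1)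
    have h2 := card_le_card_extensions hΔ M
    rw [(mem_matchings.1 hM).2.1] at h2
    obtain ⟨f, hf⟩ := card_pos.1 (show 0 < #(extensions 𝓔 M) by omega)
    exact ⟨_, insert_mem_matchings hM hf⟩

/-- Switching for matchings: replace `e` by an edge `f` that extends `M.erase e`. The new matching
and the choice of `f` among its `d` edges determine `M`. -/
theorem card_matchings_superset_mul_le {𝓔 : Finset (Sym2 V)} {Δ d : ℕ}
    (hΔ : ∀ v, #{e ∈ 𝓔 | v ∈ e} ≤ Δ) {S : Finset (Sym2 V)} {e : Sym2 V} (he : e ∈ S) :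
    #{M ∈ matchings 𝓔 d | S ⊆ M} * (#𝓔 - (d - 1) * (2 * Δ)) ≤
      #{M ∈ matchings 𝓔 d | S.erase e ⊆ M} * d := by
  set P : Finset (Σ _ : Finset (Sym2 V), Sym2 V) :=
    ({M ∈ matchings 𝓔 d | S ⊆ M} : Finset _).sigma fun M => extensions 𝓔 (M.erase e) with hP
  set Q : Finset (Σ _ : Finset (Sym2 V), Sym2 V) :=
    ({M ∈ matchings 𝓔 d | S.erase e ⊆ M} : Finset _).sigma fun M => M with hQ
  have h1 : #{M ∈ matchings 𝓔 d | S ⊆ M} * (#𝓔 - (d - 1) * (2 * Δ)) ≤ #P := by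
    rw [hP, card_sigma, ← smul_eq_mul, ← Finset.sum_const]
    refine Finset.sum_le_sum fun M hM => ?_
    obtain ⟨hM1, hM2⟩ := mem_filter.1 hM
    have h2 := card_le_card_extensions hΔ (M.erase e)
    rw [(mem_matchings.1 (erase_mem_matchings hM1 (hM2 he))).2.1] at h2
    omega
  have h2 : #Q = #{M ∈ matchings 𝓔 d | S.erase e ⊆ M} * d := by
    rw [hQ, card_sigma, ← smul_eq_mul, ← Finset.sum_const]
    exact Finset.sum_congr rfl fun M hM => (mem_matchings.1 (mem_filter.1 hM).1).2.1
  refine h1.trans ((card_le_card_of_injOn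
    (fun x => (⟨insert x.2 (x.1.erase e), x.2⟩ : Σ _ : Finset (Sym2 V), Sym2 V)) ?_ ?_).trans h2.le)
  · rintro ⟨M, f⟩ hx
    rw [mem_coe, hP, mem_sigma] at hx
    obtain ⟨hM, hf⟩ := hx
    obtain ⟨hM1, hM2⟩ := mem_filter.1 hM
    have hd : d - 1 + 1 = d := by
      have := card_pos.2 ⟨e, hM2 he⟩
      rw [(mem_matchings.1 hM1).2.1] at this
      omega
    have h3 := insert_mem_matchings (erase_mem_matchings hM1 (hM2 he)) hf
    rw [hd] at h3
    rw [mem_coe, hQ, mem_sigma]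
    exact ⟨mem_filter.2 ⟨h3, (erase_subset_erase e hM2).trans (subset_insert _ _)⟩,
      mem_insert_self _ _⟩
  · rintro ⟨M, f⟩ hx ⟨M', f'⟩ hx' h
    rw [mem_coe, hP, mem_sigma] at hx hx'
    simp only [Sigma.mk.injEq, heq_eq_eq] at h ⊢
    obtain ⟨h3, rfl⟩ := h
    have e1 := notMem_of_mem_extensions hx.2
    have e2 := notMem_of_mem_extensions hx'.2
    simp only at e1 e2
    have h4 : M.erase e = M'.erase e := by
      rw [← erase_insert e1, h3, erase_insert e2]
    have h5 : e ∈ M := (mem_filter.1 hx.1).2 he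
    have h6 : e ∈ M' := (mem_filter.1 hx'.1).2 he
    refine ⟨?_, rfl⟩
    rw [← insert_erase h5, h4, insert_erase h6]

/-- A uniformly random matching of `d` edges is spread. -/
theorem card_matchings_superset_le {𝓔 : Finset (Sym2 V)} {Δ d : ℕ} {r : ℝ} (hr : 0 < r)
    (hΔ : ∀ v, #{e ∈ 𝓔 | v ∈ e} ≤ Δ) (h : r * d + (d - 1 : ℕ) * (2 * Δ) ≤ #𝓔)
    (S : Finset (Sym2 V)) :
    (#{M ∈ matchings 𝓔 d | S ⊆ M} : ℝ) ≤ (1 / r) ^ #S * #(matchings 𝓔 d) := by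
  induction S using Finset.induction_on with
  | empty => simp
  | insert e S he ih =>
    rw [card_insert_of_notMem he]
    have h1 := card_matchings_superset_mul_le (d := d) hΔ (mem_insert_self e S)
    rw [erase_insert he] at h1
    rcases Nat.eq_zero_or_pos d with rfl | hd
    · have : #{M ∈ matchings 𝓔 0 | insert e S ⊆ M} = 0 := by
        rw [card_eq_zero, filter_eq_empty_iff]
        intro M hM hsub
        have h2 := (mem_matchings.1 hM).2.1
        rw [card_eq_zero] at h2
        rw [h2] at hsub
        exact notMem_empty _ (hsub (mem_insert_self e S))
      rw [this]
      simp only [Nat.cast_zero]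
      positivity
    · have hd0 : (0 : ℝ) < d := by exact_mod_cast hd
      have h2 : (d - 1) * (2 * Δ) ≤ #𝓔 := by
        have : (((d - 1) * (2 * Δ) : ℕ) : ℝ) ≤ #𝓔 := by
          push_cast
          nlinarith [mul_pos hr hd0]
        exact_mod_cast this
      have h3 : (#{M ∈ matchings 𝓔 d | insert e S ⊆ M} : ℝ) * (#𝓔 - (d - 1 : ℕ) * (2 * Δ)) ≤
          #{M ∈ matchings 𝓔 d | S ⊆ M} * d := by
        have h4 : ((#{M ∈ matchings 𝓔 d | insert e S ⊆ M} * (#𝓔 - (d - 1) * (2 * Δ)) : ℕ) : ℝ) ≤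
          ((#{M ∈ matchings 𝓔 d | S ⊆ M} * d : ℕ) : ℝ) := Nat.cast_le.2 h1
        rw [Nat.cast_mul, Nat.cast_sub h2] at h4
        push_cast at h4
        exact h4
      have h5 : (#{M ∈ matchings 𝓔 d | insert e S ⊆ M} : ℝ) * (r * d) ≤
          #{M ∈ matchings 𝓔 d | S ⊆ M} * d := by
        refine le_trans ?_ h3
        gcongr
        linarith
      have h6 : (#{M ∈ matchings 𝓔 d | insert e S ⊆ M} : ℝ) * r ≤ #{M ∈ matchings 𝓔 d | S ⊆ M} := by
        nlinarith
      calc (#{M ∈ matchings 𝓔 d | insert e S ⊆ M} : ℝ)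
          ≤ #{M ∈ matchings 𝓔 d | S ⊆ M} / r := by rw [le_div_iff₀ hr]; exact h6
        _ ≤ ((1 / r) ^ #S * #(matchings 𝓔 d)) / r := by gcongr
        _ = _ := by rw [pow_succ]; ring

/-- The pairs of a matching, listed and oriented. -/
theorem exists_isPairing_of_mem_matchings {𝓔 : Finset (Sym2 V)} {d : ℕ} {M : Finset (Sym2 V)}
    (hdiag : ∀ v, s(v, v) ∉ 𝓔) (hM : M ∈ matchings 𝓔 d) :
    ∃ u v : Fin d → V, IsPairing u v ∧ pairEdges u v = M := by
  obtain ⟨h1, h2, h3⟩ := mem_matchings.1 hM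
  obtain ⟨e⟩ : Nonempty (Fin d ≃ M) := ⟨(M.equivFinOfCardEq h2).symm⟩
  have hout : ∀ i, ∃ x : V × V, s(x.1, x.2) = (e i : Sym2 V) := by
    intro i
    induction h : (e i : Sym2 V) with | _ a b =>
    exact ⟨(a, b), rfl⟩
  choose x hx using hout
  have key : ∀ i j w, w ∈ s((x i).1, (x i).2) → w ∈ s((x j).1, (x j).2) → i = j := by
    intro i j w hi hj
    rw [hx] at hi hj
    exact e.injective (Subtype.ext (h3 _ (e i).2 _ (e j).2 w hi hj))
  refine ⟨fun i => (x i).1, fun i => (x i).2, ⟨?_, ?_, ?_⟩, ?_⟩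
  · intro i j hij
    refine key i j (x i).1 (Sym2.mem_mk_left _ _) ?_
    beta_reduce at hij
    rw [hij]
    exact Sym2.mem_mk_left _ _
  · intro i j hij
    refine key i j (x i).2 (Sym2.mem_mk_right _ _) ?_
    beta_reduce at hij
    rw [hij]
    exact Sym2.mem_mk_right _ _
  · intro i j hij
    have : i = j := key i j (x i).1 (Sym2.mem_mk_left _ _) (by rw [hij]; exact Sym2.mem_mk_right _ _)
    subst this
    have h4 := h1 (e i).2
    rw [← hx i, hij] at h4
    exact hdiag _ h4
  · ext f
    rw [mem_pairEdges]
    constructor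
    · rintro ⟨i, rfl⟩
      rw [hx]
      exact (e i).2
    · intro hf
      refine ⟨e.symm ⟨f, hf⟩, ?_⟩
      rw [hx, Equiv.apply_symm_apply]

end Matchings

/-! ### Two random edges are spread. -/

section TwoEdges
variable {V : Type*} [DecidableEq V] [Fintype V]

/-- The edges `e₁ p ∋ p.1` and `e₂ p ∋ p.2`, for a random pair `p`, are spread. -/
theorem card_filter_subset_two_edges_le (T : Finset (V × V)) (e₁ e₂ : V × V → Sym2 V)
    (h₁ : ∀ p ∈ T, p.1 ∈ e₁ p) (h₂ : ∀ p ∈ T, p.2 ∈ e₂ p) {r : ℝ} (hr : 0 < r) (hr2 : r ≤ 2)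
    (hT : r * (Fintype.card V : ℝ) ^ 2 ≤ #T) (S : Finset (Sym2 V)) :
    (#{p ∈ T | S ⊆ {e₁ p, e₂ p}} : ℝ) ≤ (4 / r / Fintype.card V) ^ #S * #T := by
  rcases T.eq_empty_or_nonempty with rfl | ⟨p₀, hp₀⟩
  · simp
  have hn0 : (0 : ℝ) < Fintype.card V := by
    have : 0 < Fintype.card V := Fintype.card_pos_iff.2 ⟨p₀.1⟩
    exact_mod_cast this
  have hcard : ∀ e : Sym2 V, #(e.toFinset) ≤ 2 := by
    intro e
    induction e with | _ a b =>
    have : (s(a, b)).toFinset ⊆ {a, b} := by intro x; simp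
    exact (card_le_card this).trans card_le_two
  by_cases hS3 : 3 ≤ #S
  · have : #{p ∈ T | S ⊆ {e₁ p, e₂ p}} = 0 := by
      rw [card_eq_zero, filter_eq_empty_iff]
      intro p _ hS
      have := (card_le_card hS).trans card_le_two
      omega
    rw [this]
    simp only [Nat.cast_zero]
    positivity
  obtain h | h | h : #S = 0 ∨ #S = 1 ∨ #S = 2 := by omega
  · rw [h]
    simp only [pow_zero, one_mul]
    exact_mod_cast card_filter_le _ _
  · rw [h, pow_one]
    obtain ⟨e, rfl⟩ := card_eq_one.1 h
    have h3 : ({p ∈ T | {e} ⊆ ({e₁ p, e₂ p} : Finset (Sym2 V))} : Finset _) ⊆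
        e.toFinset ×ˢ univ ∪ univ ×ˢ e.toFinset := by
      intro p hp
      obtain ⟨hp1, hp2⟩ := mem_filter.1 hp
      rw [singleton_subset_iff, mem_insert, mem_singleton] at hp2
      rcases hp2 with rfl | rfl
      · exact mem_union_left _ (mem_product.2 ⟨by simpa using h₁ p hp1, mem_univ _⟩)
      · exact mem_union_right _ (mem_product.2 ⟨mem_univ _, by simpa using h₂ p hp1⟩)
    have h4 := (card_le_card h3).trans (card_union_le _ _)
    rw [card_product, card_product, card_univ] at h4
    have h5 := hcard e
    have h6 : #{p ∈ T | {e} ⊆ ({e₁ p, e₂ p} : Finset (Sym2 V))} ≤ 4 * Fintype.card V := by nlinarith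
    have h7 : (#{p ∈ T | {e} ⊆ ({e₁ p, e₂ p} : Finset (Sym2 V))} : ℝ) ≤ 4 * Fintype.card V := by
      exact_mod_cast h6
    refine h7.trans ?_
    calc (4 * Fintype.card V : ℝ) = 4 / r / Fintype.card V * (r * (Fintype.card V : ℝ) ^ 2) := by
          field_simp
      _ ≤ _ := by gcongr
  · rw [h]
    obtain ⟨e, f, hef, rfl⟩ := card_eq_two.1 h
    have h3 : ({p ∈ T | {e, f} ⊆ ({e₁ p, e₂ p} : Finset (Sym2 V))} : Finset _) ⊆
        e.toFinset ×ˢ f.toFinset ∪ f.toFinset ×ˢ e.toFinset := by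
      intro p hp
      obtain ⟨hp1, hp2⟩ := mem_filter.1 hp
      have k1 := h₁ p hp1
      have k2 := h₂ p hp1
      rw [insert_subset_iff, singleton_subset_iff, mem_insert, mem_singleton, mem_insert,
        mem_singleton] at hp2
      rw [mem_union, mem_product, mem_product, Sym2.mem_toFinset, Sym2.mem_toFinset,
        Sym2.mem_toFinset, Sym2.mem_toFinset]
      rcases hp2 with ⟨ha | ha, hb | hb⟩
      · exact absurd (ha.trans hb.symm) hef
      · rw [ha, hb]; exact Or.inl ⟨k1, k2⟩
      · rw [ha, hb]; exact Or.inr ⟨k1, k2⟩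
      · exact absurd (ha.trans hb.symm) hef
    have h4 := (card_le_card h3).trans (card_union_le _ _)
    rw [card_product, card_product] at h4
    have h5 := hcard e
    have h5' := hcard f
    have h6 : #{p ∈ T | {e, f} ⊆ ({e₁ p, e₂ p} : Finset (Sym2 V))} ≤ 8 := by nlinarith
    have h7 : (#{p ∈ T | {e, f} ⊆ ({e₁ p, e₂ p} : Finset (Sym2 V))} : ℝ) ≤ 8 := by exact_mod_cast h6
    refine h7.trans ?_
    calc (8 : ℝ) ≤ 16 / r := by rw [le_div_iff₀ hr]; linarith
      _ = (4 / r / Fintype.card V) ^ 2 * (r * (Fintype.card V : ℝ) ^ 2) := by field_simp; norm_num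
      _ ≤ _ := by gcongr

end TwoEdges

/-! ### The extremal case of two nearly complete classes. -/

section Classes
variable {V : Type*} [Fintype V] [DecidableEq V] {n : ℕ} [NeZero n]

/-- The pairs of vertices in the same class. -/
def sameClass (cl : V → Bool) : Finset (Sym2 V) :=
  ({p : V × V | cl p.1 = cl p.2} : Finset (V × V)).image fun p => s(p.1, p.2)

/-- The pairs of vertices in different classes. -/
def crossClass (cl : V → Bool) : Finset (Sym2 V) :=
  ({p : V × V | cl p.1 ≠ cl p.2} : Finset (V × V)).image fun p => s(p.1, p.2)

theorem mem_sameClass {cl : V → Bool} {x y : V} : s(x, y) ∈ sameClass cl ↔ cl x = cl y := by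
  simp only [sameClass, mem_image, mem_filter, mem_univ, true_and, Prod.exists]
  constructor
  · rintro ⟨a, b, h, hab⟩
    rcases Sym2.eq_iff.1 hab with ⟨rfl, rfl⟩ | ⟨rfl, rfl⟩
    exacts [h, h.symm]
  · exact fun h => ⟨x, y, h, rfl⟩

theorem mem_crossClass {cl : V → Bool} {x y : V} : s(x, y) ∈ crossClass cl ↔ cl x ≠ cl y := by
  simp only [crossClass, mem_image, mem_filter, mem_univ, true_and, Prod.exists]
  constructor
  · rintro ⟨a, b, h, hab⟩
    rcases Sym2.eq_iff.1 hab with ⟨rfl, rfl⟩ | ⟨rfl, rfl⟩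
    exacts [h, h.symm]
  · exact fun h => ⟨x, y, h, rfl⟩

/-- The rate of spread of the Hamilton cycles of a graph which is nearly complete in its host. -/
noncomputable def nearCompleteRate (γ : ℝ) : ℝ := spreadConst (γ / 8) (γ ^ 2 * γ / 8) 24

/-- Random Hamilton cycles through random pairs, in a graph that is nearly complete within a host
which is a union of classes or a complete bipartite graph between classes. -/
theorem hasSpread_of_pairings {Ω : Type*} (hcard : Fintype.card V = n) (cl : V → Bool)
    {A K : Finset (Sym2 V)} {X : Finset V} {γ q : ℝ} (hγ : 0 < γ) (hn : 8 ≤ γ * n) (hn3 : 3 ≤ n)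
    (hK : ∀ x y z w, s(x, y) ∈ K → s(y, z) ∈ K → s(z, w) ∈ K → s(x, w) ∈ K)
    (hKcl : ∀ x y x' y', cl x = cl x' → cl y = cl y' → s(x, y) ∈ K → s(x', y') ∈ K)
    (hA : ∀ v, γ * n ≤ #(nbrs (A ∩ K) v)) (hX : (#X : ℝ) ≤ γ / 8 * n)
    (hXA : ∀ v, v ∉ X → (#(nbrs (K \ A) v) : ℝ) ≤ γ / 8 * n)
    (T : Finset Ω) (hT : T.Nonempty) (F : Ω → Finset (Sym2 V))
    (hF : ∀ S, (#{ω ∈ T | S ⊆ F ω} : ℝ) ≤ (q / n) ^ #S * #T)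
    (hpair : ∀ ω ∈ T, ∃ (d : ℕ) (u v : Fin d → V), IsPairing u v ∧ pairEdges u v = F ω ∧
      (∀ i j, cl (u i) = cl (u j)) ∧ (∀ i j, cl (v i) = cl (v j)) ∧ F ω ⊆ A ∧
      (d : ℝ) ≤ γ / 16 * n ∧ (tours n (F ω) (K ∪ F ω)).Nonempty) :
    HasSpread ((q + nearCompleteRate γ) / n) (hamCycles n A) ∅ := by
  have h0 : (0 : ℝ) < n := by exact_mod_cast NeZero.pos n
  have hrate : 0 ≤ nearCompleteRate γ / n := by
    unfold nearCompleteRate spreadConst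
    positivity
  rw [add_div]
  refine hasSpread_mix hrate T hT F hF fun ω hω => ?_
  obtain ⟨d, u, v, h, hF', hu, hv, hFA, hd, hne⟩ := hpair ω hω
  have hflex : Flexible n (A ∩ K) K (F ω) (γ / 8) (γ ^ 2 * γ / 8) := by
    refine flexible_of_nearComplete (X := X) (δ := γ / 8) hn3 hγ hγ inter_subset_right hK hA
      (fun v => (hA v).trans ?_) hX (fun v hv => ?_) (by nlinarith) (by nlinarith)
    · refine Nat.cast_le.2 (card_le_card fun w hw => ?_)
      rw [mem_nbrs] at hw ⊢
      exact (mem_inter.1 hw).2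
    · have : K \ (A ∩ K) = K \ A := by ext e; simp
      rw [this]
      exact hXA v hv
  refine hflex.hasSpread hn3 (by positivity) (by positivity) (by norm_num) inter_subset_right ?_ ?_
    hne (union_subset inter_subset_left hFA)
  · rw [← hF', h.card_pairEdges]
    linarith
  · rw [← hF'] at hne ⊢
    exact_mod_cast card_tours_pairEdges_univ_le h hn3 hcard hu hv hKcl hne

theorem card_nbrs_eq_card_filter_mem {𝓔 : Finset (Sym2 V)} (v : V) :
    #{e ∈ 𝓔 | v ∈ e} = #(nbrs 𝓔 v) := by
  symm
  refine card_bij (fun w _ => s(v, w)) ?_ ?_ ?_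
  · intro w hw
    exact mem_filter.2 ⟨mem_nbrs.1 hw, Sym2.mem_mk_left _ _⟩
  · intro w _ w' _ h
    rcases Sym2.eq_iff.1 h with ⟨_, h⟩ | ⟨h1, h2⟩
    exacts [h, h2.trans h1]
  · intro e he
    obtain ⟨h1, h2⟩ := mem_filter.1 he
    obtain ⟨w, rfl⟩ := Sym2.mem_iff_exists.1 h2
    exact ⟨w, mem_nbrs.2 h1, rfl⟩

theorem sum_card_nbrs_le (𝓔 : Finset (Sym2 V)) : ∑ v, #(nbrs 𝓔 v) ≤ 2 * #𝓔 := by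
  simp_rw [← card_nbrs_eq_card_filter_mem]
  calc ∑ v, #{e ∈ 𝓔 | v ∈ e} = ∑ e ∈ 𝓔, #{v : V | v ∈ e} := by
        simp_rw [card_filter]
        rw [Finset.sum_comm]
    _ ≤ ∑ e ∈ 𝓔, 2 := by
        refine Finset.sum_le_sum fun e _ => ?_
        induction e with | _ a b =>
        have : ({v : V | v ∈ s(a, b)} : Finset V) ⊆ {a, b} := by intro x; simp
        exact (card_le_card this).trans card_le_two
    _ = 2 * #𝓔 := by rw [Finset.sum_const, smul_eq_mul, mul_comm]

/-- The vertices of a class. -/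
def classOf (cl : V → Bool) (b : Bool) : Finset V := univ.filter fun v => cl v = b

omit [DecidableEq V] in
@[simp] theorem mem_classOf {cl : V → Bool} {b : Bool} {v : V} : v ∈ classOf cl b ↔ cl v = b := by
  simp [classOf]

omit [DecidableEq V] in
theorem card_classOf_add (cl : V → Bool) (b : Bool) :
    #(classOf cl b) + #(classOf cl !b) = Fintype.card V := by
  rw [← card_univ, ← card_filter_add_card_filter_not (s := univ) fun v => cl v = b]
  congr 2
  ext v
  simp only [mem_classOf, mem_filter, mem_univ, true_and]
  cases cl v <;> cases b <;> simp

/-- The case of two nearly complete classes. -/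
theorem hasSpread_of_sameClass (hcard : Fintype.card V = n) (cl : V → Bool) {A : Finset (Sym2 V)}
    (hdiag : ∀ v, s(v, v) ∉ A) (hdeg : ∀ v, n ≤ 2 * #(nbrs A v)) {X : Finset V} {γ : ℝ} (hγ : 0 < γ)
    (hγ2 : γ ≤ 1 / 2) (hn : 32 ≤ γ * n) (hcls : ∀ b, γ * n ≤ #(classOf cl b))
    (hA : ∀ v, γ * n ≤ #(nbrs (A ∩ sameClass cl) v)) (hX : (#X : ℝ) ≤ γ / 8 * n)
    (hXA : ∀ v, v ∉ X → (#(nbrs (sameClass cl \ A) v) : ℝ) ≤ γ / 8 * n) :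
    HasSpread ((8 / γ ^ 2 + nearCompleteRate γ) / n) (hamCycles n A) ∅ := by
  wlog hab : #(classOf cl true) ≤ #(classOf cl false) generalizing cl
  · have hs : sameClass (fun v => !cl v) = sameClass cl := by
      ext e
      induction e with | _ a b =>
      simp [mem_sameClass]
    have hc : ∀ b, classOf (fun v => !cl v) b = classOf cl !b := by
      intro b
      ext v
      simp only [mem_classOf]
      cases cl v <;> cases b <;> simp
    refine this (fun v => !cl v) (fun b => ?_) ?_ ?_ ?_
    · rw [hc]; exact hcls _
    · rw [hs]; exact hA
    · rw [hs]; exact hXA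
    · rw [hc, hc]
      exact (not_le.1 hab).le
  have hn0 : (0 : ℝ) < n := by exact_mod_cast NeZero.pos n
  have hn64 : (64 : ℝ) ≤ n := by nlinarith
  have hn3 : 3 ≤ n := by
    have : (3 : ℝ) ≤ n := by linarith
    exact_mod_cast this
  have hsum := card_classOf_add cl true
  rw [hcard, Bool.not_true] at hsum
  -- every vertex has at least `n / 2 + 1 - (size of its class)` neighbours in the other class
  have hcross : ∀ v, n + 2 ≤ 2 * #(nbrs A v \ classOf cl (cl v)) + 2 * #(classOf cl (cl v)) := by
    intro v
    have h1 := hdeg v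
    have h2 : nbrs A v ∩ classOf cl (cl v) ⊆ (classOf cl (cl v)).erase v := by
      intro w hw
      obtain ⟨h3, h4⟩ := mem_inter.1 hw
      refine mem_erase.2 ⟨?_, h4⟩
      rintro rfl
      exact hdiag _ (mem_nbrs.1 h3)
    have h3 := card_le_card h2
    have hv : v ∈ classOf cl (cl v) := mem_classOf.2 rfl
    have h4 := card_pos.2 ⟨v, hv⟩
    rw [card_erase_of_mem hv] at h3
    have h5 := card_sdiff_add_card_inter (nbrs A v) (classOf cl (cl v))
    omega
  have hmem : ∀ v w, w ∈ nbrs A v \ classOf cl (cl v) ↔ s(v, w) ∈ A ∧ cl w ≠ cl v := by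
    intro v w
    rw [mem_sdiff, mem_nbrs, mem_classOf]
  have hr : 4 / (γ ^ 2 / 2) = 8 / γ ^ 2 := by field_simp; norm_num
  -- It suffices to attach to quadratically many pairs of vertices two disjoint crossing edges, one
  -- at each vertex of the pair.
  have hmain : ∀ (T : Finset (V × V)) (u v : V × V → Fin 2 → V),
      (γ ^ 2 / 2 * (Fintype.card V : ℝ) ^ 2 ≤ #T) →
      (∀ p ∈ T, p.1 ∈ s(u p 0, v p 0)) → (∀ p ∈ T, p.2 ∈ s(u p 1, v p 1)) →
      (∀ p ∈ T, ∀ i, cl (u p i) = true ∧ cl (v p i) = false ∧ s(u p i, v p i) ∈ A) →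
      (∀ p ∈ T, u p 0 ≠ u p 1 ∧ v p 0 ≠ v p 1) →
      HasSpread ((8 / γ ^ 2 + nearCompleteRate γ) / n) (hamCycles n A) ∅ := by
    intro T u v hT h₁ h₂ hcl hne
    have hT0 : T.Nonempty := by
      rw [← card_pos]
      rw [hcard] at hT
      have : (0 : ℝ) < #T := lt_of_lt_of_le (by positivity) hT
      exact_mod_cast this
    have hpe : ∀ p, pairEdges (u p) (v p) = {s(u p 0, v p 0), s(u p 1, v p 1)} := by
      intro p
      ext e
      rw [mem_pairEdges, Fin.exists_fin_two, mem_insert, mem_singleton, eq_comm, @eq_comm _ e]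
      tauto
    refine hasSpread_of_pairings hcard cl (K := sameClass cl) (X := X) hγ (by linarith) hn3 ?_ ?_
      hA hX hXA T hT0 (fun p => pairEdges (u p) (v p)) ?_ ?_
    · intro x y z w
      rw [mem_sameClass, mem_sameClass, mem_sameClass, mem_sameClass]
      exact fun h1 h2 h3 => h1.trans (h2.trans h3)
    · intro x y x' y' h1 h2
      rw [mem_sameClass, mem_sameClass, h1, h2]
      exact id
    · intro S
      simp_rw [hpe]
      have := card_filter_subset_two_edges_le T (fun p => s(u p 0, v p 0))
        (fun p => s(u p 1, v p 1)) h₁ h₂ (r := γ ^ 2 / 2) (by positivity) (by nlinarith) hT S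
      rwa [hr, hcard] at this
    · intro p hp
      have h := hcl p hp
      have hP : IsPairing (u p) (v p) := by
        refine ⟨?_, ?_, ?_⟩
        · intro i j hij
          fin_cases i <;> fin_cases j
          · rfl
          · exact absurd hij (hne p hp).1
          · exact absurd hij.symm (hne p hp).1
          · rfl
        · intro i j hij
          fin_cases i <;> fin_cases j
          · rfl
          · exact absurd hij (hne p hp).2
          · exact absurd hij.symm (hne p hp).2
          · rfl
        · intro i j hij
          have h1 := (h i).1
          rw [hij, (h j).2.1] at h1
          exact absurd h1 (by simp)
      refine ⟨2, u p, v p, hP, rfl, fun i j => (h i).1.trans (h j).1.symm,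
        fun i j => (h i).2.1.trans (h j).2.1.symm, ?_, by push_cast; linarith, ?_⟩
      · intro e he
        obtain ⟨i, rfl⟩ := mem_pairEdges.1 he
        exact (h i).2.2
      · exact nonempty_tours_of_two_pairs hcard cl hP (fun i => (h i).1) (fun i => (h i).2.1)
          fun x y hxy => mem_sameClass.2 hxy
  have hγn : γ * n * (γ * n) ≤ #(classOf cl true) * #(classOf cl true) := by
    have := hcls true
    gcongr
  rcases hab.eq_or_lt with hab | hab
  -- Equal classes: every vertex has a crossing neighbour `f v`. One vertex is taken from each
  -- class, so that the edges are anchored on opposite sides; the at most `n` pairs where they would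
  -- meet are excluded.
  · have hex : ∀ v, ∃ w, s(v, w) ∈ A ∧ cl w ≠ cl v := by
      intro v
      have h1 := hcross v
      have h2 : 2 * #(classOf cl (cl v)) ≤ n := by cases cl v <;> omega
      obtain ⟨w, hw⟩ := card_pos.1 (show 0 < #(nbrs A v \ classOf cl (cl v)) by omega)
      exact ⟨w, (hmem v w).1 hw⟩
    choose f hf1 hf2 using hex
    refine hmain ({p ∈ classOf cl true ×ˢ classOf cl false | p.1 ≠ f p.2 ∧ f p.1 ≠ p.2})
      (fun p => ![p.1, f p.2]) (fun p => ![f p.1, p.2]) ?_ (fun p _ => by simp) (fun p _ => by simp)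
      ?_ ?_
    · have h1 : classOf cl true ×ˢ classOf cl false ⊆
          ({p ∈ classOf cl true ×ˢ classOf cl false | p.1 ≠ f p.2 ∧ f p.1 ≠ p.2}) ∪
          ((classOf cl false).image (fun y => (f y, y)) ∪
            (classOf cl true).image (fun x => (x, f x))) := by
        rintro ⟨x, y⟩ hp
        obtain ⟨hx, hy⟩ := mem_product.1 hp
        by_cases h1 : x = f y
        · exact mem_union_right _ (mem_union_left _ (mem_image.2 ⟨y, hy, by rw [h1]⟩))
        by_cases h2 : f x = y
        · exact mem_union_right _ (mem_union_right _ (mem_image.2 ⟨x, hx, by rw [h2]⟩))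
        · exact mem_union_left _ (mem_filter.2 ⟨hp, h1, h2⟩)
      have h2 := (card_le_card h1).trans (card_union_le _ _)
      have h3 := (card_union_le ((classOf cl false).image (fun y => (f y, y)))
            ((classOf cl true).image (fun x => (x, f x)))).trans
            (Nat.add_le_add card_image_le card_image_le)
      rw [card_product] at h2
      obtain ⟨t, ht⟩ : ∃ t, t = #({p ∈ classOf cl true ×ˢ classOf cl false |
        p.1 ≠ f p.2 ∧ f p.1 ≠ p.2}) := ⟨_, rfl⟩
      rw [← ht] at h2 ⊢
      have h4 : #(classOf cl true) * #(classOf cl false) ≤ t + n := by omega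
      have h5 : (#(classOf cl true) * #(classOf cl false) : ℝ) ≤ t + n := by exact_mod_cast h4
      have h6 : (2 * #(classOf cl true) : ℝ) = n := by
        have : 2 * #(classOf cl true) = n := by omega
        exact_mod_cast this
      rw [← hab] at h5
      rw [hcard]
      nlinarith
    · intro p hp i
      obtain ⟨hp1, hp2⟩ := mem_filter.1 hp
      rw [mem_product, mem_classOf, mem_classOf] at hp1
      have k1 := hf2 p.1
      have k2 := hf2 p.2
      rw [hp1.1] at k1
      rw [hp1.2] at k2
      fin_cases i
      · exact ⟨hp1.1, by simpa using k1, hf1 _⟩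
      · refine ⟨by simpa using k2, hp1.2, ?_⟩
        have := hf1 p.2
        rw [Sym2.eq_swap] at this
        exact this
    · intro p hp
      exact (mem_filter.1 hp).2
  -- Unequal classes: every vertex of the smaller class has at least two crossing neighbours. Both
  -- anchors are taken there, and the second neighbour avoids the first.
  · have hex : ∀ v y, cl v = true → ∃ w, s(v, w) ∈ A ∧ cl w = false ∧ w ≠ y := by
      intro v y hv
      have h1 := hcross v
      rw [hv] at h1
      obtain ⟨w, hw⟩ := card_pos.1 (show 0 < #((nbrs A v \ classOf cl true).erase y) by
        have := pred_card_le_card_erase (s := nbrs A v \ classOf cl true) (a := y)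
        omega)
      have h2 := mem_erase.1 hw
      rw [← hv, hmem] at h2
      refine ⟨w, h2.2.1, ?_, h2.1⟩
      have := h2.2.2
      rw [hv] at this
      simpa using this
    choose! g hg1 hg2 hg3 using hex
    refine hmain ((classOf cl true).offDiag) (fun p => ![p.1, p.2])
      (fun p => ![g p.1 p.1, g p.2 (g p.1 p.1)]) ?_ (fun p _ => by simp) (fun p _ => by simp) ?_ ?_
    · rw [offDiag_card, hcard, Nat.cast_sub (Nat.le_mul_self _)]
      push_cast
      have := hcls true
      nlinarith
    · intro p hp i
      obtain ⟨hp1, hp2, hp3⟩ := mem_offDiag.1 hp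
      rw [mem_classOf] at hp1 hp2
      fin_cases i
      · exact ⟨hp1, hg2 _ _ hp1, hg1 _ _ hp1⟩
      · exact ⟨hp2, hg2 _ _ hp2, hg1 _ _ hp2⟩
    · intro p hp
      obtain ⟨hp1, hp2, hp3⟩ := mem_offDiag.1 hp
      rw [mem_classOf] at hp1 hp2
      exact ⟨hp3, (hg3 p.2 (g p.1 p.1) hp2).symm⟩

end Classes

/-! ### The extremal case of a nearly complete bipartite graph. -/

section Bipartite
variable {V : Type*} [Fintype V] [DecidableEq V] {n : ℕ} [NeZero n]

/-- The case of a nearly complete bipartite graph between two classes. -/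
theorem hasSpread_of_crossClass (hcard : Fintype.card V = n) (cl : V → Bool) {A : Finset (Sym2 V)}
    (hdiag : ∀ v, s(v, v) ∉ A) (hdeg : ∀ v, n ≤ 2 * #(nbrs A v)) {X : Finset V} {γ : ℝ} (hγ : 0 < γ)
    (hn : 16 ≤ γ * n) (hn3 : 3 ≤ n) {d : ℕ} (hd : #(classOf cl true) = #(classOf cl false) + d)
    (hdγ : (d : ℝ) ≤ γ / 16 * n)
    (hsparse : d ≤ 1 ∨ ∀ v, cl v = true → 32 * #(nbrs A v ∩ classOf cl true) ≤ n)
    (hA : ∀ v, γ * n ≤ #(nbrs (A ∩ crossClass cl) v)) (hX : (#X : ℝ) ≤ γ / 8 * n)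
    (hXA : ∀ v, v ∉ X → (#(nbrs (crossClass cl \ A) v) : ℝ) ≤ γ / 8 * n) :
    HasSpread ((16 + nearCompleteRate γ) / n) (hamCycles n A) ∅ := by
  have hn0 : (0 : ℝ) < n := by exact_mod_cast NeZero.pos n
  have hsum := card_classOf_add cl true
  rw [hcard, Bool.not_true] at hsum
  set 𝓔 : Finset (Sym2 V) := A.filter fun e => ∀ v ∈ e, cl v = true with h𝓔
  have hnb : ∀ v, cl v = true → nbrs 𝓔 v = nbrs A v ∩ classOf cl true := by
    intro v hv
    ext w
    rw [mem_nbrs, h𝓔, mem_filter, mem_inter, mem_nbrs, mem_classOf]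
    simp [hv]
  have hnb' : ∀ v, cl v ≠ true → nbrs 𝓔 v = ∅ := by
    intro v hv
    rw [eq_empty_iff_forall_notMem]
    intro w hw
    rw [mem_nbrs, h𝓔, mem_filter] at hw
    exact hv (hw.2 v (Sym2.mem_mk_left _ _))
  -- A vertex of the larger class has at most `#(classOf cl false)` neighbours across, so at least
  -- `d / 2` inside its own class, which contains at least half of all vertices.
  have hcardE : n * d ≤ 8 * #𝓔 := by
    have h1 : ∀ v ∈ classOf cl true, d ≤ 2 * #(nbrs 𝓔 v) := by
      intro v hv
      rw [mem_classOf] at hv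
      rw [hnb v hv]
      have h2 := hdeg v
      have h3 := card_sdiff_add_card_inter (nbrs A v) (classOf cl true)
      have h4 : #(nbrs A v \ classOf cl true) ≤ #(classOf cl false) := by
        refine card_le_card fun w hw => ?_
        rw [mem_sdiff, mem_classOf] at hw
        rw [mem_classOf]
        simpa using hw.2
      omega
    have h2 : #(classOf cl true) * d ≤ ∑ v, 2 * #(nbrs 𝓔 v) := by
      rw [← smul_eq_mul, ← Finset.sum_const]
      exact (Finset.sum_le_sum h1).trans (Finset.sum_le_sum_of_subset (subset_univ _))
    rw [← Finset.mul_sum] at h2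
    have h3 := sum_card_nbrs_le 𝓔
    have h4 : n * d ≤ 2 * #(classOf cl true) * d := Nat.mul_le_mul_right _ (by omega)
    nlinarith
  -- For `d ≤ 1` no bound on the degree is needed, because its coefficient `d - 1` vanishes.
  -- Otherwise sparsity gives `Δ = n / 32`.
  obtain ⟨Δ, hΔ1, hΔ2⟩ : ∃ Δ : ℕ, (∀ v, #{e ∈ 𝓔 | v ∈ e} ≤ Δ) ∧ (d ≤ 1 ∨ 32 * Δ ≤ n) := by
    rcases hsparse with h | h
    · exact ⟨#𝓔, fun v => card_filter_le _ _, Or.inl h⟩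
    · refine ⟨n / 32, fun v => ?_, Or.inr (Nat.mul_div_le _ _)⟩
      rw [card_nbrs_eq_card_filter_mem]
      by_cases hv : cl v = true
      · rw [hnb v hv]
        have := h v hv
        omega
      · rw [hnb' v hv]
        simp
  have hsmall : (n / 16 : ℝ) * d + (d - 1 : ℕ) * (2 * Δ) ≤ #𝓔 := by
    have h1 : (n * d : ℝ) ≤ 8 * #𝓔 := by exact_mod_cast hcardE
    rcases hΔ2 with h | h
    · rw [show d - 1 = 0 by omega]
      simp only [Nat.cast_zero, zero_mul, add_zero]
      nlinarith
    · have h2 : (32 * Δ : ℝ) ≤ n := by exact_mod_cast h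
      have h3 : ((d - 1 : ℕ) : ℝ) ≤ d := by exact_mod_cast Nat.sub_le _ _
      have h4 : ((d - 1 : ℕ) : ℝ) * (2 * Δ) ≤ d * (n / 16) := by
        gcongr
        linarith
      linarith
  have hne : (matchings 𝓔 d).Nonempty := by
    refine matchings_nonempty hΔ1 fun hd0 => ?_
    have h1 : (1 : ℝ) ≤ d := by exact_mod_cast Nat.one_le_iff_ne_zero.2 hd0
    have h2 : (((d - 1) * (2 * Δ) : ℕ) : ℝ) < #𝓔 := by
      push_cast
      nlinarith
    exact_mod_cast h2
  have hdiag' : ∀ v, s(v, v) ∉ 𝓔 := fun v h => hdiag v (filter_subset _ _ h)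
  refine hasSpread_of_pairings hcard cl (K := crossClass cl) (X := X) hγ (by linarith) hn3 ?_ ?_
      hA hX hXA (matchings 𝓔 d) hne id ?_ ?_
  · intro x y z w
    rw [mem_crossClass, mem_crossClass, mem_crossClass, mem_crossClass]
    cases cl x <;> cases cl y <;> cases cl z <;> cases cl w <;> simp
  · intro x y x' y' h1 h2
    rw [mem_crossClass, mem_crossClass, h1, h2]
    exact id
  · intro S
    have := card_matchings_superset_le (d := d) (r := n / 16) (by positivity) hΔ1 hsmall S
    rwa [one_div_div] at this
  · intro M hM
    obtain ⟨u, v, hP, hPM⟩ := exists_isPairing_of_mem_matchings hdiag' hM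
    have hcl : ∀ i, cl (u i) = true ∧ cl (v i) = true := by
      intro i
      have h1 : s(u i, v i) ∈ 𝓔 := by
        refine (mem_matchings.1 hM).1 ?_
        rw [← hPM]
        exact mem_pairEdges.2 ⟨i, rfl⟩
      have h2 := (mem_filter.1 h1).2
      exact ⟨h2 _ (Sym2.mem_mk_left _ _), h2 _ (Sym2.mem_mk_right _ _)⟩
    refine ⟨d, u, v, hP, hPM, fun i j => (hcl i).1.trans (hcl j).1.symm,
      fun i j => (hcl i).2.trans (hcl j).2.symm, (mem_matchings.1 hM).1.trans (filter_subset _ _),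
      hdγ, ?_⟩
    rw [id, ← hPM]
    refine nonempty_tours_of_alternating hcard cl hP (fun i => (hcl i).1) (fun i => (hcl i).2) ?_
      fun x y hxy => mem_crossClass.2 hxy
    have h1 := hP.card_eq cl
    have h2 : unpaired cl u v false = classOf cl false := by
      ext w
      rw [mem_unpaired, mem_classOf]
      refine ⟨fun h => h.1, fun h => ⟨h, fun i hi => ?_, fun i hi => ?_⟩⟩
      · rw [← hi, (hcl i).1] at h
        exact absurd h (by simp)
      · rw [← hi, (hcl i).2] at h
        exact absurd h (by simp)
    rw [h2] at h1 ⊢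
    omega

end Bipartite

/-! ### From near extremality to clean classes, and the spread measure on Hamilton cycles. -/

section Structure
variable {V : Type*} [Fintype V] [DecidableEq V] {n : ℕ} [NeZero n]

omit [Fintype V] [DecidableEq V] in
theorem sum_card_filter_comm (P : Sym2 V → Prop) [DecidablePred P]
    (X Y : Finset V) :
    ∑ x ∈ X, #{y ∈ Y | P s(x, y)} = ∑ y ∈ Y, #{x ∈ X | P s(y, x)} := by
  simp_rw [card_filter]
  rw [Finset.sum_comm]
  refine Finset.sum_congr rfl fun y _ => Finset.sum_congr rfl fun x _ => ?_
  rw [Sym2.eq_swap]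

/-- In a nearly extremal graph of minimum degree at least `n / 2` there are two classes such that
few pairs inside the classes, or few pairs between the classes, are missing. -/
theorem NearExtremal.exists_classes {A : Finset (Sym2 V)} {β : ℝ} (h : NearExtremal A β)
    (hdeg : ∀ v, Fintype.card V ≤ 2 * #(nbrs A v)) : ∃ (s : Bool) (cl : V → Bool),
      (∀ b, (1 - β) * Fintype.card V ≤ 2 * #(classOf cl b)) ∧
      ∑ v, (#(classOf cl (cl v ^^ s) \ nbrs A v) : ℝ) ≤ 2 * β * (Fintype.card V : ℝ) ^ 2 := by
  obtain ⟨X, h1, h2, h3⟩ := h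
  have hβ : 0 ≤ β * (Fintype.card V : ℝ) := by
    have : (Fintype.card V : ℝ) ≤ 2 * #X := by exact_mod_cast h1
    linarith
  set cl : V → Bool := fun v => decide (v ∈ X) with hcl
  have ht : classOf cl true = X := by ext v; simp [hcl]
  have hf : classOf cl false = Xᶜ := by ext v; simp [hcl]
  have hXc := card_compl_add_card X
  have hsize : ∀ b, (1 - β) * Fintype.card V ≤ 2 * #(classOf cl b) := by
    have hXc' : (#Xᶜ + #X : ℝ) = Fintype.card V := by exact_mod_cast hXc
    have : (Fintype.card V : ℝ) ≤ 2 * #X := by exact_mod_cast h1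
    rintro (_ | _)
    · rw [hf]; linarith
    · rw [ht]; linarith
  have hsplit : ∀ f : V → ℝ, ∑ v, f v = ∑ v ∈ X, f v + ∑ v ∈ Xᶜ, f v :=
    fun f => (sum_add_sum_compl X f).symm
  rcases h3 with h3 | h3
  · refine ⟨false, cl, hsize, ?_⟩
    rw [hsplit]
    have e1 : ∑ v ∈ X, (#(classOf cl (cl v ^^ false) \ nbrs A v) : ℝ) ≤
        ∑ v ∈ X, (#(symmDiff (nbrs A v) X) : ℝ) := by
      refine Finset.sum_le_sum fun v hv => Nat.cast_le.2 (card_le_card fun w hw => ?_)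
      have : cl v = true := by simpa [hcl] using hv
      rw [Bool.xor_false, this, ht, mem_sdiff] at hw
      exact mem_symmDiff.2 (Or.inr hw)
    have e2 : ∑ v ∈ Xᶜ, (#(classOf cl (cl v ^^ false) \ nbrs A v) : ℝ) ≤
        ∑ v ∈ X, (#(symmDiff (nbrs A v) X) : ℝ) := by
      -- A vertex outside `X` has degree at least `n / 2 ≥ #Xᶜ`, so it misses no more of `Xᶜ` than
      -- it has edges into `X`. These edges are counted from the side of `X`.
      have e3 : ∑ v ∈ Xᶜ, #(classOf cl (cl v ^^ false) \ nbrs A v) ≤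
          ∑ v ∈ Xᶜ, #{x ∈ X | s(v, x) ∈ A} := by
        refine Finset.sum_le_sum fun v hv => ?_
        have : cl v = false := by simpa [hcl] using hv
        rw [Bool.xor_false, this, hf]
        have k1 := hdeg v
        have k2 := card_sdiff_add_card_inter Xᶜ (nbrs A v)
        have k3 : #(nbrs A v) ≤ #(Xᶜ ∩ nbrs A v) + #{x ∈ X | s(v, x) ∈ A} := by
          refine le_trans (card_le_card fun w hw => ?_) (card_union_le _ _)
          by_cases hwX : w ∈ X
          · exact mem_union_right _ (mem_filter.2 ⟨hwX, mem_nbrs.1 hw⟩)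
          · exact mem_union_left _ (mem_inter.2 ⟨mem_compl.2 hwX, hw⟩)
        omega
      rw [← sum_card_filter_comm (fun e => e ∈ A) X Xᶜ] at e3
      have e4 : ∑ x ∈ X, #{y ∈ Xᶜ | s(x, y) ∈ A} ≤ ∑ v ∈ X, #(symmDiff (nbrs A v) X) := by
        refine Finset.sum_le_sum fun v hv => card_le_card fun w hw => ?_
        obtain ⟨k1, k2⟩ := mem_filter.1 hw
        exact mem_symmDiff.2 (Or.inl ⟨mem_nbrs.2 k2, mem_compl.1 k1⟩)
      exact_mod_cast e3.trans e4
    linarith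
  · refine ⟨true, cl, hsize, ?_⟩
    rw [hsplit]
    have e1 : ∑ v ∈ X, (#(classOf cl (cl v ^^ true) \ nbrs A v) : ℝ) ≤
        ∑ v ∈ X, (#(symmDiff (nbrs A v) Xᶜ) : ℝ) := by
      refine Finset.sum_le_sum fun v hv => Nat.cast_le.2 (card_le_card fun w hw => ?_)
      have : cl v = true := by simpa [hcl] using hv
      rw [Bool.xor_true, this, Bool.not_true, hf, mem_sdiff] at hw
      exact mem_symmDiff.2 (Or.inr hw)
    have e2 : ∑ v ∈ Xᶜ, (#(classOf cl (cl v ^^ true) \ nbrs A v) : ℝ) ≤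
        ∑ v ∈ X, (#(symmDiff (nbrs A v) Xᶜ) : ℝ) := by
      have e3 : ∑ v ∈ Xᶜ, #(classOf cl (cl v ^^ true) \ nbrs A v) =
          ∑ v ∈ Xᶜ, #{x ∈ X | s(v, x) ∉ A} := by
        refine Finset.sum_congr rfl fun v hv => ?_
        have : cl v = false := by simpa [hcl] using hv
        rw [Bool.xor_true, this, Bool.not_false, ht]
        congr 1
        ext w
        simp
      rw [← sum_card_filter_comm (fun e => e ∉ A) X Xᶜ] at e3
      have e4 : ∑ x ∈ X, #{y ∈ Xᶜ | s(x, y) ∉ A} ≤ ∑ v ∈ X, #(symmDiff (nbrs A v) Xᶜ) := by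
        refine Finset.sum_le_sum fun v hv => card_le_card fun w hw => ?_
        obtain ⟨k1, k2⟩ := mem_filter.1 hw
        refine mem_symmDiff.2 (Or.inr ⟨k1, ?_⟩)
        rwa [mem_nbrs]
      exact_mod_cast e3.le.trans e4
    linarith

/-- Exceptional vertices can be reassigned such that every vertex has many neighbours in its
host class. -/
theorem exists_reassigned_classes {A : Finset (Sym2 V)}
    (hdeg : ∀ v, n ≤ 2 * #(nbrs A v)) {s : Bool} {cl : V → Bool} {β δ : ℝ} (hδ : 0 < δ)
    (hδ1 : δ ≤ 1 / 100) (hβδ : 2 * β ≤ δ ^ 2)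
    (hsize : ∀ b, (1 - β) * n ≤ 2 * #(classOf cl b))
    (hsum : ∑ v, (#(classOf cl (cl v ^^ s) \ nbrs A v) : ℝ) ≤ 2 * β * (n : ℝ) ^ 2) :
    ∃ (cl' : V → Bool) (Z : Finset V), (#Z : ℝ) ≤ δ * n ∧
      (∀ v, v ∉ Z → (#(classOf cl' (cl' v ^^ s) \ nbrs A v) : ℝ) ≤ 2 * δ * n) ∧
      (∀ v, (n : ℝ) / 5 ≤ #(nbrs A v ∩ classOf cl' (cl' v ^^ s))) ∧
      ∀ b, (1 / 2 - 2 * δ) * n ≤ #(classOf cl' b) := by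
  have hn0 : (0 : ℝ) < n := by exact_mod_cast NeZero.pos n
  -- The exceptional vertices; by Markov's inequality and `2 * β ≤ δ ^ 2` there are at most `δ * n`.
  obtain ⟨Z, hZ⟩ : ∃ Z : Finset V, ∀ v, v ∈ Z ↔ δ * n < #(classOf cl (cl v ^^ s) \ nbrs A v) :=
    ⟨univ.filter fun v => δ * n < #(classOf cl (cl v ^^ s) \ nbrs A v), by simp⟩
  have hZcard : (#Z : ℝ) ≤ δ * n := by
    have h1 : #Z * (δ * n) ≤ ∑ v, (#(classOf cl (cl v ^^ s) \ nbrs A v) : ℝ) := by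
      rw [← nsmul_eq_mul, ← Finset.sum_const]
      exact (Finset.sum_le_sum fun v hv => ((hZ v).1 hv).le).trans
        (Finset.sum_le_sum_of_subset_of_nonneg (subset_univ _) fun _ _ _ => Nat.cast_nonneg _)
    have h2 : #Z * (δ * n) ≤ δ * n * (δ * n) := by nlinarith
    exact le_of_mul_le_mul_right h2 (by positivity)
  have hex : ∀ v, ∃ b, n ≤ 4 * #(nbrs A v ∩ classOf cl b) := by
    intro v
    by_contra! hb
    have h1 := hdeg v
    have h2 : #(nbrs A v) ≤ #(nbrs A v ∩ classOf cl true) + #(nbrs A v ∩ classOf cl false) := by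
      refine le_trans (card_le_card fun w hw => ?_) (card_union_le _ _)
      rcases hw' : cl w with _ | _
      · exact mem_union_right _ (mem_inter.2 ⟨hw, mem_classOf.2 hw'⟩)
      · exact mem_union_left _ (mem_inter.2 ⟨hw, mem_classOf.2 hw'⟩)
    have h3 := hb true
    have h4 := hb false
    omega
  choose b hb using hex
  -- An exceptional vertex is placed so that its host class, itself or its opposite according to
  -- `s`, is one in which it had at least `n / 4` neighbours.
  set cl' : V → Bool := fun v => if v ∈ Z then b v ^^ s else cl v with hcl'
  have hsub : ∀ c, classOf cl' c ⊆ classOf cl c ∪ Z := by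
    intro c w hw
    by_cases hwZ : w ∈ Z
    · exact mem_union_right _ hwZ
    · rw [mem_classOf, hcl'] at hw
      simp only [hwZ, if_false] at hw
      exact mem_union_left _ (mem_classOf.2 hw)
  have hsub' : ∀ c, classOf cl c ⊆ classOf cl' c ∪ Z := by
    intro c w hw
    by_cases hwZ : w ∈ Z
    · exact mem_union_right _ hwZ
    · rw [mem_classOf] at hw
      refine mem_union_left _ (mem_classOf.2 ?_)
      simp only [hcl', hwZ, if_false, hw]
  have hsize' : ∀ c, (1 / 2 - 2 * δ) * n ≤ #(classOf cl' c) := by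
    intro c
    have h1 := (card_le_card (hsub' c)).trans (card_union_le _ _)
    have h2 : (#(classOf cl c) : ℝ) ≤ #(classOf cl' c) + #Z := by exact_mod_cast h1
    have h3 := hsize c
    nlinarith
  have hmiss : ∀ v, v ∉ Z → (#(classOf cl' (cl' v ^^ s) \ nbrs A v) : ℝ) ≤ 2 * δ * n := by
    intro v hv
    have h1 : cl' v = cl v := by simp only [hcl', hv, if_false]
    rw [h1]
    have h2 : #(classOf cl' (cl v ^^ s) \ nbrs A v) ≤ #(classOf cl (cl v ^^ s) \ nbrs A v) + #Z := by
      refine le_trans (card_le_card fun w hw => ?_) (card_union_le _ _)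
      obtain ⟨h3, h4⟩ := mem_sdiff.1 hw
      rcases mem_union.1 (hsub _ h3) with h5 | h5
      · exact mem_union_left _ (mem_sdiff.2 ⟨h5, h4⟩)
      · exact mem_union_right _ h5
    have h3 : (#(classOf cl' (cl v ^^ s) \ nbrs A v) : ℝ) ≤
        #(classOf cl (cl v ^^ s) \ nbrs A v) + #Z := by exact_mod_cast h2
    have h4 := not_lt.1 (mt (hZ v).2 hv)
    linarith
  refine ⟨cl', Z, hZcard, hmiss, fun v => ?_, hsize'⟩
  by_cases hv : v ∈ Z
  · have h1 : (cl' v ^^ s) = b v := by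
      simp only [hcl', hv, if_true]
      cases b v <;> cases s <;> rfl
    rw [h1]
    have h2 : #(nbrs A v ∩ classOf cl (b v)) ≤ #(nbrs A v ∩ classOf cl' (b v)) + #Z := by
      refine le_trans (card_le_card fun w hw => ?_) (card_union_le _ _)
      obtain ⟨h3, h4⟩ := mem_inter.1 hw
      rcases mem_union.1 (hsub' _ h4) with h5 | h5
      · exact mem_union_left _ (mem_inter.2 ⟨h3, h5⟩)
      · exact mem_union_right _ h5
    have h3 : (n : ℝ) ≤ 4 * (#(nbrs A v ∩ classOf cl' (b v)) + #Z) := by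
      exact_mod_cast (hb v).trans (Nat.mul_le_mul_left _ h2)
    nlinarith
  · have h1 := hmiss v hv
    have h2 := hsize' (cl' v ^^ s)
    have h3 := card_sdiff_add_card_inter (classOf cl' (cl' v ^^ s)) (nbrs A v)
    rw [inter_comm] at h3
    have h4 : (#(classOf cl' (cl' v ^^ s) \ nbrs A v) : ℝ) + #(nbrs A v ∩ classOf cl' (cl' v ^^ s)) =
      #(classOf cl' (cl' v ^^ s)) := by exact_mod_cast h3
    nlinarith

theorem nbrs_inter_sameClass (A : Finset (Sym2 V)) (cl : V → Bool) (v : V) :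
    nbrs (A ∩ sameClass cl) v = nbrs A v ∩ classOf cl (cl v) := by
  ext w
  rw [mem_nbrs, mem_inter, mem_inter, mem_nbrs, mem_sameClass, mem_classOf, @eq_comm _ (cl v)]

theorem nbrs_sameClass_sdiff (A : Finset (Sym2 V)) (cl : V → Bool) (v : V) :
    nbrs (sameClass cl \ A) v = classOf cl (cl v) \ nbrs A v := by
  ext w
  rw [mem_nbrs, mem_sdiff, mem_sdiff, mem_nbrs, mem_sameClass, mem_classOf, @eq_comm _ (cl v)]

theorem nbrs_inter_crossClass (A : Finset (Sym2 V)) (cl : V → Bool) (v : V) :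
    nbrs (A ∩ crossClass cl) v = nbrs A v ∩ classOf cl (!cl v) := by
  ext w
  rw [mem_nbrs, mem_inter, mem_inter, mem_nbrs, mem_crossClass, mem_classOf]
  cases cl v <;> cases cl w <;> simp

theorem nbrs_crossClass_sdiff (A : Finset (Sym2 V)) (cl : V → Bool) (v : V) :
    nbrs (crossClass cl \ A) v = classOf cl (!cl v) \ nbrs A v := by
  ext w
  rw [mem_nbrs, mem_sdiff, mem_sdiff, mem_nbrs, mem_crossClass, mem_classOf]
  cases cl v <;> cases cl w <;> simp

/-- Vertices can be moved from the larger to the smaller class until the classes have almost the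
same size or the larger class is sparse. -/
theorem exists_balanced_classes (hcard : Fintype.card V = n) {A : Finset (Sym2 V)}
    {cl : V → Bool} {Z : Finset V} {δ : ℝ} (hδ1 : δ ≤ 1 / 5000)
    (hZ : (#Z : ℝ) ≤ δ * n)
    (hmiss : ∀ v, v ∉ Z → (#(classOf cl (!cl v) \ nbrs A v) : ℝ) ≤ 2 * δ * n)
    (hnb : ∀ v, (n : ℝ) / 5 ≤ #(nbrs A v ∩ classOf cl (!cl v)))
    (hsize : ∀ b, (1 / 2 - 2 * δ) * n ≤ #(classOf cl b))
    (hle : #(classOf cl false) ≤ #(classOf cl true)) :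
    ∃ (cl' : V → Bool) (X : Finset V) (d : ℕ), #(classOf cl' true) = #(classOf cl' false) + d ∧
      (d : ℝ) ≤ n / 1024 ∧
      (d ≤ 1 ∨ ∀ v, cl' v = true → 32 * #(nbrs A v ∩ classOf cl' true) ≤ n) ∧
      (∀ v, (n : ℝ) / 64 ≤ #(nbrs A v ∩ classOf cl' (!cl' v))) ∧ (#X : ℝ) ≤ n / 512 ∧
      ∀ v, v ∉ X → (#(classOf cl' (!cl' v) \ nbrs A v) : ℝ) ≤ n / 512 := by
  have hn0 : (0 : ℝ) < n := by exact_mod_cast NeZero.pos n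
  have hsum := card_classOf_add cl true
  rw [hcard, Bool.not_true] at hsum
  obtain ⟨d, hd⟩ : ∃ d, #(classOf cl true) = #(classOf cl false) + d :=
    Nat.exists_eq_add_of_le hle
  have hdn : (d : ℝ) ≤ 4 * δ * n := by
    have h1 := hsize false
    have h2 : (2 * #(classOf cl false) + d : ℝ) = n := by
      have : 2 * #(classOf cl false) + d = n := by omega
      exact_mod_cast this
    linarith
  -- Vertices with many neighbours in their own class do well on the other side too. At most `d / 2`
  -- of them are moved; if they run out first, the larger class has become sparse.
  obtain ⟨M₀, hM₀⟩ : ∃ M₀ : Finset V, ∀ v, v ∈ M₀ ↔ cl v = true ∧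
      n < 32 * #(nbrs A v ∩ classOf cl true) :=
    ⟨univ.filter fun v => cl v = true ∧ n < 32 * #(nbrs A v ∩ classOf cl true), by simp⟩
  obtain ⟨M, hMM, hMcard⟩ := exists_subset_card_eq (Nat.min_le_left #M₀ (d / 2))
  have hMd : 2 * #M ≤ d := by omega
  have hMn : (#M : ℝ) ≤ 2 * δ * n := by
    have : (2 * #M : ℝ) ≤ d := by exact_mod_cast hMd
    linarith
  have hMcl : ∀ v ∈ M, cl v = true := fun v hv => ((hM₀ v).1 (hMM hv)).1
  set cl' : V → Bool := fun v => if v ∈ M then false else cl v with hcl'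
  have ht : classOf cl' true = classOf cl true \ M := by
    ext v
    by_cases hv : v ∈ M <;> simp [hcl', hv]
  have hf : classOf cl' false = classOf cl false ∪ M := by
    ext v
    by_cases hv : v ∈ M <;> simp [hcl', hv]
  have hct : #(classOf cl' true) + #M = #(classOf cl true) := by
    rw [ht]
    exact card_sdiff_add_card_eq_card fun v hv => mem_classOf.2 (hMcl v hv)
  have hcf : #(classOf cl' false) = #(classOf cl false) + #M := by
    rw [hf, card_union_of_disjoint]
    rw [disjoint_left]
    intro v h1 h2
    rw [mem_classOf, hMcl v h2] at h1
    exact absurd h1 (by simp)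
  have hsub : ∀ b, classOf cl' b ⊆ classOf cl b ∪ M := by
    rintro (_ | _)
    · rw [hf]
    · rw [ht]; exact sdiff_subset.trans subset_union_left
  have hsub' : ∀ b, classOf cl b ⊆ classOf cl' b ∪ M := by
    rintro (_ | _)
    · rw [hf, union_assoc, union_self]; exact subset_union_left
    · rw [ht, sdiff_union_self_eq_union]; exact subset_union_left
  have hnb' : ∀ v b, (#(nbrs A v ∩ classOf cl b) : ℝ) ≤ #(nbrs A v ∩ classOf cl' b) + #M := by
    intro v b
    have : #(nbrs A v ∩ classOf cl b) ≤ #(nbrs A v ∩ classOf cl' b) + #M := by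
      refine le_trans (card_le_card fun w hw => ?_) (card_union_le _ _)
      obtain ⟨h1, h2⟩ := mem_inter.1 hw
      rcases mem_union.1 (hsub' _ h2) with h3 | h3
      · exact mem_union_left _ (mem_inter.2 ⟨h1, h3⟩)
      · exact mem_union_right _ h3
    exact_mod_cast this
  have hδn : δ * n ≤ n / 5000 := by nlinarith
  refine ⟨cl', Z ∪ M, d - 2 * #M, by omega, ?_, ?_, fun v => ?_, ?_, fun v hv => ?_⟩
  · have : ((d - 2 * #M : ℕ) : ℝ) ≤ d := by exact_mod_cast Nat.sub_le _ _
    linarith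
  · by_cases hlt : #M₀ < d / 2
    · right
      have hMeq : M = M₀ := eq_of_subset_of_card_le hMM (by omega)
      intro v hv
      have hvM : v ∉ M := by
        intro h
        simp only [hcl', h, if_true] at hv
        exact absurd hv (by simp)
      have hv' : cl v = true := by simpa only [hcl', hvM, if_false] using hv
      rw [hMeq, hM₀, not_and, not_lt] at hvM
      refine le_trans (Nat.mul_le_mul_left _ (card_le_card ?_)) (hvM hv')
      rw [ht]
      exact inter_subset_inter_left sdiff_subset
    · left
      omega
  · by_cases hv : v ∈ M
    · have h1 : cl' v = false := by simp only [hcl', hv, if_true]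
      rw [h1, Bool.not_false]
      have h2 := ((hM₀ v).1 (hMM hv)).2
      have h3 : (n : ℝ) ≤ 32 * #(nbrs A v ∩ classOf cl true) := by exact_mod_cast h2.le
      have h4 := hnb' v true
      linarith
    · have h1 : cl' v = cl v := by simp only [hcl', hv, if_false]
      rw [h1]
      have h2 := hnb v
      have h3 := hnb' v (!cl v)
      linarith
  · have h1 : (#(Z ∪ M) : ℝ) ≤ #Z + #M := by exact_mod_cast card_union_le Z M
    linarith
  · rw [mem_union, not_or] at hv
    have h1 : cl' v = cl v := by simp only [hcl', hv.2, if_false]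
    rw [h1]
    have h2 : #(classOf cl' (!cl v) \ nbrs A v) ≤ #(classOf cl (!cl v) \ nbrs A v) + #M := by
      refine le_trans (card_le_card fun w hw => ?_) (card_union_le _ _)
      obtain ⟨h3, h4⟩ := mem_sdiff.1 hw
      rcases mem_union.1 (hsub _ h3) with h5 | h5
      · exact mem_union_left _ (mem_sdiff.2 ⟨h5, h4⟩)
      · exact mem_union_right _ h5
    have h3 : (#(classOf cl' (!cl v) \ nbrs A v) : ℝ) ≤
        #(classOf cl (!cl v) \ nbrs A v) + #M := by exact_mod_cast h2
    have h4 := hmiss v hv.1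
    linarith

theorem HasSpread.mono {E : Type*} [Fintype E] [DecidableEq E] {q q' : ℝ} {𝓗 : Finset (Finset E)}
    {F : Finset E} (h : HasSpread q 𝓗 F) (hq : 0 ≤ q) (hqq : q ≤ q') : HasSpread q' 𝓗 F := by
  obtain ⟨μ, h0, hs, h1, hS⟩ := h
  exact ⟨μ, h0, hs, h1, fun S => (hS S).trans (by gcongr)⟩

/-- The Hamilton cycles of a Dirac graph support a spread distribution. -/
theorem exists_hasSpread_hamCycles : ∃ C : ℝ, 0 < C ∧ ∃ N : ℕ, ∀ n : ℕ, N ≤ n → ∀ [NeZero n],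
    ∀ A : Finset (Sym2 (Fin n)), (∀ v, s(v, v) ∉ A) → (∀ v, n ≤ 2 * #(nbrs A v)) →
      HasSpread (C / n) (hamCycles n A) ∅ := by
  -- With `β = 100 * θ` the reassignment needs `200 * θ ≤ δ ^ 2`, and `n ≥ 10 ^ 23` ensures `θ ^ 2 *
  -- n ≥ 100`.
  obtain ⟨θ, hθ⟩ : ∃ θ : ℝ, θ = 1 / 10 ^ 10 := ⟨_, rfl⟩
  obtain ⟨δ, hδ⟩ : ∃ δ : ℝ, δ = 1 / 5000 := ⟨_, rfl⟩
  have hrate : ∀ γ : ℝ, 0 < γ → 0 < nearCompleteRate γ := by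
    intro γ hγ
    unfold nearCompleteRate spreadConst
    positivity
  have hrate0 : 0 < spreadConst (θ ^ 2 / 10) (θ ^ 2 / 10) 1 := by
    unfold spreadConst
    rw [hθ]
    positivity
  set C : ℝ := spreadConst (θ ^ 2 / 10) (θ ^ 2 / 10) 1 + (8 / (1 / 5) ^ 2 + nearCompleteRate (1 / 5)) +
    (16 + nearCompleteRate (1 / 64)) with hC
  have k1 := hrate (1 / 5) (by norm_num)
  have k2 := hrate (1 / 64) (by norm_num)
  refine ⟨C, by positivity, 10 ^ 23, ?_⟩
  intro n hn _ A hdiag hdeg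
  have hn' : (10 ^ 23 : ℝ) ≤ n := by exact_mod_cast hn
  have hn0 : (0 : ℝ) < n := by linarith
  have hcard : Fintype.card (Fin n) = n := Fintype.card_fin n
  have hn3 : 3 ≤ n := le_trans (by norm_num) hn
  by_cases hA : NearExtremal A (100 * θ)
  · obtain ⟨s, cl, hsz, hsum⟩ := hA.exists_classes (by rwa [hcard])
    rw [hcard] at hsz hsum
    obtain ⟨cl', Z, hZ, hmiss, hnb, hsize⟩ := exists_reassigned_classes hdeg (δ := δ)
      (by rw [hδ]; norm_num) (by rw [hδ]; norm_num) (by rw [hδ, hθ]; norm_num) hsz hsum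
    have hδn : δ * n = n / 5000 := by rw [hδ]; ring
    cases s
    · simp only [Bool.xor_false] at hmiss hnb
      have := hasSpread_of_sameClass hcard cl' hdiag hdeg (X := Z) (γ := 1 / 5) (by norm_num)
        (by norm_num) (by linarith)
        (fun b => by have := hsize b; nlinarith)
        (fun v => by rw [nbrs_inter_sameClass]; have := hnb v; linarith) (by linarith)
        (fun v hv => by rw [nbrs_sameClass_sdiff]; have := hmiss v hv; linarith)
      refine this.mono (by positivity) ?_
      gcongr
      rw [hC]
      linarith
    · simp only [Bool.xor_true] at hmiss hnb
      have hfin : ∀ cl' : Fin n → Bool,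
          (∀ v, v ∉ Z → (#(classOf cl' (!cl' v) \ nbrs A v) : ℝ) ≤ 2 * δ * n) →
          (∀ v, (n : ℝ) / 5 ≤ #(nbrs A v ∩ classOf cl' (!cl' v))) →
          (∀ b, (1 / 2 - 2 * δ) * n ≤ #(classOf cl' b)) →
          #(classOf cl' false) ≤ #(classOf cl' true) → HasSpread (C / n) (hamCycles n A) ∅ := by
        intro cl' hmiss hnb hsize hle
        obtain ⟨cl'', X, d, h1, h2, h3, h4, h5, h6⟩ := exists_balanced_classes hcard hδ.le hZ hmiss
          hnb hsize hle
        have := hasSpread_of_crossClass hcard cl'' hdiag hdeg (X := X) (γ := 1 / 64) (by norm_num)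
          (by linarith) hn3 h1 (by linarith) h3
          (fun v => by rw [nbrs_inter_crossClass]; have := h4 v; linarith) (by linarith)
          (fun v hv => by rw [nbrs_crossClass_sdiff]; have := h6 v hv; linarith)
        refine this.mono (by positivity) ?_
        gcongr
        rw [hC]
        have : (0 : ℝ) < 8 / (1 / 5) ^ 2 := by positivity
        linarith
      rcases le_total #(classOf cl' false) #(classOf cl' true) with hle | hle
      · exact hfin cl' hmiss hnb hsize hle
      · have hc : ∀ b, classOf (fun v => !cl' v) b = classOf cl' !b := by
          intro b
          ext v
          simp only [mem_classOf]
          cases cl' v <;> cases b <;> simp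
        refine hfin (fun v => !cl' v) (fun v hv => ?_) (fun v => ?_) (fun b => ?_) ?_
        · rw [hc, Bool.not_not]; exact hmiss v hv
        · rw [hc, Bool.not_not]; exact hnb v
        · rw [hc]; exact hsize _
        · rw [hc, hc]; exact hle
  -- Away from the extremal cases the host is the complete graph, no edges are prescribed, and `D =
  -- 1`.
  · have hflex := flexible_of_not_nearExtremal (n := n) hdiag hdeg (θ := θ) (by rw [hθ]; norm_num)
      (by rw [hθ]; norm_num) (by rw [hθ]; linarith) hA
    have := hflex.hasSpread hn3 (B := A) (D := 1) (by rw [hθ]; norm_num) (by rw [hθ]; norm_num) le_rfl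
      (subset_univ _) (by rw [card_empty, Nat.cast_zero]; positivity)
      (by rw [union_empty, one_pow, one_mul])
      ⟨Equiv.refl _, by rw [mem_tours, union_empty]; exact ⟨empty_subset _, subset_univ _⟩⟩
      (by rw [union_empty])
    refine this.mono (by positivity) ?_
    gcongr
    rw [hC]
    have : (0 : ℝ) < 8 / (1 / 5) ^ 2 := by positivity
    linarith

end Structure

/-! ### The threshold for Hamiltonicity. -/

section Conclusion

theorem SimpleGraph.isHamiltonian_of_tour {V : Type*} [Fintype V] [DecidableEq V] {n : ℕ}
    [NeZero n] (hn : 3 ≤ n) (σ : Fin n ≃ V) (G : SimpleGraph V)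
    (h : ∀ i, G.Adj (vtx σ i) (vtx σ (i + 1))) : G.IsHamiltonian := by
  obtain ⟨m, rfl⟩ := Nat.exists_eq_add_of_le' hn
  have key : ∀ u : Fin (m + 3), G.Adj (σ u) (σ (u + 1)) := by
    intro u
    have h1 := h u
    rw [vtx_fin] at h1
    have h2 : vtx σ ((u : ℕ) + 1) = σ (u + 1) := by
      rw [← vtx_fin, ← vtx_mod]
      congr 1
    rwa [h2] at h1
  let f : SimpleGraph.cycleGraph (m + 3) →g G :=
    { toFun := σ
      map_rel' := by
        intro u w huw
        rw [SimpleGraph.cycleGraph_adj] at huw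
        rcases huw with huw | huw
        · rw [sub_eq_iff_eq_add'.1 huw, G.adj_comm]
          exact key w
        · rw [sub_eq_iff_eq_add'.1 huw]
          exact key u }
  have hc : (SimpleGraph.cycleGraph.cycle m).IsHamiltonianCycle := by
    rw [SimpleGraph.Walk.isHamiltonianCycle_iff_isCycle_and_length_eq]
    exact ⟨SimpleGraph.cycleGraph.isCycle_cycle, by
      rw [SimpleGraph.cycleGraph.length_cycle, Fintype.card_fin]⟩
  intro _
  exact ⟨_, _, hc.map (f := f) σ.bijective⟩

theorem exists_isHamiltonian_of_log_div_le : ∃ C : ℝ, 0 < C ∧ ∀ η : ℝ, 0 < η →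
    ∃ N : ℕ, ∀ n : ℕ, N ≤ n → ∀ (G : SimpleGraph (Fin n)) [DecidableRel G.Adj], G.IsDirac →
      ∀ p : unitInterval, C * Real.log n / n ≤ (p : ℝ) →
        1 - η ≤ (G.randomSubgraph p).real {H | H.IsHamiltonian} := by
  obtain ⟨C, hC, N₀, hN₀⟩ := exists_hasSpread_hamCycles
  -- The last round uses density `C * log n / n`, and the at most `3 * log n` halving rounds use `16
  -- * C / n` each.
  refine ⟨49 * C, by positivity, fun η hη => ?_⟩
  -- `m` depends on `η` only. The other error `(1 + 1 / log n) ^ m - 1` then vanishes as `n` grows,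
  -- so `C` does not depend on `η`.
  obtain ⟨m, hm0, hm⟩ : ∃ m : ℕ, 0 < m ∧ 2 * (1 / 4 : ℝ) ^ m < η / 2 := by
    obtain ⟨m, hm⟩ := exists_pow_lt_of_lt_one (show 0 < η / 4 by positivity)
      (show (1 / 4 : ℝ) < 1 by norm_num)
    refine ⟨m + 1, by omega, ?_⟩
    have : (0 : ℝ) < (1 / 4) ^ m := by positivity
    rw [pow_succ]
    linarith
  have hlim : Filter.Tendsto (fun n : ℕ => (1 + 1 / Real.log n) ^ m) Filter.atTop (nhds 1) := by
    have h1 : Filter.Tendsto (fun n : ℕ => 1 + 1 / Real.log n) Filter.atTop (nhds (1 + 0)) := by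
      refine Filter.Tendsto.add tendsto_const_nhds ?_
      simp_rw [one_div]
      exact (Real.tendsto_log_atTop.comp tendsto_natCast_atTop_atTop).inv_tendsto_atTop
    have h2 := h1.pow m
    simpa using h2
  obtain ⟨N₁, hN₁⟩ := Filter.eventually_atTop.1
    (hlim.eventually (gt_mem_nhds (show (1 : ℝ) < 1 + η / 2 by linarith)))
  refine ⟨max N₀ (max N₁ 3), fun n hn G _ hG p hp => ?_⟩
  have hn0 := (le_max_left _ _).trans hn
  have hn1 := ((le_max_left _ _).trans (le_max_right _ _)).trans hn
  have hn3 : 3 ≤ n := ((le_max_right _ _).trans (le_max_right _ _)).trans hn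
  have : NeZero n := ⟨by omega⟩
  have hnR : (3 : ℝ) ≤ n := by exact_mod_cast hn3
  have hlog : 1 ≤ Real.log n := by
    rw [Real.le_log_iff_exp_le (by linarith)]
    linarith [Real.exp_one_lt_three]
  have hdiag : ∀ v, s(v, v) ∉ G.edgeFinset := fun v hv => by
    rw [SimpleGraph.mem_edgeFinset, SimpleGraph.mem_edgeSet] at hv
    exact G.irrefl hv
  have hdeg : ∀ v, n ≤ 2 * #(nbrs G.edgeFinset v) := by
    intro v
    have h1 : nbrs G.edgeFinset v = G.neighborFinset v := by
      ext w
      rw [mem_nbrs, SimpleGraph.mem_edgeFinset, SimpleGraph.mem_edgeSet,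
        SimpleGraph.mem_neighborFinset]
    rw [h1, SimpleGraph.card_neighborFinset_eq_degree]
    have h2 : (n : ℝ) / 2 ≤ G.minDegree := by
      have := hG
      unfold SimpleGraph.IsDirac at this
      rwa [Fintype.card_fin] at this
    have h3 : (G.minDegree : ℝ) ≤ G.degree v := by exact_mod_cast G.minDegree_le_degree v
    have h4 : (n : ℝ) ≤ 2 * G.degree v := by linarith
    exact_mod_cast h4
  have hcover := (hN₀ n hn0 G.edgeFinset hdiag hdeg).coverCost
  have hclog : n ≤ 2 ^ Nat.clog 2 n := Nat.le_pow_clog (by norm_num) n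
  have hk : (Nat.clog 2 n : ℝ) ≤ 3 * Real.log n := by
    have h1 : Nat.clog 2 n ≤ Nat.log 2 n + 1 :=
      Nat.clog_le_of_le_pow (Nat.lt_pow_succ_log_self (by norm_num) n).le
    have h2 : ((2 : ℝ)) ^ Nat.log 2 n ≤ n := by
      exact_mod_cast Nat.pow_log_le_self 2 (show n ≠ 0 by omega)
    have h3 := Real.log_le_log (by positivity) h2
    rw [Real.log_pow] at h3
    have h4 : (Nat.clog 2 n : ℝ) ≤ Nat.log 2 n + 1 := by exact_mod_cast h1
    have h5 := Real.log_two_gt_d9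
    nlinarith
  have hfail := failProb_le_of_coverCost (p := p) (q := C / n) (L := Real.log n) (by linarith)
    (by positivity) (k := Nat.clog 2 n) hm0 p.2.2 (by
      refine le_trans ?_ hp
      rw [div_mul_eq_mul_div, mul_div_assoc', div_mul_eq_mul_div, ← add_div]
      gcongr
      nlinarith) (hamCycles n G.edgeFinset) (by
      intro H hH
      obtain ⟨σ, _, rfl⟩ := mem_image.1 hH
      rw [card_cycEdges hn3]
      exact hclog.trans (Nat.le_mul_of_pos_right _ hm0)) hcover
  refine le_trans ?_ (G.one_sub_failProb_le p {H | H.IsHamiltonian} (hamCycles n G.edgeFinset) ?_ ?_)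
  · have := hN₁ n hn1
    linarith
  · intro H hH
    obtain ⟨σ, hσ, rfl⟩ := mem_image.1 hH
    exact (mem_tours.1 hσ).2
  · intro H hH W hW
    obtain ⟨σ, hσ, rfl⟩ := mem_image.1 hH
    refine SimpleGraph.isHamiltonian_of_tour hn3 σ _ fun i => ?_
    have h1 : tourEdge σ i ∈ cycEdges σ :=
      mem_cycEdges.2 ⟨i % n, Nat.mod_lt _ (by omega), tourEdge_mod σ i⟩
    rw [SimpleGraph.fromEdgeSet_adj]
    refine ⟨hW h1, fun h => ?_⟩
    have h2 := (mem_tours.1 hσ).2 h1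
    rw [tourEdge, ← h] at h2
    exact hdiag _ h2

end Conclusion

theorem theorem1p1 :
    -- there is an absolute constant `C` such that, for `p ≥ C log n / n`, the random subgraph
    -- of a Dirac graph is a.a.s. Hamiltonian
    (∃ C : ℝ, 0 < C ∧ ∀ η : ℝ, 0 < η → ∃ N : ℕ, ∀ n : ℕ, N ≤ n →
      ∀ (G : SimpleGraph (Fin n)) [DecidableRel G.Adj], G.IsDirac →
      ∀ p : unitInterval, C * Real.log n / n ≤ (p : ℝ) →
        1 - η ≤ (G.randomSubgraph p).real {H | H.IsHamiltonian}) ∧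
    -- tightness: for `p ≤ c log n / n` with a constant `c < 1`, it a.a.s. has an isolated vertex
    -- and is a.a.s. not Hamiltonian
    (∀ c : ℝ, c < 1 → ∀ η : ℝ, 0 < η → ∃ N : ℕ, ∀ n : ℕ, N ≤ n →
      ∀ (G : SimpleGraph (Fin n)) [DecidableRel G.Adj], G.IsDirac →
      ∀ p : unitInterval, (p : ℝ) ≤ c * Real.log n / n →
        1 - η ≤ (G.randomSubgraph p).real {H | ∃ v, H.IsIsolated v} ∧
        1 - η ≤ (G.randomSubgraph p).real {H | ¬ H.IsHamiltonian}) := by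
  refine ⟨exists_isHamiltonian_of_log_div_le, fun c hc η hη => ?_⟩
  obtain ⟨N, hN⟩ := exists_isIsolated_of_le_log_div c hc η hη
  exact ⟨N, fun n hn G _ _ p hp => hN n hn G p hp⟩
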